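/- **Theorem (Sparse Linear Encoder).** For a real matrix $A$ of rank $\rho$, let $A=U\Sigma V^{T}$ be its singular value decomposition, where $U,V$ have $\rho$ orthonormal columns and $\Sigma=\mathrm{diag}(\sigma_1\ge\dots\ge\sigma_\rho>0)$. Let $A^\dagger=V\Sigma^{-1}U^{T}$ be its pseudo-inverse, let $A_k$ be obtained from the decomposition by replacing all but the top $k$ singular values by $0$, and let $\|A\|_F^2=\sum_{ij}A_{ij}^2$. Consider random access machines with exact real arithmetic. Integer additions and (truncated) subtractions, real operations $+,-,\times,/,\sqrt{\cdot}$, comparisons, memory accesses and draws of independent uniform random numbers from $[0,1]$ cost one unit of time each. A subroutine returns a singular value decomposition of a $p\times q$ matrix at the customary cost of $pq\min(p,q)$, up to a constant factor; it may return any of the decompositions of that matrix. There are a single randomized program on such a machine and an absolute constant $C$ such that the following holds, whichever decompositions the subroutine returns. Let $n,d\ge 1$, let $X\in\mathbb{R}^{n\times d}$ have rank $\rho$, and let $k,r\ge 0$ be integers with $k\le\rho$ and $r>5k$. On input $X,k,r$ the program always stops within $$C\,\bigl(ndr+(n+d)r^2+dk^3\bigr)$$ steps, and outputs a matrix (linear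 encoder) $H\in\mathbb{R}^{d\times k}$ that is always $r$-sparse, i.e. every column of $H$ has at most $r$ non-zero entries. The expected information loss, over the random numbers drawn by the program, satisfies $$\mathbb{E}\Bigl[\bigl\|X-XH(XH)^\dagger X\bigr\|_F^2\Bigr]\le\Bigl(1+\frac{5k}{r-5k}\Bigr)\,\|X-X_k\|_F^2 .$$ -/

import Mathlib

namespace SparseEncoder

noncomputable section

/-! ### Linear algebra -/

/-- A (compact) singular value decomposition `A = U Σ Vᵀ` of a real matrix: `ρ = rank A`
orthonormal left and right singular vectors (the columns of `U` and `V`), and positive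
singular values in decreasing order. -/
structure SVD {m n : ℕ} (A : Matrix (Fin m) (Fin n) ℝ) where
  U : Matrix (Fin m) (Fin A.rank) ℝ
  σ : Fin A.rank → ℝ
  V : Matrix (Fin n) (Fin A.rank) ℝ
  orthU : U.transpose * U = 1
  orthV : V.transpose * V = 1
  pos : ∀ t, 0 < σ t
  anti : Antitone σ
  eq : A = U * Matrix.diagonal σ * V.transpose

/-- Every real matrix has a singular value decomposition. -/
theorem SVD.nonempty {m n : ℕ} (A : Matrix (Fin m) (Fin n) ℝ) : Nonempty (SVD A) := by
  have hM : (A.transpose * A).IsHermitian := by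
    simpa using Matrix.isHermitian_conjTranspose_mul_self A
  let p := Tuple.sort (fun i => -hM.eigenvalues i)
  let μ : Fin n → ℝ := fun j => hM.eigenvalues (p j)
  have hanti : Antitone μ := fun i j hij => by
    have := Tuple.monotone_sort (fun i => -hM.eigenvalues i) hij
    simpa [μ, p] using this
  obtain ⟨W, hWd⟩ : ∃ W : Matrix (Fin n) (Fin n) ℝ,
      ∀ i j, W i j = hM.eigenvectorBasis (p j) i := ⟨Matrix.of fun i j => _, fun _ _ => rfl⟩
  have hW : W.transpose * W = 1 := by
    ext i j
    have h := orthonormal_iff_ite.1 hM.eigenvectorBasis.orthonormal (p i) (p j)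
    rw [PiLp.inner_apply] at h
    simp only [Matrix.mul_apply, Matrix.transpose_apply, Matrix.one_apply, hWd]
    simp only [EmbeddingLike.apply_eq_iff_eq] at h
    rw [← h]
    exact Finset.sum_congr rfl fun x _ => by simp [mul_comm]
  have hW' : W * W.transpose = 1 := mul_eq_one_comm.1 hW
  have hMW : A.transpose * A * W = W * Matrix.diagonal μ := by
    ext i j
    have h := congrFun (hM.mulVec_eigenvectorBasis (p j)) i
    rw [Matrix.mul_diagonal, mul_comm]
    simpa [Matrix.mul_apply, Matrix.mulVec, dotProduct, hWd, μ] using h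
  obtain ⟨B, hBd⟩ : ∃ B, B = A * W := ⟨_, rfl⟩
  have hB : B.transpose * B = Matrix.diagonal μ := by
    have : B.transpose * B = W.transpose * (A.transpose * A * W) := by
      simp only [hBd, Matrix.transpose_mul, Matrix.mul_assoc]
    rw [this, hMW, ← Matrix.mul_assoc, hW, Matrix.one_mul]
  have hBe : ∀ i j, ∑ x, B x i * B x j = if i = j then μ i else 0 := fun i j => by
    have := congrFun (congrFun hB i) j
    simpa [Matrix.mul_apply, Matrix.diagonal_apply] using this
  have hnn : ∀ j, 0 ≤ μ j := fun j => by
    have := hBe j j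
    rw [if_pos rfl] at this
    rw [← this]
    exact Finset.sum_nonneg fun x _ => mul_self_nonneg _
  have hrank : A.rank = (Finset.univ.filter fun i => 0 < μ i).card := by
    rw [← Matrix.rank_transpose_mul_self A, hM.rank_eq_card_non_zero_eigs, Fintype.card_subtype]
    refine (Finset.card_equiv p fun i => ?_).symm
    simp only [Finset.mem_filter, Finset.mem_univ, true_and]
    exact ⟨fun h => ne_of_gt h, fun h => lt_of_le_of_ne (hnn i) (Ne.symm h)⟩
  have hpos : ∀ j : Fin n, (j : ℕ) < A.rank ↔ 0 < μ j := fun j => by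
    rw [hrank]
    exact Tuple.lt_card_gt_iff_apply_gt_of_antitone hanti
  have hle : A.rank ≤ n := by simpa using A.rank_le_width
  let c : Fin A.rank ↪ Fin n := Fin.castLEEmb hle
  have hc : ∀ t, 0 < μ (c t) := fun t => (hpos _).1 t.2
  have hB0 : ∀ i j, j ∉ Set.range c → B i j = 0 := fun i j hj => by
    have h0 : μ j = 0 := by
      refine le_antisymm (not_lt.1 fun h => hj ⟨⟨j, (hpos j).2 h⟩, rfl⟩) (hnn j)
    have := hBe j j
    rw [if_pos rfl, h0, Finset.sum_eq_zero_iff_of_nonneg fun x _ => mul_self_nonneg _] at this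
    exact mul_self_eq_zero.1 (this i (Finset.mem_univ i))
  refine ⟨⟨Matrix.of fun i t => B i (c t) / √(μ (c t)), fun t => √(μ (c t)),
    Matrix.of fun i t => W i (c t), ?_, ?_, fun t => Real.sqrt_pos.2 (hc t), fun s t hst => Real.sqrt_le_sqrt (hanti hst), ?_⟩⟩
  · ext s t
    have h := hBe (c s) (c t)
    simp only [Matrix.mul_apply, Matrix.transpose_apply, Matrix.one_apply, Matrix.of_apply]
    have hst : ∀ x, B x (c s) / √(μ (c s)) * (B x (c t) / √(μ (c t))) =
        (B x (c s) * B x (c t)) / (√(μ (c s)) * √(μ (c t))) := fun x => by ring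
    simp only [hst]
    rw [← Finset.sum_div, h]
    by_cases hs : s = t
    · subst hs
      simp [Real.mul_self_sqrt (hnn _), (hc s).ne']
    · simp [hs]
  · ext s t
    have h := congrFun (congrFun hW (c s)) (c t)
    simpa [Matrix.mul_apply, Matrix.one_apply] using h
  · have hA : A = B * W.transpose := by
      rw [hBd, Matrix.mul_assoc, hW', Matrix.mul_one]
    ext i j
    have hA' : A i j = ∑ x, B i x * W j x := by
      conv_lhs => rw [hA]
      simp [Matrix.mul_apply]
    rw [hA', Matrix.mul_apply]
    simp only [Matrix.mul_diagonal, Matrix.transpose_apply, Matrix.of_apply]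
    have hs : ∀ t, B i (c t) / √(μ (c t)) * √(μ (c t)) = B i (c t) := fun t =>
      div_mul_cancel₀ _ (Real.sqrt_pos.2 (hc t)).ne'
    simp only [hs]
    rw [← Finset.sum_map Finset.univ c (fun x => B i x * W j x)]
    refine (Finset.sum_subset (Finset.subset_univ _) fun x _ hx => ?_).symm
    rw [hB0 i x (by simpa using hx), zero_mul]

/-- A singular value decomposition of `A`. -/
def svd {m n : ℕ} (A : Matrix (Fin m) (Fin n) ℝ) : SVD A :=
  Classical.choice (SVD.nonempty A)

/-- The pseudo-inverse `A† = V Σ⁻¹ Uᵀ`. -/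
def pinv {m n : ℕ} (A : Matrix (Fin m) (Fin n) ℝ) : Matrix (Fin n) (Fin m) ℝ :=
  (svd A).V * Matrix.diagonal (fun t => ((svd A).σ t)⁻¹) * (svd A).U.transpose

/-- The best rank-`k` approximation `A_k = U_k Σ_k V_kᵀ`: the singular value decomposition
with all but the top `k` singular values replaced by `0`. -/
def bestRank {m n : ℕ} (A : Matrix (Fin m) (Fin n) ℝ) (k : ℕ) : Matrix (Fin m) (Fin n) ℝ :=
  (svd A).U * Matrix.diagonal (fun t : Fin A.rank => if (t : ℕ) < k then (svd A).σ t else 0) *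
    (svd A).V.transpose

/-- The squared Frobenius norm. -/
def frobSq {m n : ℕ} (A : Matrix (Fin m) (Fin n) ℝ) : ℝ :=
  ∑ i, ∑ j, A i j ^ 2

/-- The information loss `ℓ(H, X) = ‖X - XH(XH)†X‖_F²` of the linear encoder `H`. -/
def infoLoss {n d k : ℕ} (H : Matrix (Fin d) (Fin k) ℝ) (X : Matrix (Fin n) (Fin d) ℝ) : ℝ :=
  frobSq (X - X * H * pinv (X * H) * X)

/-- `H` is `r`-sparse: every column has at most `r` non-zero entries. -/
def IsSparse {d k : ℕ} (r : ℕ) (H : Matrix (Fin d) (Fin k) ℝ) : Prop :=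
  ∀ j, {i | H i j ≠ 0}.ncard ≤ r

/-! ### Randomized real-number algorithms

A random access machine with exact real arithmetic. Its memory consists of arrays of natural
numbers and of two-dimensional arrays of reals, addressed by natural numbers; programs are
built from assignments, branching, counted loops, draws of independent uniform random numbers
from `[0, 1]`, and calls of a subroutine that computes the singular value decomposition of a
`p × q` matrix at the customary cost of `p q min(p, q)` operations. Every other operation,
and every node of an expression that is evaluated, costs one unit of time. -/

/-- Integer expressions. -/
inductive NExp where
  /-- A constant. -/
  | lit (c : ℕ)
  /-- The entry `i` of the integer array `a`. -/
  | get (a : ℕ) (i : NExp)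
  | add (e f : NExp)
  /-- Truncated subtraction. -/
  | sub (e f : NExp)

/-- Real expressions (division by `0` and the root of a negative number give `0`). -/
inductive RExp where
  /-- A rational constant. -/
  | lit (c : ℚ)
  /-- The entry `(i, j)` of the real array `a`. -/
  | get (a : ℕ) (i j : NExp)
  /-- An integer, read as a real number. -/
  | cast (e : NExp)
  | add (e f : RExp)
  | sub (e f : RExp)
  | mul (e f : RExp)
  | div (e f : RExp)
  | sqrt (e : RExp)

/-- Tests. -/
inductive BExp where
  | ltN (e f : NExp)
  | ltR (e f : RExp)

/-- Programs. -/
inductive Prog where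
  | skip
  | seq (c c' : Prog)
  /-- `a[i] := e` for an integer array `a`. -/
  | setN (a : ℕ) (i e : NExp)
  /-- `a[i, j] := e` for a real array `a`. -/
  | setR (a : ℕ) (i j : NExp) (e : RExp)
  /-- Put a fresh uniform random number from `[0, 1]` into `a[i, j]`. -/
  | rand (a : ℕ) (i j : NExp)
  | ite (b : BExp) (c c' : Prog)
  /-- For `t = 0, …, e - 1` put `t` into `x[0]` and run `c`; the bound `e` is evaluated once. -/
  | loop (x : ℕ) (e : NExp) (c : Prog)
  /-- Decompose the upper left `p × q` block of the real array `a`, and put the left singular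
  vectors into the columns of `u`, the singular values into the row `0` of `z`, and the right
  singular vectors into the columns of `v`, all padded by zeros to `min(p, q)` columns. -/
  | svd (a : ℕ) (p q : NExp) (u z v : ℕ)

/-- The state of the machine: integer and real memory, the number of random numbers drawn so
far, and the time elapsed so far. -/
structure State where
  nat : ℕ → ℕ → ℕ
  real : ℕ → ℕ → ℕ → ℝ
  drawn : ℕ
  time : ℕ

namespace NExp

def eval (s : State) : NExp → ℕ
  | lit c => c
  | get a i => s.nat a (i.eval s)
  | add e f => e.eval s + f.eval s
  | sub e f => e.eval s - f.eval s

def cost : NExp → ℕ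
  | lit _ => 1
  | get _ i => i.cost + 1
  | add e f => e.cost + f.cost + 1
  | sub e f => e.cost + f.cost + 1

end NExp

namespace RExp

def eval (s : State) : RExp → ℝ
  | lit c => (c : ℝ)
  | get a i j => s.real a (i.eval s) (j.eval s)
  | cast e => (e.eval s : ℝ)
  | add e f => e.eval s + f.eval s
  | sub e f => e.eval s - f.eval s
  | mul e f => e.eval s * f.eval s
  | div e f => e.eval s / f.eval s
  | sqrt e => Real.sqrt (e.eval s)

def cost : RExp → ℕ
  | lit _ => 1
  | get _ i j => i.cost + j.cost + 1
  | cast e => e.cost + 1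
  | add e f => e.cost + f.cost + 1
  | sub e f => e.cost + f.cost + 1
  | mul e f => e.cost + f.cost + 1
  | div e f => e.cost + f.cost + 1
  | sqrt e => e.cost + 1

end RExp

namespace BExp

def eval (s : State) : BExp → Prop
  | ltN e f => e.eval s < f.eval s
  | ltR e f => e.eval s < f.eval s

def cost : BExp → ℕ
  | ltN e f => e.cost + f.cost + 1
  | ltR e f => e.cost + f.cost + 1

end BExp

namespace State

def tick (s : State) (t : ℕ) : State :=
  { s with time := s.time + t }

def writeN (s : State) (a i x : ℕ) : State :=
  { s with nat := fun a' i' => if a' = a ∧ i' = i then x else s.nat a' i' }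

def writeR (s : State) (a i j : ℕ) (x : ℝ) : State :=
  { s with real := fun a' i' j' => if a' = a ∧ i' = i ∧ j' = j then x else s.real a' i' j' }

/-- Overwrite the upper left `p × w` block of the real array `a` by the matrix `M`, whose
number `l` of columns may be smaller than `w`, padded by zeros. -/
def writeBlock (s : State) (a p w : ℕ) {l : ℕ} (M : Matrix (Fin p) (Fin l) ℝ) : State :=
  { s with
    real := fun a' i j =>
      if a' = a ∧ i < p ∧ j < w then
        (if h : i < p ∧ j < l then M ⟨i, h.1⟩ ⟨j, h.2⟩ else 0)
      else s.real a' i j }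

/-- The upper left `p × q` block of the real array `a`. -/
def readBlock (s : State) (a p q : ℕ) : Matrix (Fin p) (Fin q) ℝ :=
  Matrix.of fun i j => s.real a i j

end State

/-- A routine for the singular value decomposition; it may choose any of the decompositions
of its argument. -/
def SVDRoutine : Type :=
  ∀ (m n : ℕ) (A : Matrix (Fin m) (Fin n) ℝ), SVD A

open Classical in
/-- The effect of running a program, for the outcome `ω` of the random numbers. -/
def Prog.exec (dec : SVDRoutine) (ω : ℕ → unitInterval) : Prog → State → State
  | skip, s => s.tick 1
  | seq c c', s => c'.exec dec ω (c.exec dec ω s)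
  | setN a i e, s => (s.writeN a (i.eval s) (e.eval s)).tick (i.cost + e.cost + 1)
  | setR a i j e, s =>
      (s.writeR a (i.eval s) (j.eval s) (e.eval s)).tick (i.cost + j.cost + e.cost + 1)
  | rand a i j, s =>
      { (s.writeR a (i.eval s) (j.eval s) (ω s.drawn : ℝ)).tick (i.cost + j.cost + 1) with
        drawn := s.drawn + 1 }
  | ite b c c', s =>
      if b.eval s then c.exec dec ω (s.tick (b.cost + 1))
      else c'.exec dec ω (s.tick (b.cost + 1))
  | loop x e c, s =>
      Nat.rec (motive := fun _ => State) (s.tick (e.cost + 1))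
        (fun t s' => c.exec dec ω ((s'.writeN x 0 t).tick 1)) (e.eval s)
  | svd a p q u z v, s =>
      let m := p.eval s
      let n := q.eval s
      let A := s.readBlock a m n
      let D := dec m n A
      let S : Matrix (Fin 1) (Fin A.rank) ℝ := Matrix.of fun _ t => D.σ t
      (((s.writeBlock u m (min m n) D.U).writeBlock z 1 (min m n) S).writeBlock v n
        (min m n) D.V).tick (p.cost + q.cost + m * n * min m n + 1)

/-- The initial state on the input `X`, `k`, `r`: the integer array `0` holds `n, d, k, r`,
the real array `0` holds `X`, and all other memory is `0`. -/
def initState {n d : ℕ} (X : Matrix (Fin n) (Fin d) ℝ) (k r : ℕ) : State where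
  nat := fun a i =>
    if a = 0 then
      (if i = 0 then n else if i = 1 then d else if i = 2 then k else if i = 3 then r else 0)
    else 0
  real := fun a i j => if h : a = 0 ∧ i < n ∧ j < d then X ⟨i, h.2.1⟩ ⟨j, h.2.2⟩ else 0
  drawn := 0
  time := 0

/-- The final state of the program `P` on the input `X`, `k`, `r`. -/
def Prog.run (P : Prog) (dec : SVDRoutine) {n d : ℕ} (X : Matrix (Fin n) (Fin d) ℝ) (k r : ℕ)
    (ω : ℕ → unitInterval) : State :=
  P.exec dec ω (initState X k r)

/-- The number of time steps of the run of `P`. -/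
def Prog.runTime (P : Prog) (dec : SVDRoutine) {n d : ℕ} (X : Matrix (Fin n) (Fin d) ℝ)
    (k r : ℕ) (ω : ℕ → unitInterval) : ℕ :=
  (P.run dec X k r ω).time

/-- The output of `P`: the `d × k` block of the real array `1` in the final state. -/
def Prog.encoder (P : Prog) (dec : SVDRoutine) {n d : ℕ} (X : Matrix (Fin n) (Fin d) ℝ)
    (k r : ℕ) (ω : ℕ → unitInterval) : Matrix (Fin d) (Fin k) ℝ :=
  (P.run dec X k r ω).readBlock 1 d k

/-- The law of a sequence of independent random numbers, uniform on `[0, 1]`. -/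
def coins : MeasureTheory.Measure (ℕ → unitInterval) :=
  MeasureTheory.Measure.infinitePi fun _ => MeasureTheory.volume

end

end SparseEncoder

namespace SparseEncoder

open Matrix

/-! ### The Frobenius norm and orthogonal projections -/

/-! The encoder is supported on $r$ chosen columns of $X$. If $C$ consists of these columns, any
matrix of the form $CF$ is $XH$ for an $H$ whose nonzero rows belong to chosen columns, so sparsity
is automatic. The loss of $H$ is the squared distance of $X$ to the column space of $XH$. It remains
to choose the columns so that their span contains a near-optimal rank-$k$ approximation, and to find
the best one in that span. Write $O=\|X-X_k\|_F^2$.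

Three stages produce the columns. Frequent directions (`IsSketch.step`, `IsSketch.frobSq_le`)
compress $X$ to a sketch with $r$ rows; its leading $l\le k$ right singular vectors $Z$ satisfy
$(r-k)\|X-XZZ^T\|^2\le rO$. Batches of $r$ rows keep the cost at $ndr+r^2d$.

A one-sided barrier argument in the style of Batson, Spielman and Srivastava
(`BarrierInv.exists_score`, `BarrierInv.step`) selects $4l$ rows $z_u$ of $Z$ with weights $\tau_u$.
The lower barrier moves from $-2l$ to $2l$ in unit steps while the potential stays equal to $1/2$,
so $\sum\tau_u z_uz_u^T\succ 2l\cdot I$. Each weight is also bounded in terms of the residual column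
norms, so their weighted sum is at most $8l\,\|X-XZZ^T\|^2$. By `exists_column_approx` the
projection onto the selected columns then has error
$\|R\|^2\le(1+8l/2l)\|X-XZZ^T\|^2=5\|X-XZZ^T\|^2$.

Adaptive sampling draws the other $s=r-4l$ columns with probability proportional to the squared
column norms of the residual $R$. For the optimal frame $V$, the importance-sampling estimator of
$RV$ is unbiased with mean square error at most $k\|R\|^2/s$ (`integral_sampleMat_le`). It lies in
the span of the chosen columns up to a term already there, so the expected error of the best
rank-$k$ approximation in that span is at most $O+\frac ks\|R\|^2$ (`integral_infoLoss_encOf_le`).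

Together this gives $O\bigl(1+\frac{k}{r-4k}\cdot\frac{5r}{r-k}\bigr)$, and $(r-4k)(r-k)\ge r(r-5k)$
turns it into the claimed factor (`bound_of_residual`). The final encoder comes from Eckart–Young in
the coordinates $U^TX$ of the chosen column space (`SVD.infoLoss_le_of_coords`).

For the machine, `mat_run` gives value and running time of every matrix-valued sum at once. Frame
rules carry the untouched arrays along, and zero padding to `min(p, q)` columns avoids any knowledge
of ranks. -/

theorem frobSq_eq_trace {m n : ℕ} (A : Matrix (Fin m) (Fin n) ℝ) :
    frobSq A = (Aᵀ * A).trace := by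
  simp only [frobSq, Matrix.trace, Matrix.diag, Matrix.mul_apply, Matrix.transpose_apply]
  rw [Finset.sum_comm]
  simp only [sq]

theorem frobSq_nonneg {m n : ℕ} (A : Matrix (Fin m) (Fin n) ℝ) : 0 ≤ frobSq A :=
  Finset.sum_nonneg fun _ _ => Finset.sum_nonneg fun _ _ => sq_nonneg _

theorem frobSq_transpose {m n : ℕ} (A : Matrix (Fin m) (Fin n) ℝ) : frobSq Aᵀ = frobSq A :=
  Finset.sum_comm

theorem frobSq_neg {m n : ℕ} (A : Matrix (Fin m) (Fin n) ℝ) : frobSq (-A) = frobSq A := by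
  simp [frobSq]

theorem frobSq_add_of_transpose_mul_eq_zero {m n : ℕ} {A B : Matrix (Fin m) (Fin n) ℝ}
    (h : Aᵀ * B = 0) : frobSq (A + B) = frobSq A + frobSq B := by
  have h' : Bᵀ * A = 0 := by
    have := congrArg Matrix.transpose h
    simpa using this
  simp only [frobSq_eq_trace, Matrix.transpose_add, Matrix.add_mul, Matrix.mul_add, h, h']
  simp

theorem frobSq_add_of_mul_transpose_eq_zero {m n : ℕ} {A B : Matrix (Fin m) (Fin n) ℝ}
    (h : A * Bᵀ = 0) : frobSq (A + B) = frobSq A + frobSq B := by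
  rw [← frobSq_transpose, Matrix.transpose_add,
    frobSq_add_of_transpose_mul_eq_zero (by simpa using h), frobSq_transpose, frobSq_transpose]

theorem frobSq_mul_left {m n l : ℕ} {U : Matrix (Fin m) (Fin l) ℝ} (hU : Uᵀ * U = 1)
    (A : Matrix (Fin l) (Fin n) ℝ) : frobSq (U * A) = frobSq A := by
  rw [frobSq_eq_trace, frobSq_eq_trace, Matrix.transpose_mul, Matrix.mul_assoc,
    ← Matrix.mul_assoc Uᵀ, hU, Matrix.one_mul]

theorem frobSq_mul_right {m n l : ℕ} {V : Matrix (Fin n) (Fin l) ℝ} (hV : Vᵀ * V = 1)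
    (A : Matrix (Fin m) (Fin l) ℝ) : frobSq (A * Vᵀ) = frobSq A := by
  rw [← frobSq_transpose, Matrix.transpose_mul, Matrix.transpose_transpose, frobSq_mul_left hV,
    frobSq_transpose]

theorem frobSq_sub_mul_transpose {m n l : ℕ} {U : Matrix (Fin m) (Fin l) ℝ} (hU : Uᵀ * U = 1)
    (X : Matrix (Fin m) (Fin n) ℝ) :
    frobSq (X - U * (Uᵀ * X)) = frobSq X - frobSq (Uᵀ * X) := by
  have h : (X - U * (Uᵀ * X))ᵀ * (U * (Uᵀ * X)) = 0 := by
    have : Uᵀ * (X - U * (Uᵀ * X)) = 0 := by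
      rw [Matrix.mul_sub, ← Matrix.mul_assoc, hU, Matrix.one_mul, sub_self]
    rw [← Matrix.mul_assoc]
    have h2 := congrArg Matrix.transpose this
    rw [Matrix.transpose_mul, Matrix.transpose_transpose, Matrix.transpose_zero] at h2
    rw [h2, Matrix.zero_mul]
  have := frobSq_add_of_transpose_mul_eq_zero h
  rw [sub_add_cancel, frobSq_mul_left hU] at this
  linarith

theorem frobSq_transpose_mul_le {m n l : ℕ} {U : Matrix (Fin m) (Fin l) ℝ} (hU : Uᵀ * U = 1)
    (X : Matrix (Fin m) (Fin n) ℝ) : frobSq (Uᵀ * X) ≤ frobSq X := by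
  have := frobSq_nonneg (X - U * (Uᵀ * X))
  rw [frobSq_sub_mul_transpose hU] at this
  linarith

/-- Pythagoras: the residual of the projection is orthogonal to the column space of `U`. All
comparisons of approximations within a fixed column space reduce to their coordinates through this
identity. -/
theorem frobSq_eq_proj_add {m n l : ℕ} {U : Matrix (Fin m) (Fin l) ℝ} (hU : Uᵀ * U = 1)
    (X : Matrix (Fin m) (Fin n) ℝ) (W : Matrix (Fin l) (Fin n) ℝ) :
    frobSq (X - U * W) = frobSq (X - U * (Uᵀ * X)) + frobSq (Uᵀ * X - W) := by
  have h : (X - U * (Uᵀ * X))ᵀ * (U * (Uᵀ * X - W)) = 0 := by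
    have : Uᵀ * (X - U * (Uᵀ * X)) = 0 := by
      rw [Matrix.mul_sub, ← Matrix.mul_assoc, hU, Matrix.one_mul, sub_self]
    have h2 := congrArg Matrix.transpose this
    rw [Matrix.transpose_mul, Matrix.transpose_transpose, Matrix.transpose_zero] at h2
    rw [← Matrix.mul_assoc, h2, Matrix.zero_mul]
  have := frobSq_add_of_transpose_mul_eq_zero h
  rw [frobSq_mul_left hU, Matrix.mul_sub, sub_add_sub_cancel] at this
  exact this

theorem frobSq_sub_proj_le {m n l : ℕ} {U : Matrix (Fin m) (Fin l) ℝ} (hU : Uᵀ * U = 1)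
    (X : Matrix (Fin m) (Fin n) ℝ) (W : Matrix (Fin l) (Fin n) ℝ) :
    frobSq (X - U * (Uᵀ * X)) ≤ frobSq (X - U * W) := by
  rw [frobSq_eq_proj_add hU X W]
  linarith [frobSq_nonneg (Uᵀ * X - W)]

/-- The Bessel inequality for the rows of `Uᵀ W`. -/
theorem sum_sq_col_le_one {p l m : ℕ} {U : Matrix (Fin p) (Fin l) ℝ}
    {W : Matrix (Fin p) (Fin m) ℝ} (hU : Uᵀ * U = 1) (hW : Wᵀ * W = 1) (j : Fin m) :
    ∑ t, (Uᵀ * W) t j ^ 2 ≤ 1 := by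
  have h := frobSq_transpose_mul_le hU (Matrix.of fun i (_ : Fin 1) => W i j)
  have h1 := congrFun (congrFun hW j) j
  simp only [Matrix.mul_apply, Matrix.transpose_apply, Matrix.one_apply_eq] at h1
  simp only [frobSq, Matrix.mul_apply, Matrix.transpose_apply, Matrix.of_apply,
    Finset.univ_unique, Finset.sum_singleton] at h
  simp only [Matrix.mul_apply, Matrix.transpose_apply]
  refine h.trans (le_of_eq ?_)
  rw [← h1]
  exact Finset.sum_congr rfl fun i _ => sq _

/-- The Ky Fan inequality: among all `k` orthonormal vectors the leading singular vectors capture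
the most of the Frobenius norm. -/
theorem frobSq_diagonal_mul_le {p l m k : ℕ} {U : Matrix (Fin p) (Fin l) ℝ}
    {W : Matrix (Fin p) (Fin m) ℝ} (hU : Uᵀ * U = 1) (hW : Wᵀ * W = 1) {σ : Fin l → ℝ}
    (hσ : Antitone σ) (h0 : ∀ t, 0 ≤ σ t) (hm : m ≤ k) :
    frobSq (Matrix.diagonal σ * (Uᵀ * W)) ≤ ∑ t : Fin l, if (t : ℕ) < k then σ t ^ 2 else 0 := by
  -- The captured energy is a weighted sum of the $\sigma_t^2$ with weights $w_t\in[0,1]$ of total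
  -- at most $k$; the maximum puts weight one on the $k$ largest.
  obtain ⟨w, hw⟩ : ∃ w : Fin l → ℝ, ∀ t, w t = ∑ j, (Uᵀ * W) t j ^ 2 := ⟨_, fun _ => rfl⟩
  have hw0 : ∀ t, 0 ≤ w t := fun t => by
    rw [hw]; exact Finset.sum_nonneg fun _ _ => sq_nonneg _
  have hw1 : ∀ t, w t ≤ 1 := fun t => by
    rw [hw]
    refine le_trans (le_of_eq ?_) (sum_sq_col_le_one hW hU t)
    refine Finset.sum_congr rfl fun j _ => ?_
    rw [← Matrix.transpose_apply (Wᵀ * U), Matrix.transpose_mul, Matrix.transpose_transpose]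
  have hws : ∑ t, w t ≤ k := by
    simp only [hw]
    rw [Finset.sum_comm]
    calc _ ≤ ∑ _j : Fin m, (1 : ℝ) := Finset.sum_le_sum fun j _ => sum_sq_col_le_one hU hW j
      _ = m := by simp
      _ ≤ k := by exact_mod_cast hm
  have hL : frobSq (Matrix.diagonal σ * (Uᵀ * W)) = ∑ t, σ t ^ 2 * w t := by
    simp only [frobSq, Matrix.diagonal_mul, mul_pow, hw, Finset.mul_sum]
  rw [hL]
  by_cases hk : k < l
  -- The threshold $c=\sigma_k^2$ (counting from zero) is the Lagrange multiplier of the constraint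
  -- $\sum w_t\le k$; it separates the first $k$ values from the rest.
  · obtain ⟨c, hc⟩ : ∃ c, c = σ ⟨k, hk⟩ ^ 2 := ⟨_, rfl⟩
    have hlt : ∀ t : Fin l, (t : ℕ) < k → c ≤ σ t ^ 2 := fun t ht => by
      rw [hc]
      exact pow_le_pow_left₀ (h0 _) (hσ (Fin.le_def.2 ht.le)) 2
    have hge : ∀ t : Fin l, ¬ (t : ℕ) < k → σ t ^ 2 ≤ c := fun t ht => by
      rw [hc]
      exact pow_le_pow_left₀ (h0 _) (hσ (Fin.le_def.2 (not_lt.1 ht))) 2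
    have hc0 : 0 ≤ c := hc ▸ sq_nonneg _
    have hcard : ∑ t : Fin l, (if (t : ℕ) < k then c else 0) = k * c := by
      rw [← Finset.sum_filter, Finset.sum_const, nsmul_eq_mul]
      congr 2
      rw [Fin.card_filter_val_lt]
      omega
    have hterm : ∀ t : Fin l, σ t ^ 2 * w t ≤
        (if (t : ℕ) < k then σ t ^ 2 else 0) - (if (t : ℕ) < k then c else 0) + c * w t := by
      intro t
      split_ifs with ht
      · nlinarith [hlt t ht, hw1 t]
      · nlinarith [hge t ht, hw0 t]
    calc _ ≤ ∑ t : Fin l, ((if (t : ℕ) < k then σ t ^ 2 else 0) -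
          (if (t : ℕ) < k then c else 0) + c * w t) := Finset.sum_le_sum fun t _ => hterm t
      _ = (∑ t : Fin l, if (t : ℕ) < k then σ t ^ 2 else 0) - k * c + c * ∑ t, w t := by
          rw [Finset.sum_add_distrib, Finset.sum_sub_distrib, hcard, Finset.mul_sum]
      _ ≤ _ := by nlinarith
  · refine Finset.sum_le_sum fun t _ => ?_
    rw [if_pos (by have := t.2; omega)]
    nlinarith [hw1 t, sq_nonneg (σ t)]

/-! ### Singular value decompositions -/

namespace SVD

variable {m n : ℕ} {A : Matrix (Fin m) (Fin n) ℝ} (D : SVD A)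

theorem transpose_U_mul : D.Uᵀ * A = Matrix.diagonal D.σ * D.Vᵀ := by
  refine (congrArg (D.Uᵀ * ·) D.eq).trans ?_
  simp only [← Matrix.mul_assoc]
  rw [D.orthU, Matrix.one_mul]

theorem mul_V : A * D.V = D.U * Matrix.diagonal D.σ := by
  refine (congrArg (· * D.V) D.eq).trans ?_
  simp only [Matrix.mul_assoc]
  rw [D.orthV, Matrix.mul_one]

theorem U_mul_transpose_mul : D.U * (D.Uᵀ * A) = A := by
  rw [D.transpose_U_mul, ← Matrix.mul_assoc, ← D.eq]

theorem diagonal_mul_inv :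
    Matrix.diagonal D.σ * Matrix.diagonal (fun t => (D.σ t)⁻¹) = 1 := by
  rw [Matrix.diagonal_mul_diagonal, ← Matrix.diagonal_one]
  congr 1
  funext t
  exact mul_inv_cancel₀ (D.pos t).ne'

theorem mul_inv : A * (D.V * Matrix.diagonal (fun t => (D.σ t)⁻¹)) = D.U := by
  rw [← Matrix.mul_assoc, D.mul_V, Matrix.mul_assoc, D.diagonal_mul_inv, Matrix.mul_one]

theorem frobSq_eq : frobSq A = ∑ t, D.σ t ^ 2 := by
  refine (congrArg frobSq D.eq).trans ?_
  rw [frobSq_mul_right D.orthV, frobSq_mul_left D.orthU]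
  simp [frobSq, Matrix.diagonal_apply]

theorem frobSq_sub_U_le {l : ℕ} (X : Matrix (Fin m) (Fin l) ℝ) (W : Matrix (Fin n) (Fin l) ℝ) :
    frobSq (X - D.U * (D.Uᵀ * X)) ≤ frobSq (X - A * W) := by
  have := frobSq_sub_proj_le D.orthU X (D.Uᵀ * A * W)
  rwa [← Matrix.mul_assoc D.U (D.Uᵀ * A), D.U_mul_transpose_mul] at this

/-- The leading `k` left singular vectors, padded by zeros. -/
noncomputable def leadU {m n : ℕ} {A : Matrix (Fin m) (Fin n) ℝ} (D : SVD A) (k : ℕ) :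
    Matrix (Fin m) (Fin k) ℝ :=
  Matrix.of fun i j => if h : (j : ℕ) < A.rank then D.U i ⟨j, h⟩ else 0

/-- The Eckart–Young theorem in the Frobenius norm. -/
theorem frobSq_sub_leadU_le (k : ℕ) (F : Matrix (Fin m) (Fin k) ℝ)
    (G : Matrix (Fin k) (Fin n) ℝ) :
    frobSq (A - D.leadU k * ((D.leadU k)ᵀ * A)) ≤ frobSq (A - F * G) := by
  have hproj : D.leadU k * (D.leadU k)ᵀ =
      D.U * Matrix.diagonal (fun t : Fin A.rank => if (t : ℕ) < k then (1 : ℝ) else 0) * D.Uᵀ := by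
    ext i j
    rw [Matrix.mul_apply, Matrix.mul_apply]
    simp only [Matrix.mul_diagonal, Matrix.transpose_apply, leadU, Matrix.of_apply]
    obtain ⟨f, hf⟩ : ∃ f : ℕ → ℝ, ∀ t, f t =
        if h : t < A.rank then D.U i ⟨t, h⟩ * D.U j ⟨t, h⟩ else 0 := ⟨_, fun _ => rfl⟩
    have h1 : ∀ x : Fin k, ((if h : (x : ℕ) < A.rank then D.U i ⟨x, h⟩ else 0) *
        (if h : (x : ℕ) < A.rank then D.U j ⟨x, h⟩ else 0)) = f x := fun x => by
      rw [hf]; split_ifs <;> simp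
    have h2 : ∀ x : Fin A.rank, D.U i x * (if (x : ℕ) < k then (1 : ℝ) else 0) * D.U j x =
        if (x : ℕ) < k then f x else 0 := fun x => by
      rw [hf, dif_pos x.2]; split_ifs <;> simp
    simp only [h1, h2]
    rw [Fin.sum_univ_eq_sum_range, Fin.sum_univ_eq_sum_range (fun x => if x < k then f x else 0),
      ← Finset.sum_filter]
    have h3 : ∀ x, f x = if x < A.rank then f x else 0 := fun x => by
      rw [hf]; split_ifs <;> rfl
    rw [Finset.sum_congr rfl fun x _ => h3 x, ← Finset.sum_filter]
    refine Finset.sum_congr ?_ fun _ _ => rfl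
    ext x
    simp [and_comm]
  have hL : frobSq (A - D.leadU k * ((D.leadU k)ᵀ * A)) =
      frobSq A - ∑ t : Fin A.rank, if (t : ℕ) < k then D.σ t ^ 2 else 0 := by
    have : A - D.leadU k * ((D.leadU k)ᵀ * A) =
        D.U * Matrix.diagonal (fun t : Fin A.rank => if (t : ℕ) < k then 0 else D.σ t) * D.Vᵀ := by
      rw [← Matrix.mul_assoc, hproj, Matrix.mul_assoc, D.transpose_U_mul]
      refine (congrArg (· - _) D.eq).trans ?_
      rw [← Matrix.mul_assoc, Matrix.mul_assoc D.U (Matrix.diagonal _) (Matrix.diagonal _),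
        Matrix.diagonal_mul_diagonal, ← Matrix.sub_mul, ← Matrix.mul_sub, Matrix.diagonal_sub]
      congr 3
      funext t
      split_ifs <;> simp
    rw [this, frobSq_mul_right D.orthV, frobSq_mul_left D.orthU, D.frobSq_eq,
      ← Finset.sum_sub_distrib]
    simp only [frobSq, Matrix.diagonal_apply]
    refine Finset.sum_congr rfl fun t _ => ?_
    rw [Finset.sum_eq_single t (fun b _ hb => by simp [Ne.symm hb]) (by simp), if_pos rfl]
    split_ifs <;> simp
  rw [hL]
  -- The column space of `F` is spanned by at most $k$ orthonormal columns `E.U`; projecting on it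
  -- beats `F * G`, and Ky Fan bounds what this projection captures.
  obtain ⟨E⟩ := SVD.nonempty F
  have h1 := E.frobSq_sub_U_le A G
  rw [frobSq_sub_mul_transpose E.orthU] at h1
  have hr : F.rank ≤ k := by simpa using F.rank_le_width
  have h2 := frobSq_diagonal_mul_le D.orthU E.orthU D.anti (fun t => (D.pos t).le) hr
  have h3 : frobSq (E.Uᵀ * A) = frobSq (Matrix.diagonal D.σ * (D.Uᵀ * E.U)) := by
    refine (congrArg (fun M => frobSq (E.Uᵀ * M)) D.eq).trans ?_
    rw [← Matrix.mul_assoc, frobSq_mul_right D.orthV, ← frobSq_transpose]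
    simp [Matrix.mul_assoc]
  linarith

/-- The leading right singular vectors. -/
noncomputable def leadV {m n : ℕ} {A : Matrix (Fin m) (Fin n) ℝ} (D : SVD A) {l : ℕ} (h : l ≤ A.rank) :
    Matrix (Fin n) (Fin l) ℝ :=
  D.V.submatrix id (Fin.castLE h)

theorem leadV_orth {l : ℕ} (h : l ≤ A.rank) : (D.leadV h)ᵀ * D.leadV h = 1 := by
  have : (D.leadV h)ᵀ * D.leadV h = (D.Vᵀ * D.V).submatrix (Fin.castLE h) (Fin.castLE h) := by
    ext i j
    simp [leadV, Matrix.mul_apply]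
  rw [this, D.orthV]
  exact Matrix.submatrix_one _ (Fin.castLE_injective h)

theorem frobSq_mul_leadV {l : ℕ} (h : l ≤ A.rank) :
    frobSq (A * D.leadV h) = ∑ t : Fin A.rank, if (t : ℕ) < l then D.σ t ^ 2 else 0 := by
  have : A * D.leadV h = D.U * (Matrix.diagonal D.σ).submatrix id (Fin.castLE h) := by
    have := congrArg (fun M => M.submatrix id (Fin.castLE h)) D.mul_V
    ext i j
    have := congrFun (congrFun this i) j
    simpa [leadV, Matrix.mul_apply] using this
  rw [this, frobSq_mul_left D.orthU, frobSq]
  refine Finset.sum_congr rfl fun t _ => ?_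
  simp only [Matrix.submatrix_apply, id, Matrix.diagonal_apply]
  split_ifs with ht
  · rw [Finset.sum_eq_single ⟨t, ht⟩]
    · simp
    · intro b _ hb
      have : t ≠ Fin.castLE h b := fun e => hb (by ext; simp [e])
      simp [this]
    · simp
  · refine Finset.sum_eq_zero fun b _ => ?_
    have : t ≠ Fin.castLE h b := fun e => ht (by simp [e])
    simp [this]

/-- If the rank is below $k$ there are fewer than $k$ singular vectors, but they already capture
everything; hence `l = min k A.rank`. -/
theorem frobSq_mul_le_leadV {k l p : ℕ} (h : l ≤ A.rank) (hl : l = min k A.rank)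
    {W : Matrix (Fin n) (Fin p) ℝ} (hW : Wᵀ * W = 1) (hp : p ≤ k) :
    frobSq (A * W) ≤ frobSq (A * D.leadV h) := by
  rw [D.frobSq_mul_leadV]
  have h2 := frobSq_diagonal_mul_le D.orthV hW D.anti (fun t => (D.pos t).le) hp
  have h3 : frobSq (A * W) = frobSq (Matrix.diagonal D.σ * (D.Vᵀ * W)) := by
    refine (congrArg (fun M => frobSq (M * W)) D.eq).trans ?_
    rw [Matrix.mul_assoc, Matrix.mul_assoc, frobSq_mul_left D.orthU]
  rw [h3]
  refine h2.trans (le_of_eq (Finset.sum_congr rfl fun t _ => ?_))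
  have := t.2
  simp [hl]

end SVD

/-! ### Optimal rank-k loss and information loss as projection errors -/

theorem frobSq_sub_mul_mul_transpose {m n l : ℕ} {V : Matrix (Fin n) (Fin l) ℝ}
    (hV : Vᵀ * V = 1) (X : Matrix (Fin m) (Fin n) ℝ) :
    frobSq (X - X * V * Vᵀ) = frobSq X - frobSq (X * V) := by
  have h := frobSq_sub_mul_transpose hV Xᵀ
  rw [frobSq_transpose, ← frobSq_transpose (_ - _), ← frobSq_transpose (Vᵀ * Xᵀ)] at h
  simpa [Matrix.mul_assoc] using h

/-- Only the size of the optimal error enters later, through an orthonormal frame attaining it. It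
does not matter that `bestRank` uses a decomposition unrelated to those the routine returns. -/
theorem exists_bestRank_eq {n d k : ℕ} (X : Matrix (Fin n) (Fin d) ℝ) (hk : k ≤ X.rank) :
    ∃ V : Matrix (Fin d) (Fin k) ℝ, Vᵀ * V = 1 ∧
      frobSq (X - X * V * Vᵀ) = frobSq (X - bestRank X k) := by
  refine ⟨(svd X).leadV hk, (svd X).leadV_orth hk, ?_⟩
  rw [frobSq_sub_mul_mul_transpose ((svd X).leadV_orth hk), (svd X).frobSq_mul_leadV hk]
  have : X - bestRank X k = (svd X).U *
      Matrix.diagonal (fun t : Fin X.rank => if (t : ℕ) < k then 0 else (svd X).σ t) * (svd X).Vᵀ := by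
    refine (congrArg (· - bestRank X k) (svd X).eq).trans ?_
    rw [bestRank, ← Matrix.sub_mul, ← Matrix.mul_sub, Matrix.diagonal_sub]
    congr 3
    funext t
    split_ifs <;> simp
  rw [this, frobSq_mul_right (svd X).orthV, frobSq_mul_left (svd X).orthU, (svd X).frobSq_eq,
      ← Finset.sum_sub_distrib]
  simp only [frobSq, Matrix.diagonal_apply]
  refine Finset.sum_congr rfl fun t _ => ?_
  rw [Finset.sum_eq_single t (fun b _ hb => by simp [Ne.symm hb]) (by simp), if_pos rfl]
  split_ifs <;> simp

/-- The information loss is the distance to the column space of `X H`. -/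
theorem infoLoss_le {n d k : ℕ} (H : Matrix (Fin d) (Fin k) ℝ) (X : Matrix (Fin n) (Fin d) ℝ)
    (W : Matrix (Fin k) (Fin d) ℝ) : infoLoss H X ≤ frobSq (X - X * H * W) := by
  have h := (svd (X * H)).frobSq_sub_U_le X W
  have e : X * H * pinv (X * H) = (svd (X * H)).U * (svd (X * H)).Uᵀ := by
    rw [pinv, ← Matrix.mul_assoc, (svd (X * H)).mul_inv]
  rwa [infoLoss, e, Matrix.mul_assoc]

end SparseEncoder

namespace SparseEncoder

open Matrix

/-! ### Greedy selection of columns by a barrier potential -/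

theorem exists_orthogonal_diagonal {l : ℕ} {T : Matrix (Fin l) (Fin l) ℝ} (hT : T.IsHermitian) :
    ∃ (Q : Matrix (Fin l) (Fin l) ℝ) (μ : Fin l → ℝ), Qᵀ * Q = 1 ∧ Q * Qᵀ = 1 ∧
      T = Q * Matrix.diagonal μ * Qᵀ := by
  have h1 : (hT.eigenvectorUnitary : Matrix (Fin l) (Fin l) ℝ)ᵀ *
      (hT.eigenvectorUnitary : Matrix (Fin l) (Fin l) ℝ) = 1 := by
    have := Unitary.coe_star_mul_self hT.eigenvectorUnitary
    simpa [Matrix.star_eq_conjTranspose] using this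
  refine ⟨_, hT.eigenvalues, h1, mul_eq_one_comm.1 h1, ?_⟩
  conv_lhs => rw [hT.spectral_theorem, Unitary.conjStarAlgAut_apply]
  simp [Matrix.star_eq_conjTranspose]

theorem inv_orthogonal_diagonal {l : ℕ} {Q : Matrix (Fin l) (Fin l) ℝ} {μ : Fin l → ℝ}
    (h1 : Qᵀ * Q = 1) (h2 : Q * Qᵀ = 1) (h0 : ∀ j, μ j ≠ 0) :
    (Q * Matrix.diagonal μ * Qᵀ)⁻¹ = Q * Matrix.diagonal (fun j => (μ j)⁻¹) * Qᵀ := by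
  refine Matrix.inv_eq_right_inv ?_
  have : Q * Matrix.diagonal μ * Qᵀ * (Q * Matrix.diagonal (fun j => (μ j)⁻¹) * Qᵀ) =
      Q * (Matrix.diagonal μ * (Qᵀ * Q) * Matrix.diagonal (fun j => (μ j)⁻¹)) * Qᵀ := by
    simp only [Matrix.mul_assoc]
  rw [this, h1, Matrix.mul_one, Matrix.diagonal_mul_diagonal]
  have : (fun i => μ i * (μ i)⁻¹) = fun _ => (1 : ℝ) := funext fun i => mul_inv_cancel₀ (h0 i)
  rw [this, Matrix.diagonal_one, Matrix.mul_one, h2]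

theorem trace_orthogonal_diagonal {l : ℕ} {Q : Matrix (Fin l) (Fin l) ℝ} {μ : Fin l → ℝ}
    (h1 : Qᵀ * Q = 1) : (Q * Matrix.diagonal μ * Qᵀ).trace = ∑ j, μ j := by
  rw [Matrix.trace_mul_comm, ← Matrix.mul_assoc, h1, Matrix.one_mul, Matrix.trace_diagonal]

/-- The invariant of the barrier method: `T + 1` is positive definite of potential `1 / 2`. -/
def BarrierInv {l : ℕ} (T : Matrix (Fin l) (Fin l) ℝ) : Prop :=
  (T + 1).PosDef ∧ ((T + 1)⁻¹).trace = 1 / 2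

/-- The score of the `i`-th row of `Z` with respect to the inverse `M` of the shifted matrix. -/
noncomputable def score {d l : ℕ} (Z : Matrix (Fin d) (Fin l) ℝ) (M : Matrix (Fin l) (Fin l) ℝ)
    (i : Fin d) : ℝ :=
  (∑ b, (Z * M) i b ^ 2) / (M.trace - 1 / 2) - ∑ b, (Z * M) i b * Z i b

/-- All terms of $\sum(\mu_j+1)^{-1}=1/2$ are positive, so each is at most $1/2$ and $\mu_j\ge1$.
Thus the barrier can move up by one without reaching an eigenvalue. -/
theorem BarrierInv.spectral {l : ℕ} {T : Matrix (Fin l) (Fin l) ℝ} (hT : BarrierInv T) :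
    ∃ (Q : Matrix (Fin l) (Fin l) ℝ) (μ : Fin l → ℝ), Qᵀ * Q = 1 ∧ Q * Qᵀ = 1 ∧
      T = Q * Matrix.diagonal μ * Qᵀ ∧ (∀ j, 1 ≤ μ j) ∧ ∑ j, (μ j + 1)⁻¹ = 1 / 2 := by
  have hTH : T.IsHermitian := by
    have := hT.1.isHermitian
    have h2 := this.sub (Matrix.isHermitian_one (n := Fin l) (α := ℝ))
    simpa using h2
  obtain ⟨Q, μ, h1, h2, rfl⟩ := exists_orthogonal_diagonal hTH
  have hadd : Q * Matrix.diagonal μ * Qᵀ + 1 = Q * Matrix.diagonal (fun j => μ j + 1) * Qᵀ := by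
    rw [← h2, ← Matrix.diagonal_add (d₁ := μ) (d₂ := fun _ => (1 : ℝ)), Matrix.diagonal_one,
      Matrix.mul_add, Matrix.add_mul, Matrix.mul_one]
  have hpos : ∀ j, 0 < μ j + 1 := fun j => by
    have h := hT.1
    rw [hadd] at h
    have h3 : (Qᵀ * (Q * Matrix.diagonal (fun j => μ j + 1) * Qᵀ) * Q).PosDef := by
      have := h.conjTranspose_mul_mul_same (B := Q) (by
        intro x y hxy
        have := congrArg (Qᵀ.mulVec) hxy
        simpa [Matrix.mulVec_mulVec, h1] using this)
      simpa using this
    have h4 : Qᵀ * (Q * Matrix.diagonal (fun j => μ j + 1) * Qᵀ) * Q =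
        Matrix.diagonal (fun j => μ j + 1) := by
      simp only [Matrix.mul_assoc]
      rw [h1, Matrix.mul_one, ← Matrix.mul_assoc, h1, Matrix.one_mul]
    rw [h4] at h3
    simpa using h3.diag_pos (i := j)
  have hsum : ∑ j, (μ j + 1)⁻¹ = 1 / 2 := by
    have h := hT.2
    rwa [hadd, inv_orthogonal_diagonal h1 h2 (fun j => (hpos j).ne'),
      trace_orthogonal_diagonal h1] at h
  refine ⟨Q, μ, h1, h2, rfl, fun j => ?_, hsum⟩
  have hj : (μ j + 1)⁻¹ ≤ 1 / 2 := by
    rw [← hsum]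
    exact Finset.single_le_sum (f := fun j => (μ j + 1)⁻¹)
      (fun i _ => (inv_pos.2 (hpos i)).le) (Finset.mem_univ j)
  have := hpos j
  have h2 : (μ j + 1)⁻¹ * (μ j + 1) = 1 := inv_mul_cancel₀ this.ne'
  nlinarith

/-- The total score is at least $1/2$. With
$\delta=\sum\mu_j^{-1}-\frac12=\sum(\mu_j(\mu_j+1))^{-1}$, the increase of the potential when the
barrier moves, Cauchy–Schwarz gives $\delta^2\le\frac12(\sum\mu_j^{-2}-\delta)$, that is
$\sum\mu_j^{-2}\ge2\delta^2+\delta$. -/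
theorem barrier_sum_ineq {l : ℕ} {μ : Fin l → ℝ} (hμ : ∀ j, 1 ≤ μ j)
    (hs : ∑ j, (μ j + 1)⁻¹ = 1 / 2) :
    0 < (∑ j, (μ j)⁻¹) - 1 / 2 ∧
      1 / 2 ≤ (∑ j, (μ j)⁻¹ ^ 2) / ((∑ j, (μ j)⁻¹) - 1 / 2) - ∑ j, (μ j)⁻¹ := by
  have hp : ∀ j, 0 < μ j := fun j => by linarith [hμ j]
  obtain ⟨δ, hδ⟩ : ∃ δ, δ = (∑ j, (μ j)⁻¹) - 1 / 2 := ⟨_, rfl⟩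
  have hδ' : δ = ∑ j, (μ j * (μ j + 1))⁻¹ := by
    rw [hδ, ← hs, ← Finset.sum_sub_distrib]
    refine Finset.sum_congr rfl fun j _ => ?_
    have := hp j
    field_simp
    ring
  have hne : (Finset.univ : Finset (Fin l)).Nonempty := by
    by_contra h
    rw [Finset.not_nonempty_iff_eq_empty] at h
    rw [h] at hs
    norm_num at hs
  have hδ0 : 0 < δ := by
    rw [hδ']
    exact Finset.sum_pos (fun j _ => by have := hp j; positivity) hne
  rw [← hδ]
  refine ⟨hδ0, ?_⟩
  -- The factor $(\mu_j+1)^{-1}$ is split evenly so that the second sum of squares is the potential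
  -- $1/2$.
  have hcs := Finset.sum_mul_sq_le_sq_mul_sq Finset.univ
    (fun j => (μ j)⁻¹ * (√(μ j + 1))⁻¹) (fun j => (√(μ j + 1))⁻¹)
  have hsq : ∀ j, √(μ j + 1) ^ 2 = μ j + 1 := fun j => Real.sq_sqrt (by linarith [hp j])
  have e1 : ∀ j, (μ j)⁻¹ * (√(μ j + 1))⁻¹ * (√(μ j + 1))⁻¹ = (μ j * (μ j + 1))⁻¹ := fun j => by
    rw [mul_assoc, ← sq, inv_pow, hsq, mul_inv]
  have e2 : ∀ j, (√(μ j + 1))⁻¹ ^ 2 = (μ j + 1)⁻¹ := fun j => by rw [inv_pow, hsq]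
  simp only [e1, e2, hs, mul_pow] at hcs
  rw [← hδ'] at hcs
  have e3 : ∑ j, (μ j)⁻¹ ^ 2 * (μ j + 1)⁻¹ = (∑ j, (μ j)⁻¹ ^ 2) - δ := by
    rw [hδ', ← Finset.sum_sub_distrib]
    refine Finset.sum_congr rfl fun j _ => ?_
    have := hp j
    field_simp
    ring
  rw [e3] at hcs
  rw [le_sub_iff_add_le, le_div_iff₀ hδ0]
  have : ∑ j, (μ j)⁻¹ = δ + 1 / 2 := by rw [hδ]; ring
  rw [this]
  nlinarith

theorem BarrierInv.posDef {l : ℕ} {T : Matrix (Fin l) (Fin l) ℝ} (hT : BarrierInv T) :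
    T.PosDef := by
  obtain ⟨Q, μ, h1, h2, rfl, hμ, -⟩ := hT.spectral
  have h := (Matrix.PosDef.diagonal (d := μ) fun j => by linarith [hμ j]).mul_mul_conjTranspose_same
    (B := Q) (by
      intro x y hxy
      have := congrArg (fun v => Matrix.vecMul v Qᵀ) hxy
      simpa [Matrix.vecMul_vecMul, h2] using this)
  simpa using h

/-- Some row has a positive score that exceeds its share of the weights. -/
theorem BarrierInv.exists_score {d l : ℕ} {T : Matrix (Fin l) (Fin l) ℝ} (hT : BarrierInv T)
    {Z : Matrix (Fin d) (Fin l) ℝ} (hZ : Zᵀ * Z = 1) {a : Fin d → ℝ} (ha : ∀ i, 0 ≤ a i) :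
    0 < (T⁻¹).trace - 1 / 2 ∧
      ∃ i, 0 < score Z T⁻¹ i ∧ a i / (2 * ∑ j, a j) ≤ score Z T⁻¹ i := by
  obtain ⟨Q, μ, h1, h2, rfl, hμ, hs⟩ := hT.spectral
  rw [inv_orthogonal_diagonal h1 h2 (fun j => by linarith [hμ j])]
  obtain ⟨hpos, hineq⟩ := barrier_sum_ineq hμ hs
  have htr := trace_orthogonal_diagonal (μ := fun j => (μ j)⁻¹) h1
  have hfr : frobSq (Q * Matrix.diagonal (fun j => (μ j)⁻¹) * Qᵀ) = ∑ j, (μ j)⁻¹ ^ 2 := by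
    rw [frobSq_mul_right h1, frobSq_mul_left h1]
    simp [frobSq, Matrix.diagonal_apply]
  obtain ⟨M, hM⟩ : ∃ M, M = Q * Matrix.diagonal (fun j => (μ j)⁻¹) * Qᵀ := ⟨_, rfl⟩
  rw [← hM] at htr hfr ⊢
  rw [← htr] at hpos hineq
  refine ⟨hpos, ?_⟩
  rw [← hfr] at hineq
  -- Since $Z^TZ=1$, summing over the rows of `Z` turns the quadratic forms into the Frobenius norm
  -- and the trace of `M`.
  have hsum : ∑ i, score Z M i = frobSq M / (M.trace - 1 / 2) - M.trace := by
    simp only [score]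
    rw [Finset.sum_sub_distrib, ← Finset.sum_div]
    congr 1
    · rw [← frobSq_mul_left hZ M]; rfl
    · have : ∑ i, ∑ b, (Z * M) i b * Z i b = (Zᵀ * (Z * M)).trace := by
        simp only [Matrix.trace, Matrix.diag, Matrix.mul_apply (M := Zᵀ), Matrix.transpose_apply]
        rw [Finset.sum_comm]
        simp only [mul_comm]
      rw [this, ← Matrix.mul_assoc, hZ, Matrix.one_mul]
  -- Averaging: the scores add up to at least $1/2$ and the shares to at most $1/2$. If every
  -- positive score were below its share, the strict inequality at one positive score would
  -- contradict this.
  by_contra! hcon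
  have ha0 : ∀ i, 0 ≤ a i / (2 * ∑ j, a j) := fun i =>
    div_nonneg (ha i) (mul_nonneg zero_le_two (Finset.sum_nonneg fun j _ => ha j))
  have hle : ∀ i, score Z M i ≤ a i / (2 * ∑ j, a j) := fun i => by
    by_cases h : 0 < score Z M i
    · exact (hcon i h).le
    · exact (not_lt.1 h).trans (ha0 i)
  have hsuma : ∑ i, a i / (2 * ∑ j, a j) ≤ 1 / 2 := by
    rw [← Finset.sum_div]
    by_cases h : ∑ j, a j = 0
    · rw [h]; norm_num
    · apply le_of_eq; field_simp
  have htot : 1 / 2 ≤ ∑ i, score Z M i := by rw [hsum]; exact hineq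
  obtain ⟨i, -, hi⟩ : ∃ i ∈ Finset.univ, 0 < score Z M i := by
    by_contra! h
    linarith [Finset.sum_nonpos h]
  have : ∑ i, score Z M i < ∑ i, a i / (2 * ∑ j, a j) :=
    Finset.sum_lt_sum (fun i _ => hle i) ⟨i, Finset.mem_univ i, hcon i hi⟩
  linarith

/-- One step of the barrier method. -/
theorem BarrierInv.step {d l : ℕ} {T : Matrix (Fin l) (Fin l) ℝ} (hT : BarrierInv T)
    (Z : Matrix (Fin d) (Fin l) ℝ) (i : Fin d) (htr : 0 < (T⁻¹).trace - 1 / 2)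
    (hi : 0 < score Z T⁻¹ i) :
    BarrierInv (T - 1 + (score Z T⁻¹ i)⁻¹ • Matrix.vecMulVec (Z i) (Z i)) := by
  have hP := hT.posDef
  have hTu : IsUnit T := hP.isUnit
  have hdet : IsUnit T.det := (Matrix.isUnit_iff_isUnit_det T).1 hTu
  obtain ⟨z, hz⟩ : ∃ z, z = Z i := ⟨_, rfl⟩
  obtain ⟨M, hM⟩ : ∃ M, M = T⁻¹ := ⟨_, rfl⟩
  obtain ⟨L, hL⟩ : ∃ L, L = score Z T⁻¹ i := ⟨_, rfl⟩
  rw [← hL, ← hz]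
  rw [← hL] at hi
  have hMT : M * T = 1 := by rw [hM]; exact Matrix.nonsing_inv_mul _ hdet
  have hTM : T * M = 1 := by rw [hM]; exact Matrix.mul_nonsing_inv _ hdet
  have hMP : M.PosDef := by rw [hM]; exact hP.inv
  have hMs : Mᵀ = M := by simpa using hMP.isHermitian.eq
  have hrow : ∀ b, (Z * M) i b = (M.mulVec z) b := fun b => by
    have : (Z * M) i b = (Matrix.vecMul z M) b := by
      rw [hz]; rfl
    rw [this, ← Matrix.mulVec_transpose, hMs]
  obtain ⟨w, hw⟩ : ∃ w, w = M.mulVec z := ⟨_, rfl⟩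
  have hLe : L = (w ⬝ᵥ w) / (M.trace - 1 / 2) - w ⬝ᵥ z := by
    rw [hL, score, ← hM]
    simp only [hrow, ← hw, dotProduct, ← hz, sq]
  have hq1 : 0 ≤ w ⬝ᵥ z := by
    have := hMP.posSemidef.dotProduct_mulVec_nonneg z
    rw [hw, dotProduct_comm]
    simpa using this
  rw [← hM] at htr
  have hsum : L + w ⬝ᵥ z = (w ⬝ᵥ w) / (M.trace - 1 / 2) := by rw [hLe]; ring
  have hpos : 0 < L + w ⬝ᵥ z := by linarith
  -- If $w=Mz$ vanished the score would be zero; this positivity permits the final cancellation.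
  have hww : 0 < w ⬝ᵥ w := by
    rw [hsum] at hpos
    by_contra h
    exact absurd hpos (not_lt.2 (div_nonpos_of_nonpos_of_nonneg (not_lt.1 h) htr.le))
  have hadd : T - 1 + L⁻¹ • Matrix.vecMulVec z z + 1 = T + L⁻¹ • Matrix.vecMulVec z z := by
    abel
  rw [BarrierInv, hadd]
  have hvv : (Matrix.vecMulVec z z).PosSemidef := by
    simpa using Matrix.posSemidef_vecMulVec_self_star z
  refine ⟨hP.add_posSemidef (hvv.smul (inv_pos.2 hi).le), ?_⟩
  have hTw : T.mulVec w = z := by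
    rw [hw, Matrix.mulVec_mulVec, hTM, Matrix.one_mulVec]
  -- Sherman–Morrison for the rank-one update of weight $L^{-1}$.
  have hinv : (T + L⁻¹ • Matrix.vecMulVec z z)⁻¹ = M - (L + w ⬝ᵥ z)⁻¹ • Matrix.vecMulVec w w := by
    refine Matrix.inv_eq_right_inv ?_
    have e1 : T * Matrix.vecMulVec w w = Matrix.vecMulVec z w := by
      rw [Matrix.mul_vecMulVec, hTw]
    have e2 : Matrix.vecMulVec z z * M = Matrix.vecMulVec z w := by
      rw [Matrix.vecMulVec_mul, ← Matrix.mulVec_transpose, hMs, hw]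
    have e3 : Matrix.vecMulVec z z * Matrix.vecMulVec w w =
        (w ⬝ᵥ z) • Matrix.vecMulVec z w := by
      ext a b
      simp only [Matrix.mul_apply, Matrix.vecMulVec_apply, Matrix.smul_apply, smul_eq_mul,
        dotProduct, Finset.sum_mul]
      exact Finset.sum_congr rfl fun c _ => by ring
    rw [Matrix.add_mul, Matrix.mul_sub, Matrix.mul_sub, hTM, Matrix.mul_smul, e1,
      Matrix.smul_mul, e2, Matrix.smul_mul, Matrix.mul_smul, e3]
    have : (1 : Matrix (Fin l) (Fin l) ℝ) - (L + w ⬝ᵥ z)⁻¹ • Matrix.vecMulVec z w +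
        (L⁻¹ • Matrix.vecMulVec z w -
          L⁻¹ • (L + w ⬝ᵥ z)⁻¹ • (w ⬝ᵥ z) • Matrix.vecMulVec z w) =
        1 + (-(L + w ⬝ᵥ z)⁻¹ + L⁻¹ - L⁻¹ * ((L + w ⬝ᵥ z)⁻¹ * (w ⬝ᵥ z))) •
          Matrix.vecMulVec z w := by
      simp only [sub_smul, add_smul, neg_smul, smul_smul]
      abel
    rw [this]
    have h0 : -(L + w ⬝ᵥ z)⁻¹ + L⁻¹ - L⁻¹ * ((L + w ⬝ᵥ z)⁻¹ * (w ⬝ᵥ z)) = 0 := by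
      field_simp
      ring
    rw [h0, zero_smul, add_zero]
  -- The score is the value of $L$ for which the trace drops by $|w|^2/(L+w\cdot
  -- z)=\mathrm{tr}\,M-\frac12$, so the potential returns to exactly $1/2$.
  rw [hinv, Matrix.trace_sub, Matrix.trace_smul, Matrix.trace_vecMulVec, hsum, smul_eq_mul]
  field_simp
  ring

theorem barrierInv_init {l : ℕ} (hl : 0 < l) :
    BarrierInv ((2 * (l : ℝ) - 1) • (1 : Matrix (Fin l) (Fin l) ℝ)) := by
  have hl' : (0 : ℝ) < l := by exact_mod_cast hl
  have e : (2 * (l : ℝ) - 1) • (1 : Matrix (Fin l) (Fin l) ℝ) + 1 =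
      Matrix.diagonal fun _ => 2 * (l : ℝ) := by
    rw [← Matrix.smul_one_eq_diagonal, sub_smul, one_smul, sub_add_cancel]
  rw [BarrierInv, e]
  refine ⟨Matrix.PosDef.diagonal fun _ => by positivity, ?_⟩
  have : (Matrix.diagonal fun _ : Fin l => 2 * (l : ℝ))⁻¹ =
      Matrix.diagonal fun _ : Fin l => (2 * (l : ℝ))⁻¹ := by
    refine Matrix.inv_eq_right_inv ?_
    rw [Matrix.diagonal_mul_diagonal, ← Matrix.diagonal_one]
    congr 1
    funext _
    field_simp
  rw [this, Matrix.trace_diagonal]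
  simp
  field_simp

/-! ### From a spectral lower bound to a column approximation -/

/-- The squared norms of the columns of a matrix. -/
def colSq {n d : ℕ} (E : Matrix (Fin n) (Fin d) ℝ) (i : Fin d) : ℝ :=
  ∑ a, E a i ^ 2

theorem colSq_nonneg {n d : ℕ} (E : Matrix (Fin n) (Fin d) ℝ) (i : Fin d) : 0 ≤ colSq E i :=
  Finset.sum_nonneg fun _ _ => sq_nonneg _

theorem sum_colSq {n d : ℕ} (E : Matrix (Fin n) (Fin d) ℝ) : ∑ i, colSq E i = frobSq E :=
  Finset.sum_comm

/-- Weighted columns whose rows in `Z` dominate a multiple of the identity span a good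
approximation of `X`. -/
theorem exists_column_approx {n d l m : ℕ} (X : Matrix (Fin n) (Fin d) ℝ)
    {Z : Matrix (Fin d) (Fin l) ℝ} (hZ : Zᵀ * Z = 1) (ι : Fin m → Fin d) {τ : Fin m → ℝ}
    (hτ : ∀ u, 0 ≤ τ u) {c : ℝ} (hc : 0 < c)
    (hG : ((∑ u, τ u • Matrix.vecMulVec (Z (ι u)) (Z (ι u))) - c • 1).PosDef) :
    ∃ W : Matrix (Fin m) (Fin d) ℝ, frobSq (X - X.submatrix id ι * W) ≤
      frobSq (X - X * Z * Zᵀ) + (∑ u, τ u * colSq (X - X * Z * Zᵀ) (ι u)) / c := by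
  obtain ⟨G, hGd⟩ : ∃ G, G = ∑ u, τ u • Matrix.vecMulVec (Z (ι u)) (Z (ι u)) := ⟨_, rfl⟩
  obtain ⟨E, hE⟩ : ∃ E, E = X - X * Z * Zᵀ := ⟨_, rfl⟩
  rw [← hGd] at hG
  rw [← hE]
  have hGP : G.PosDef := by
    have h1 : (c • (1 : Matrix (Fin l) (Fin l) ℝ)).PosDef := by
      rw [Matrix.smul_one_eq_diagonal]; exact Matrix.PosDef.diagonal fun _ => hc
    simpa using hG.add h1
  have hdet : IsUnit G.det := (Matrix.isUnit_iff_isUnit_det G).1 hGP.isUnit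
  have hGs : Gᵀ = G := by simpa using hGP.isHermitian.eq
  have hGis : (G⁻¹)ᵀ = G⁻¹ := by rw [Matrix.transpose_nonsing_inv, hGs]
  obtain ⟨S, hS⟩ : ∃ S : Matrix (Fin m) (Fin l) ℝ, S = Z.submatrix ι id := ⟨_, rfl⟩
  have hGS : G = Sᵀ * Matrix.diagonal τ * S := by
    rw [hGd]
    ext a b
    rw [Matrix.sum_apply, Matrix.mul_apply]
    refine Finset.sum_congr rfl fun u _ => ?_
    simp [hS, Matrix.vecMulVec_apply, Matrix.mul_diagonal]
    ring
  -- Split each selected column into its part $XZz_u$ and its residual. The weights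
  -- $\mathrm{diag}(\tau)SG^{-1}Z^T$ reproduce $XZZ^T$ from the first parts, and only $YZ^T$ is left
  -- over.
  have hX : X.submatrix id ι = X * Z * Sᵀ + E.submatrix id ι := by
    ext a u
    simp [hE, hS, Matrix.mul_apply]
  obtain ⟨Y, hY⟩ : ∃ Y, Y = E.submatrix id ι * Matrix.diagonal τ * S * G⁻¹ := ⟨_, rfl⟩
  refine ⟨Matrix.diagonal τ * S * G⁻¹ * Zᵀ, ?_⟩
  have hdiff : X - X.submatrix id ι * (Matrix.diagonal τ * S * G⁻¹ * Zᵀ) = E + -(Y * Zᵀ) := by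
    have h1 : X * Z * Sᵀ * (Matrix.diagonal τ * S * G⁻¹ * Zᵀ) = X * Z * Zᵀ := by
      have : X * Z * Sᵀ * (Matrix.diagonal τ * S * G⁻¹ * Zᵀ) =
          X * Z * ((Sᵀ * Matrix.diagonal τ * S) * G⁻¹) * Zᵀ := by
        simp only [Matrix.mul_assoc]
      rw [this, ← hGS, Matrix.mul_nonsing_inv _ hdet, Matrix.mul_one]
    rw [hX, Matrix.add_mul, h1, hY, hE]
    simp only [Matrix.mul_assoc]
    abel
  -- The rows of `E` are orthogonal to the span of `Z` and the rows of $YZ^T$ lie in it, so the two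
  -- errors add in squares.
  have hEZ : E * Z = 0 := by
    rw [hE, Matrix.sub_mul, Matrix.mul_assoc _ Zᵀ, hZ, Matrix.mul_one, sub_self]
  rw [hdiff, frobSq_add_of_mul_transpose_eq_zero, frobSq_neg, frobSq_mul_right hZ]
  swap
  · rw [Matrix.transpose_neg, Matrix.transpose_mul, Matrix.transpose_transpose, Matrix.mul_neg,
      ← Matrix.mul_assoc, hEZ, Matrix.zero_mul, neg_zero]
  refine add_le_add le_rfl ?_
  have hrow : ∀ a, c * ∑ b, Y a b ^ 2 ≤ ∑ u, τ u * E a (ι u) ^ 2 := by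
    intro a
    obtain ⟨y, hy⟩ : ∃ y, y = Y a := ⟨_, rfl⟩
    rw [← hy]
    have hGy : ∀ b, (G.mulVec y) b = ∑ u, τ u * E a (ι u) * S u b := by
      intro b
      have h1 : Y * G = E.submatrix id ι * Matrix.diagonal τ * S := by
        rw [hY, Matrix.mul_assoc _ _ G, Matrix.nonsing_inv_mul _ hdet, Matrix.mul_one]
      have h2 := congrFun (congrFun h1 a) b
      have h3 : (Y * G) a b = (G.mulVec y) b := by
        rw [← hGs, Matrix.mulVec_transpose, hy]
        rw [hGs]; rfl
      rw [← h3, h2, Matrix.mul_apply]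
      refine Finset.sum_congr rfl fun u _ => ?_
      rw [Matrix.mul_diagonal, Matrix.submatrix_apply, id]
      ring
    have hq1 : y ⬝ᵥ G.mulVec y = ∑ u, τ u * E a (ι u) * (S u ⬝ᵥ y) := by
      simp only [dotProduct, hGy, Finset.mul_sum]
      rw [Finset.sum_comm]
      exact Finset.sum_congr rfl fun u _ => Finset.sum_congr rfl fun b _ => by ring
    have hq2 : y ⬝ᵥ G.mulVec y = ∑ u, τ u * (S u ⬝ᵥ y) ^ 2 := by
      have h1 : G.mulVec y = Sᵀ.mulVec ((Matrix.diagonal τ).mulVec (S.mulVec y)) := by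
        rw [hGS, Matrix.mulVec_mulVec, Matrix.mulVec_mulVec, Matrix.mul_assoc]
      rw [h1, Matrix.dotProduct_mulVec, Matrix.vecMul_transpose, dotProduct]
      refine Finset.sum_congr rfl fun u _ => ?_
      rw [Matrix.mulVec_diagonal]
      simp only [Matrix.mulVec]
      ring
    -- Writing $q=y^TGy$ in two ways, weighted Cauchy–Schwarz yields
    -- $q^2\le(\sum\tau_uE_{a,\iota_u}^2)\,q$; cancelling one $q$ avoids any bound on $G$ from
    -- above.
    have hcs : (y ⬝ᵥ G.mulVec y) ^ 2 ≤
        (∑ u, τ u * E a (ι u) ^ 2) * (y ⬝ᵥ G.mulVec y) := by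
      have := Finset.sum_mul_sq_le_sq_mul_sq Finset.univ
        (fun u => √(τ u) * E a (ι u)) (fun u => √(τ u) * (S u ⬝ᵥ y))
      have e1 : ∀ u, √(τ u) * E a (ι u) * (√(τ u) * (S u ⬝ᵥ y)) =
          τ u * E a (ι u) * (S u ⬝ᵥ y) := fun u => by
        have := Real.mul_self_sqrt (hτ u)
        linear_combination (E a (ι u) * (S u ⬝ᵥ y)) * this
      simp only [e1, mul_pow, Real.sq_sqrt (hτ _)] at this
      rwa [← hq1, ← hq2] at this
    have hlow : c * ∑ b, y b ^ 2 ≤ y ⬝ᵥ G.mulVec y := by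
      have h := hG.posSemidef.dotProduct_mulVec_nonneg y
      rw [Matrix.sub_mulVec, Matrix.smul_mulVec, Matrix.one_mulVec, dotProduct_sub,
        dotProduct_smul, smul_eq_mul] at h
      simp only [star_trivial] at h
      have : y ⬝ᵥ y = ∑ b, y b ^ 2 := Finset.sum_congr rfl fun b _ => (sq _).symm
      rw [this] at h
      linarith
    have hN : 0 ≤ ∑ u, τ u * E a (ι u) ^ 2 :=
      Finset.sum_nonneg fun u _ => mul_nonneg (hτ u) (sq_nonneg _)
    by_cases h0 : y ⬝ᵥ G.mulVec y ≤ 0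
    · linarith
    · push Not at h0
      have : y ⬝ᵥ G.mulVec y ≤ ∑ u, τ u * E a (ι u) ^ 2 := by
        by_contra hlt
        push Not at hlt
        nlinarith
      linarith
  rw [le_div_iff₀ hc, mul_comm, frobSq, Finset.mul_sum]
  calc _ ≤ ∑ a, ∑ u, τ u * E a (ι u) ^ 2 := Finset.sum_le_sum fun a _ => hrow a
    _ = _ := by
      rw [Finset.sum_comm]
      simp only [colSq, Finset.mul_sum]

/-! ### Iterating the barrier method -/

/-- The state of the barrier method after `t` steps, in which the columns `ι 0, …, ι (t - 1)`
have been selected. -/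
def BarrierRun {d l : ℕ} (Z : Matrix (Fin d) (Fin l) ℝ) (a : Fin d → ℝ) (t : ℕ)
    (ι : ℕ → Fin d) (T : Matrix (Fin l) (Fin l) ℝ) : Prop :=
  BarrierInv T ∧ ∃ τ : ℕ → ℝ, (∀ u < t, 0 ≤ τ u ∧ τ u * a (ι u) ≤ 2 * ∑ i, a i) ∧
    T = (2 * (l : ℝ) - 1 - t) • 1 +
      ∑ u ∈ Finset.range t, τ u • Matrix.vecMulVec (Z (ι u)) (Z (ι u))

theorem BarrierRun.zero {d l : ℕ} (hl : 0 < l) (Z : Matrix (Fin d) (Fin l) ℝ) (a : Fin d → ℝ)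
    (ι : ℕ → Fin d) : BarrierRun Z a 0 ι ((2 * (l : ℝ) - 1) • 1) :=
  ⟨barrierInv_init hl, 0, by simp, by simp⟩

theorem BarrierRun.succ {d l t : ℕ} {Z : Matrix (Fin d) (Fin l) ℝ} (hZ : Zᵀ * Z = 1)
    {a : Fin d → ℝ} (ha : ∀ i, 0 ≤ a i) {ι : ℕ → Fin d} {T : Matrix (Fin l) (Fin l) ℝ}
    (h : BarrierRun Z a t ι T) {i : Fin d} (hi : 0 < score Z T⁻¹ i)
    (hi' : a i / (2 * ∑ j, a j) ≤ score Z T⁻¹ i) :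
    BarrierRun Z a (t + 1) (Function.update ι t i)
      (T - 1 + (score Z T⁻¹ i)⁻¹ • Matrix.vecMulVec (Z i) (Z i)) := by
  obtain ⟨hinv, τ, hτ, hT⟩ := h
  refine ⟨hinv.step Z i (hinv.exists_score hZ ha).1 hi,
    Function.update τ t (score Z T⁻¹ i)⁻¹, fun u hu => ?_, ?_⟩
  · by_cases hut : u = t
    · subst hut
      simp only [Function.update_self]
      refine ⟨(inv_pos.2 hi).le, ?_⟩
      -- With zero total weight the share is a division by zero and says nothing, but then `a i`
      -- itself is zero.
      by_cases h0 : ∑ j, a j = 0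
      · have : a i = 0 := (Finset.sum_eq_zero_iff_of_nonneg fun j _ => ha j).1 h0 i
          (Finset.mem_univ i)
        simp [this, h0]
      · have hpos : 0 < ∑ j, a j :=
          lt_of_le_of_ne (Finset.sum_nonneg fun j _ => ha j) (Ne.symm h0)
        rw [div_le_iff₀ (by positivity)] at hi'
        rw [inv_mul_le_iff₀ hi]
        exact hi'
    · simp only [Function.update_of_ne hut]
      exact hτ u (by omega)
  · rw [Finset.sum_range_succ, Function.update_self, Function.update_self]
    have : ∀ u ∈ Finset.range t, Function.update τ t (score Z T⁻¹ i)⁻¹ u •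
        Matrix.vecMulVec (Z (Function.update ι t i u)) (Z (Function.update ι t i u)) =
        τ u • Matrix.vecMulVec (Z (ι u)) (Z (ι u)) := fun u hu => by
      have hut : u ≠ t := (Finset.mem_range.1 hu).ne
      rw [Function.update_of_ne hut, Function.update_of_ne hut]
    rw [Finset.sum_congr rfl this, ← add_assoc]
    congr 1
    conv_lhs => rw [hT]
    push_cast
    rw [← sub_sub, sub_smul _ (1 : ℝ), one_smul]
    abel

theorem BarrierRun.exists_approx {n d l : ℕ} {X : Matrix (Fin n) (Fin d) ℝ}
    {Z : Matrix (Fin d) (Fin l) ℝ} (hZ : Zᵀ * Z = 1) (hl : 0 < l) {ι : ℕ → Fin d}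
    {T : Matrix (Fin l) (Fin l) ℝ}
    (h : BarrierRun Z (colSq (X - X * Z * Zᵀ)) (4 * l) ι T) :
    ∃ W : Matrix (Fin (4 * l)) (Fin d) ℝ,
      frobSq (X - X.submatrix id (fun u : Fin (4 * l) => ι u) * W) ≤ 5 * frobSq (X - X * Z * Zᵀ) := by
  obtain ⟨hinv, τ, hτ, hT⟩ := h
  have hl' : (0 : ℝ) < l := by exact_mod_cast hl
  -- After $4l$ unit moves the barrier, started at $-2l$, stands at $2l$: `T + 1` is $G-2l\cdot I$.
  -- The weighted residual is at most $4l\cdot2\sum a_i$, and division by $2l$ gives the factor 4.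
  obtain ⟨W, hW⟩ := exists_column_approx X hZ (fun u : Fin (4 * l) => ι u)
    (τ := fun u => τ u) (fun u => (hτ u u.2).1) (c := 2 * l) (by positivity) (by
      have e : (∑ u : Fin (4 * l), τ u • Matrix.vecMulVec (Z (ι u)) (Z (ι u))) -
          (2 * (l : ℝ)) • 1 = T + 1 := by
        rw [hT, Fin.sum_univ_eq_sum_range
          (fun u => τ u • Matrix.vecMulVec (Z (ι u)) (Z (ι u)))]
        have : (2 * (l : ℝ) - 1 - ((4 * l : ℕ) : ℝ)) = -(2 * l) - 1 := by push_cast; ring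
        rw [this, sub_smul, neg_smul, one_smul]
        abel
      rw [e]
      exact hinv.1)
  refine ⟨W, hW.trans ?_⟩
  rw [← sum_colSq (X - X * Z * Zᵀ)]
  have hS : ∑ u : Fin (4 * l), τ u * colSq (X - X * Z * Zᵀ) (ι u) ≤
      (4 * l) * (2 * ∑ i, colSq (X - X * Z * Zᵀ) i) := by
    calc _ ≤ ∑ _u : Fin (4 * l), 2 * ∑ i, colSq (X - X * Z * Zᵀ) i :=
          Finset.sum_le_sum fun u _ => (hτ u u.2).2
      _ = _ := by simp
  have : (∑ u : Fin (4 * l), τ u * colSq (X - X * Z * Zᵀ) (ι u)) / (2 * l) ≤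
      4 * ∑ i, colSq (X - X * Z * Zᵀ) i := by
    rw [div_le_iff₀ (by positivity)]
    linarith
  linarith

end SparseEncoder

namespace SparseEncoder

open Matrix

/-! ### Frequent directions -/

/-- The squared norm of `A x`, where `A` consists of the first `p` rows of `F`. -/
def rowsGram {d : ℕ} (F : ℕ → ℕ → ℝ) (p : ℕ) (x : Fin d → ℝ) : ℝ :=
  ∑ i ∈ Finset.range p, (∑ j : Fin d, F i j * x j) ^ 2

/-- The squared Frobenius norm of the first `p` rows of `F`. -/
def rowsSq (d : ℕ) (F : ℕ → ℕ → ℝ) (p : ℕ) : ℝ :=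
  ∑ i ∈ Finset.range p, ∑ j : Fin d, F i j ^ 2

/-- The first `r` rows of `G` are a sketch of the first `p` rows of `F` with loss `Δ`. -/
structure IsSketch (d r : ℕ) (F : ℕ → ℕ → ℝ) (p : ℕ) (G : ℕ → ℕ → ℝ) (Δ : ℝ) : Prop where
  le : ∀ x : Fin d → ℝ, rowsGram G r x ≤ rowsGram F p x
  ge : ∀ x : Fin d → ℝ, rowsGram F p x ≤ rowsGram G r x + Δ * ∑ j, x j ^ 2
  sq : r * Δ ≤ rowsSq d F p - rowsSq d G r

theorem IsSketch.zero {d r : ℕ} {F G : ℕ → ℕ → ℝ} (hG : ∀ i < r, ∀ j < d, G i j = 0) :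
    IsSketch d r F 0 G 0 := by
  have h1 : ∀ x : Fin d → ℝ, rowsGram G r x = 0 := fun x =>
    Finset.sum_eq_zero fun i hi => by
      rw [Finset.sum_eq_zero fun j _ => by
        rw [hG i (Finset.mem_range.1 hi) j j.2, zero_mul]]
      simp
  have h2 : rowsSq d G r = 0 :=
    Finset.sum_eq_zero fun i hi => Finset.sum_eq_zero fun j _ => by
      rw [hG i (Finset.mem_range.1 hi) j j.2]; simp
  refine ⟨fun x => ?_, fun x => ?_, ?_⟩
  · rw [h1]; simp [rowsGram]
  · rw [h1]; simp [rowsGram]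
  · rw [h2]; simp [rowsSq]

theorem rowsGram_eq {d p : ℕ} (F : ℕ → ℕ → ℝ) (x : Fin d → ℝ) :
    rowsGram F p x = ∑ i, ((Matrix.of fun (i : Fin p) (j : Fin d) => F i j).mulVec x) i ^ 2 := by
  rw [rowsGram, ← Fin.sum_univ_eq_sum_range (fun i => (∑ j : Fin d, F i j * x j) ^ 2)]
  rfl

theorem rowsSq_eq {d p : ℕ} (F : ℕ → ℕ → ℝ) :
    rowsSq d F p = frobSq (Matrix.of fun (i : Fin p) (j : Fin d) => F i j) := by
  rw [rowsSq, ← Fin.sum_univ_eq_sum_range (fun i => ∑ j : Fin d, F i j ^ 2)]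
  rfl

namespace SVD

variable {m n : ℕ} {A : Matrix (Fin m) (Fin n) ℝ} (D : SVD A)

/-- The singular values, padded by zeros. -/
noncomputable def sv (t : ℕ) : ℝ :=
  if h : t < A.rank then D.σ ⟨t, h⟩ else 0

theorem sv_coe (t : Fin A.rank) : D.sv t = D.σ t := by
  rw [sv, dif_pos t.2]

theorem sv_nonneg (t : ℕ) : 0 ≤ D.sv t := by
  rw [sv]
  split_ifs
  · exact (D.pos _).le
  · exact le_rfl

theorem sv_anti : Antitone D.sv := fun s t hst => by
  by_cases ht : t < A.rank
  · rw [sv, sv, dif_pos ht, dif_pos (hst.trans_lt ht)]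
    exact D.anti hst
  · rw [sv, dif_neg ht]
    exact D.sv_nonneg s

theorem sum_mulVec_sq (x : Fin n → ℝ) :
    ∑ i, (A.mulVec x) i ^ 2 = ∑ t, D.σ t ^ 2 * (D.Vᵀ.mulVec x) t ^ 2 := by
  have h1 : ∑ i, (A.mulVec x) i ^ 2 = frobSq (A * Matrix.of fun i (_ : Fin 1) => x i) := by
    simp [frobSq, Matrix.mul_apply, Matrix.mulVec, dotProduct]
  rw [h1]
  refine (congrArg (fun M => frobSq (M * Matrix.of fun i (_ : Fin 1) => x i)) D.eq).trans ?_
  rw [Matrix.mul_assoc, Matrix.mul_assoc, frobSq_mul_left D.orthU]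
  simp only [frobSq, Matrix.diagonal_mul, mul_pow, Finset.univ_unique, Finset.sum_singleton]
  rfl

theorem sum_transpose_mulVec_sq_le (x : Fin n → ℝ) :
    ∑ t, (D.Vᵀ.mulVec x) t ^ 2 ≤ ∑ j, x j ^ 2 := by
  have := frobSq_transpose_mul_le D.orthV (Matrix.of fun i (_ : Fin 1) => x i)
  simpa [frobSq, Matrix.mul_apply, Matrix.mulVec, dotProduct] using this

end SVD

/-- Replaces the index type `Fin A.rank` by a fixed range with zero padding, so that sums over
singular vectors match the loops of the program. -/
theorem sum_fin_eq_sum_range_dite {l N : ℕ} (hl : l ≤ N) (f : Fin l → ℝ) :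
    ∑ t, f t = ∑ t ∈ Finset.range N, if h : t < l then f ⟨t, h⟩ else 0 := by
  rw [← Finset.sum_subset (Finset.range_mono hl) (fun x _ hx => by
    rw [dif_neg (by simpa using hx)])]
  rw [← Fin.sum_univ_eq_sum_range (fun t => if h : t < l then f ⟨t, h⟩ else 0)]
  exact Finset.sum_congr rfl fun t _ => by rw [dif_pos t.2]

/-- One shrinking step of the method of frequent directions. -/
theorem IsSketch.step {d r p : ℕ} {F G G' buf : ℕ → ℕ → ℝ} {Δ : ℝ}
    (h : IsSketch d r F p G Δ)
    (hb1 : ∀ i < r, ∀ j < d, buf i j = G i j)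
    (hb2 : ∀ i < r, ∀ j < d, buf (r + i) j = F (p + i) j)
    (D : SVD (Matrix.of fun (i : Fin (r + r)) (j : Fin d) => buf i j)) (V : ℕ → ℕ → ℝ)
    (hV : ∀ (j : Fin d) (t : Fin (Matrix.of fun (i : Fin (r + r)) (j : Fin d) => buf i j).rank),
      V j t = D.V j t)
    (hG' : ∀ i < r, ∀ j < d, G' i j = √(D.sv i * D.sv i - D.sv r * D.sv r) * V j i) :
    IsSketch d r F (p + r) G' (Δ + D.sv r ^ 2) := by
  obtain ⟨ρ, hρ⟩ : ∃ ρ, ρ = (Matrix.of fun (i : Fin (r + r)) (j : Fin d) => buf i j).rank :=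
    ⟨_, rfl⟩
  obtain ⟨δ, hδ⟩ : ∃ δ, δ = D.sv r ^ 2 := ⟨_, rfl⟩
  rw [← hδ]
  have hδ0 : 0 ≤ δ := hδ ▸ sq_nonneg _
  have hlt : ∀ i < r, δ ≤ D.sv i ^ 2 := fun i hi => by
    rw [hδ]; exact pow_le_pow_left₀ (D.sv_nonneg _) (D.sv_anti hi.le) 2
  have hge : ∀ i, r ≤ i → D.sv i ^ 2 ≤ δ := fun i hi => by
    rw [hδ]; exact pow_le_pow_left₀ (D.sv_nonneg _) (D.sv_anti hi) 2
  have hsq : ∀ i < r, √(D.sv i * D.sv i - D.sv r * D.sv r) ^ 2 = D.sv i ^ 2 - δ := fun i hi => by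
    rw [Real.sq_sqrt]
    · rw [hδ]; ring
    · have := hlt i hi
      rw [hδ] at this
      nlinarith
  -- coefficients of the rows of the new sketch vanish beyond the rank
  have hz : ∀ i < r, ρ ≤ i → D.sv i ^ 2 - δ = 0 := fun i hi hi' => by
    have h0 : D.sv i = 0 := by rw [SVD.sv, dif_neg (by omega)]
    have := hlt i hi
    rw [h0] at this ⊢
    linarith
  have hN : ρ ≤ ρ + r := Nat.le_add_right _ _
  have hbufG : ∀ x : Fin d → ℝ, rowsGram buf (r + r) x =
      rowsGram G r x + (rowsGram F (p + r) x - rowsGram F p x) := fun x => by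
    simp only [rowsGram, Finset.sum_range_add _ r r, Finset.sum_range_add _ p r]
    rw [add_sub_cancel_left]
    congr 1
    · exact Finset.sum_congr rfl fun i hi => by
        rw [Finset.sum_congr rfl fun j _ => by rw [hb1 i (Finset.mem_range.1 hi) j j.2]]
    · exact Finset.sum_congr rfl fun i hi => by
        rw [Finset.sum_congr rfl fun j _ => by rw [hb2 i (Finset.mem_range.1 hi) j j.2]]
  have hbufS : rowsSq d buf (r + r) = rowsSq d G r + (rowsSq d F (p + r) - rowsSq d F p) := by
    simp only [rowsSq, Finset.sum_range_add _ r r, Finset.sum_range_add _ p r]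
    rw [add_sub_cancel_left]
    congr 1
    · exact Finset.sum_congr rfl fun i hi => by
        rw [Finset.sum_congr rfl fun j _ => by rw [hb1 i (Finset.mem_range.1 hi) j j.2]]
    · exact Finset.sum_congr rfl fun i hi => by
        rw [Finset.sum_congr rfl fun j _ => by rw [hb2 i (Finset.mem_range.1 hi) j j.2]]
  -- Everything is diagonal in the right singular basis of the buffer: $w$ consists of the squared
  -- coordinates of $x$. The old form has coefficients $\sigma_t^2$, the new one $\sigma_t^2-\delta$
  -- for $t<r$ and zero beyond; they differ by values in $[0,\delta]$.
  have key : ∀ x : Fin d → ℝ, ∃ w : ℕ → ℝ, (∀ t, 0 ≤ w t) ∧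
      (∑ t ∈ Finset.range (ρ + r), w t ≤ ∑ j, x j ^ 2) ∧
      rowsGram buf (r + r) x = ∑ t ∈ Finset.range (ρ + r), D.sv t ^ 2 * w t ∧
      rowsGram G' r x =
        ∑ t ∈ Finset.range (ρ + r), (if t < r then D.sv t ^ 2 - δ else 0) * w t := by
    intro x
    refine ⟨fun t => if h : t < ρ then (D.Vᵀ.mulVec x) ⟨t, hρ ▸ h⟩ ^ 2 else 0, fun t => ?_, ?_,
      ?_, ?_⟩
    · dsimp only
      split_ifs
      · exact sq_nonneg _
      · exact le_rfl
    · have := D.sum_transpose_mulVec_sq_le x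
      rw [sum_fin_eq_sum_range_dite (hρ ▸ hN)] at this
      subst hρ
      exact this
    · rw [rowsGram_eq, D.sum_mulVec_sq, sum_fin_eq_sum_range_dite (hρ ▸ hN)]
      subst hρ
      refine Finset.sum_congr rfl fun t _ => ?_
      dsimp only
      split_ifs with ht
      · rw [SVD.sv, dif_pos ht]
      · rw [mul_zero]
    · rw [rowsGram, add_comm ρ r, Finset.sum_range_add]
      rw [Finset.sum_eq_zero (s := Finset.range ρ) (fun t _ => by
        rw [if_neg (by omega), zero_mul]), add_zero]
      refine Finset.sum_congr rfl fun i hi => ?_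
      have hi' := Finset.mem_range.1 hi
      have e : ∑ j : Fin d, G' i j * x j =
          √(D.sv i * D.sv i - D.sv r * D.sv r) * ∑ j : Fin d, V j i * x j := by
        rw [Finset.mul_sum]
        exact Finset.sum_congr rfl fun j _ => by rw [hG' i hi' j j.2]; ring
      rw [if_pos hi', e, mul_pow, hsq i hi']
      dsimp only
      by_cases hiρ : i < ρ
      · rw [dif_pos hiρ]
        congr 2
        exact Finset.sum_congr rfl fun j _ => congrArg (· * x j) (hV j ⟨i, hρ ▸ hiρ⟩)
      · rw [hz i hi' (by omega), zero_mul, zero_mul]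
  refine ⟨fun x => ?_, fun x => ?_, ?_⟩
  · obtain ⟨w, hw0, -, hw2, hw3⟩ := key x
    have h1 := h.le x
    have : rowsGram G' r x ≤ rowsGram buf (r + r) x := by
      rw [hw2, hw3]
      refine Finset.sum_le_sum fun t _ => mul_le_mul_of_nonneg_right ?_ (hw0 t)
      split_ifs
      · linarith
      · exact sq_nonneg _
    rw [hbufG] at this
    linarith
  · obtain ⟨w, hw0, hw1, hw2, hw3⟩ := key x
    have h1 := h.ge x
    have : rowsGram buf (r + r) x ≤ rowsGram G' r x + δ * ∑ j, x j ^ 2 := by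
      calc rowsGram buf (r + r) x ≤ ∑ t ∈ Finset.range (ρ + r),
            ((if t < r then D.sv t ^ 2 - δ else 0) * w t + δ * w t) := by
            rw [hw2]
            refine Finset.sum_le_sum fun t _ => ?_
            rw [← add_mul]
            refine mul_le_mul_of_nonneg_right ?_ (hw0 t)
            split_ifs with ht
            · linarith
            · linarith [hge t (not_lt.1 ht)]
        _ = rowsGram G' r x + δ * ∑ t ∈ Finset.range (ρ + r), w t := by
            rw [Finset.sum_add_distrib, hw3, Finset.mul_sum]
        _ ≤ _ := by nlinarith
    rw [hbufG] at this
    linarith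
  · have h1 := h.sq
    have hS1 : rowsSq d buf (r + r) = ∑ t ∈ Finset.range (r + ρ), D.sv t ^ 2 := by
      rw [rowsSq_eq, D.frobSq_eq, sum_fin_eq_sum_range_dite (N := r + ρ) (by omega)]
      refine Finset.sum_congr rfl fun t _ => ?_
      rw [SVD.sv]
      split_ifs <;> simp
    have hS2 : rowsSq d G' r = ∑ i ∈ Finset.range r, (D.sv i ^ 2 - δ) := by
      refine Finset.sum_congr rfl fun i hi => ?_
      have hi' := Finset.mem_range.1 hi
      have e : ∑ j : Fin d, G' i j ^ 2 = (D.sv i ^ 2 - δ) * ∑ j : Fin d, V j i ^ 2 := by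
        rw [← hsq i hi', Finset.mul_sum]
        exact Finset.sum_congr rfl fun j _ => by rw [hG' i hi' j j.2]; ring
      rw [e]
      by_cases hiρ : i < ρ
      · have h2 := congrFun (congrFun D.orthV ⟨i, hρ ▸ hiρ⟩) ⟨i, hρ ▸ hiρ⟩
        rw [Matrix.one_apply_eq, Matrix.mul_apply] at h2
        have : ∑ j : Fin d, V j i ^ 2 = 1 := by
          rw [← h2]
          exact Finset.sum_congr rfl fun j _ => by
            rw [Matrix.transpose_apply, ← hV j ⟨i, hρ ▸ hiρ⟩, pow_two]
        rw [this, mul_one]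
      · rw [hz i hi' (by omega), zero_mul]
    rw [Finset.sum_range_add] at hS1
    rw [Finset.sum_sub_distrib, Finset.sum_const, Finset.card_range, nsmul_eq_mul] at hS2
    -- The shrinkage removes $\delta$ from each of the first $r$ squared singular values and drops
    -- the others, so the squared Frobenius norm falls by at least $r\delta$.
    have hnn : 0 ≤ ∑ x ∈ Finset.range ρ, D.sv (r + x) ^ 2 :=
      Finset.sum_nonneg fun _ _ => sq_nonneg _
    rw [mul_add]
    linarith

theorem frobSq_mul_eq_sum_rowsGram {d p l : ℕ} (F : ℕ → ℕ → ℝ) (W : Matrix (Fin d) (Fin l) ℝ) :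
    frobSq ((Matrix.of fun (i : Fin p) (j : Fin d) => F i j) * W) =
      ∑ c, rowsGram F p (fun j => W j c) := by
  rw [frobSq, Finset.sum_comm]
  refine Finset.sum_congr rfl fun c _ => ?_
  rw [rowsGram_eq]
  rfl

/-- The leading right singular vectors of a sketch capture almost as much of a matrix as its own
singular vectors. -/
theorem IsSketch.frobSq_le {n d k r p l : ℕ} {X : Matrix (Fin n) (Fin d) ℝ} (hk : k ≤ X.rank)
    (hkr : k ≤ r) {F G : ℕ → ℕ → ℝ} {Δ : ℝ} (h : IsSketch d r F p G Δ) (hp : n ≤ p)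
    (hF : ∀ (i : Fin n) (j : Fin d), F i j = X i j) (hF0 : ∀ i, n ≤ i → ∀ j < d, F i j = 0)
    (D : SVD (Matrix.of fun (i : Fin r) (j : Fin d) => G i j))
    (hl : l ≤ (Matrix.of fun (i : Fin r) (j : Fin d) => G i j).rank)
    (hl' : l = min k (Matrix.of fun (i : Fin r) (j : Fin d) => G i j).rank) :
    ((r : ℝ) - k) * frobSq (X - X * D.leadV hl * (D.leadV hl)ᵀ) ≤
      r * frobSq (X - bestRank X k) := by
  obtain ⟨V, hV, hVo⟩ := exists_bestRank_eq X hk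
  rw [← hVo, frobSq_sub_mul_mul_transpose hV, frobSq_sub_mul_mul_transpose (D.leadV_orth hl)]
  -- The last batch may run past row $n$; the padding rows are zero and change neither the Gram form
  -- nor the norm.
  have hgram : ∀ x : Fin d → ℝ, rowsGram F p x = rowsGram F n x := fun x => by
    refine (Finset.sum_subset (Finset.range_mono hp) fun i _ hi => ?_).symm
    have hi' : n ≤ i := by simpa using hi
    rw [Finset.sum_eq_zero fun j _ => by rw [hF0 i hi' j j.2, zero_mul]]
    simp
  have hFX : (Matrix.of fun (i : Fin n) (j : Fin d) => F i j) = X := by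
    ext i j; exact hF i j
  have hsqX : rowsSq d F p = frobSq X := by
    rw [← hFX, ← rowsSq_eq]
    refine (Finset.sum_subset (Finset.range_mono hp) fun i _ hi => ?_).symm
    have hi' : n ≤ i := by simpa using hi
    exact Finset.sum_eq_zero fun j _ => by rw [hF0 i hi' j j.2]; simp
  have hXW : ∀ {q : ℕ} (W : Matrix (Fin d) (Fin q) ℝ),
      frobSq (X * W) = ∑ c, rowsGram F p (fun j => W j c) := fun W => by
    rw [← hFX, frobSq_mul_eq_sum_rowsGram]
    simp only [hgram]
  obtain ⟨B, hB⟩ : ∃ B, B = Matrix.of fun (i : Fin r) (j : Fin d) => G i j := ⟨_, rfl⟩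
  have h1 : frobSq ((Matrix.of fun (i : Fin r) (j : Fin d) => G i j) * D.leadV hl) ≤
      frobSq (X * D.leadV hl) := by
    rw [hXW, frobSq_mul_eq_sum_rowsGram]
    exact Finset.sum_le_sum fun c _ => h.le _
  have h2 := D.frobSq_mul_le_leadV hl hl' hV le_rfl
  have h3 : frobSq (X * V) ≤
      frobSq ((Matrix.of fun (i : Fin r) (j : Fin d) => G i j) * V) + k * Δ := by
    rw [hXW, frobSq_mul_eq_sum_rowsGram]
    have hone : ∀ c, ∑ j, V j c ^ 2 = 1 := fun c => by
      have := congrFun (congrFun hV c) c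
      rw [Matrix.one_apply_eq, Matrix.mul_apply] at this
      rw [← this]
      exact Finset.sum_congr rfl fun j _ => pow_two _
    calc _ ≤ ∑ c, (rowsGram G r (fun j => V j c) + Δ * ∑ j, V j c ^ 2) :=
          Finset.sum_le_sum fun c _ => h.ge _
      _ = _ := by
          simp only [hone]
          rw [Finset.sum_add_distrib]
          simp
  have h4 : frobSq ((Matrix.of fun (i : Fin r) (j : Fin d) => G i j) * V) ≤ rowsSq d G r := by
    rw [rowsSq_eq, ← frobSq_transpose, Matrix.transpose_mul,
      ← frobSq_transpose (Matrix.of fun (i : Fin r) (j : Fin d) => G i j)]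
    exact frobSq_transpose_mul_le hV _
  have h5 := h.sq
  rw [hsqX] at h5
  have hrk : (0 : ℝ) ≤ r - k := by
    have : (k : ℝ) ≤ r := by exact_mod_cast hkr
    linarith
  have hk0 : (0 : ℝ) ≤ k := by positivity
  -- Self-bounding of the loss:
  -- $r\Delta\le\|X\|^2-\|B\|^2\le\|X\|^2-\|BV\|^2\le\|X\|^2-\|XV\|^2+k\Delta$ for the sketch $B$
  -- and the optimal frame $V$.
  have h6 : ((r : ℝ) - k) * Δ ≤ frobSq X - frobSq (X * V) := by linarith
  have h7 : frobSq X - frobSq (X * D.leadV hl) ≤ frobSq X - frobSq (X * V) + k * Δ := by linarith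
  calc _ ≤ ((r : ℝ) - k) * (frobSq X - frobSq (X * V) + k * Δ) :=
        mul_le_mul_of_nonneg_left h7 hrk
    _ = ((r : ℝ) - k) * (frobSq X - frobSq (X * V)) + k * (((r : ℝ) - k) * Δ) := by ring
    _ ≤ ((r : ℝ) - k) * (frobSq X - frobSq (X * V)) + k * (frobSq X - frobSq (X * V)) := by
        gcongr
    _ = _ := by ring

end SparseEncoder

namespace SparseEncoder

open Matrix MeasureTheory ProbabilityTheory

/-! ### Adaptive sampling -/

instance : IsProbabilityMeasure coins := by
  unfold coins; infer_instance

/-- The random numbers affect the loss only through the sampled indices, which take finitely many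
values. Hence no measurability of the decomposition routine is needed. -/
theorem integrable_comp_of_finite {Ω α : Type*} [MeasurableSpace Ω] {μ : Measure Ω}
    [IsFiniteMeasure μ] [Finite α] [MeasurableSpace α] [MeasurableSingletonClass α] {f : Ω → α}
    (hf : Measurable f) (F : α → ℝ) : Integrable (fun ω => F (f ω)) μ :=
  (Integrable.of_finite (f := F) (μ := μ.map f)).comp_measurable hf

/-- The mean square error of the average of `s` independent samples. -/
theorem integral_average_sq_le {α : Type*} [Finite α] [MeasurableSpace α]
    [MeasurableSingletonClass α] {f : unitInterval → α} (hf : Measurable f) (g : α → ℝ) {s : ℕ}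
    (hs : 0 < s) :
    ∫ ω, ((∫ u, g (f u)) - (1 / (s : ℝ)) * ∑ l : Fin s, g (f (ω l))) ^ 2 ∂coins ≤
      (1 / (s : ℝ)) * ∫ u, g (f u) ^ 2 := by
  have hs' : (0 : ℝ) < s := by exact_mod_cast hs
  have hgm : Measurable g := measurable_of_finite g
  have hpres : ∀ l : ℕ, MeasurePreserving (fun ω : ℕ → unitInterval => ω l) coins volume :=
    fun l => measurePreserving_eval_infinitePi _ l
  have hcomp : ∀ (l : ℕ) (φ : unitInterval → ℝ), Measurable φ →
      ∫ ω : ℕ → unitInterval, φ (ω l) ∂coins = ∫ u, φ u := fun l φ hφ => by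
    rw [← (hpres l).map_eq,
      integral_map (measurable_pi_apply l).aemeasurable hφ.aestronglyMeasurable]
  obtain ⟨Y, hY⟩ : ∃ Y : ℕ → (ℕ → unitInterval) → ℝ, ∀ l ω, Y l ω = g (f (ω l)) :=
    ⟨_, fun _ _ => rfl⟩
  have hYe : ∀ l, Y l = fun ω => g (f (ω l)) := fun l => funext (hY l)
  have hYm : ∀ l, Measurable (Y l) := fun l => by
    rw [hYe]; exact hgm.comp (hf.comp (measurable_pi_apply l))
  obtain ⟨C, hC⟩ : ∃ C, ∀ a, |g a| ≤ C := by
    obtain ⟨C, hC⟩ := (Set.finite_range fun a => |g a|).bddAbove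
    exact ⟨C, fun a => hC ⟨a, rfl⟩⟩
  have hL2 : ∀ l, MemLp (Y l) 2 coins := fun l =>
    MemLp.of_bound (hYm l).aestronglyMeasurable C (ae_of_all _ fun ω => by
      rw [hY]; exact hC _)
  have hmean : ∀ l, ∫ ω, Y l ω ∂coins = ∫ u, g (f u) := fun l => by
    rw [hYe]
    exact hcomp l _ (hgm.comp hf)
  have hsq : ∀ l, ∫ ω, Y l ω ^ 2 ∂coins = ∫ u, g (f u) ^ 2 := fun l => by
    rw [hYe]
    exact hcomp l _ ((hgm.comp hf).pow_const 2)
  have hind : iIndepFun Y coins := by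
    have := iIndepFun_infinitePi (P := fun _ : ℕ => (volume : Measure unitInterval))
      (X := fun _ u => g (f u)) fun _ => hgm.comp hf
    have e : Y = fun i ω => g (f (ω i)) := funext hYe
    rw [e]
    exact this
  have hvar := IndepFun.variance_sum (s := Finset.range s) (fun l _ => hL2 l)
    (fun i _ j _ hij => hind.indepFun hij)
  have hvle : ∀ l, variance (Y l) coins ≤ ∫ u, g (f u) ^ 2 := fun l => by
    rw [← hsq l]
    exact variance_le_expectation_sq (hYm l).aestronglyMeasurable
  have hsum : ∫ ω, (∑ l ∈ Finset.range s, Y l) ω ∂coins = s * ∫ u, g (f u) := by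
    simp only [Finset.sum_apply]
    rw [integral_finsetSum _ fun l _ => (hL2 l).integrable one_le_two]
    simp [hmean]
  have hvi := variance_eq_integral (μ := coins)
    (Finset.aemeasurable_sum (Finset.range s) fun l _ => (hYm l).aemeasurable)
  rw [hsum] at hvi
  have hpt : ∀ ω : ℕ → unitInterval,
      ((∫ u, g (f u)) - (1 / (s : ℝ)) * ∑ l : Fin s, g (f (ω l))) ^ 2 =
      (1 / (s : ℝ)) ^ 2 * ((∑ l ∈ Finset.range s, Y l) ω - s * ∫ u, g (f u)) ^ 2 := fun ω => by
    rw [Finset.sum_apply, ← Fin.sum_univ_eq_sum_range (fun l => Y l ω)]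
    simp only [hY]
    field_simp
    ring
  simp only [hpt]
  rw [integral_const_mul, ← hvi, hvar]
  calc _ ≤ (1 / (s : ℝ)) ^ 2 * ∑ _l ∈ Finset.range s, ∫ u, g (f u) ^ 2 := by
        gcongr with l
        exact hvle l
    _ = _ := by
        rw [Finset.sum_const, Finset.card_range, nsmul_eq_mul]
        field_simp

/-- The unbiased estimator of `R V` from the sampled columns `ι` of `R`. -/
noncomputable def sampleMat {n d k s : ℕ} (R : Matrix (Fin n) (Fin d) ℝ)
    (V : Matrix (Fin d) (Fin k) ℝ) (ι : Fin s → Fin d) : Matrix (Fin n) (Fin k) ℝ :=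
  Matrix.of fun a j =>
    (1 / (s : ℝ)) * ∑ l, R a (ι l) * V (ι l) j * (frobSq R / colSq R (ι l))

theorem eq_zero_of_colSq_eq_zero {n d : ℕ} {R : Matrix (Fin n) (Fin d) ℝ} {i : Fin d}
    (h : colSq R i = 0) (a : Fin n) : R a i = 0 := by
  have := (Finset.sum_eq_zero_iff_of_nonneg fun a _ => sq_nonneg (R a i)).1 h a
    (Finset.mem_univ a)
  exact pow_eq_zero_iff (two_ne_zero) |>.1 this

/-- Probabilities proportional to the squared column norms make the estimator unbiased, and for each
column of `V` they make the second moment at most $\sum_iV_{ij}^2\|R\|^2=\|R\|^2$. Averaging $s$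
samples divides this by $s$, and there are $k$ columns. -/
theorem integral_sampleMat_le {n d k s : ℕ} {R : Matrix (Fin n) (Fin d) ℝ} (hR : 0 < frobSq R)
    {V : Matrix (Fin d) (Fin k) ℝ} (hV : Vᵀ * V = 1) (hs : 0 < s) {f : unitInterval → Fin d}
    (hf : Measurable f) (hvol : ∀ i, volume.real (f ⁻¹' {i}) = colSq R i / frobSq R) :
    ∫ ω : ℕ → unitInterval, frobSq (R * V - sampleMat R V fun l : Fin s => f (ω l)) ∂coins ≤
      k / s * frobSq R := by
  have hmeas : Measurable fun (ω : ℕ → unitInterval) (l : Fin s) => f (ω l) :=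
    measurable_pi_lambda _ fun l => hf.comp (measurable_pi_apply _)
  have hexp : ∀ g : Fin d → ℝ, ∫ u, g (f u) = ∑ i, colSq R i / frobSq R * g i := fun g => by
    rw [← integral_map hf.aemeasurable (measurable_of_finite g).aestronglyMeasurable,
      integral_fintype Integrable.of_finite]
    refine Finset.sum_congr rfl fun i _ => ?_
    rw [map_measureReal_apply hf (measurableSet_singleton i), hvol, smul_eq_mul]
  obtain ⟨g, hg⟩ : ∃ g : Fin n → Fin k → Fin d → ℝ,
      ∀ a j i, g a j i = R a i * V i j * (frobSq R / colSq R i) := ⟨_, fun _ _ _ => rfl⟩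
  have hmean : ∀ a j, ∫ u, g a j (f u) = (R * V) a j := fun a j => by
    rw [hexp, Matrix.mul_apply]
    refine Finset.sum_congr rfl fun i _ => ?_
    rw [hg]
    -- The weight has a division by zero at vanishing columns; these contribute nothing on either
    -- side.
    by_cases h : colSq R i = 0
    · rw [eq_zero_of_colSq_eq_zero h]; simp
    · field_simp
  have hsecond : ∀ j, ∑ a, ∫ u, g a j (f u) ^ 2 ≤ frobSq R := fun j => by
    have h1 : ∀ a, ∫ u, g a j (f u) ^ 2 =
        ∑ i, colSq R i / frobSq R * (R a i * V i j * (frobSq R / colSq R i)) ^ 2 := fun a => by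
      rw [hexp fun i => g a j i ^ 2]
      simp only [hg]
    simp only [h1]
    rw [Finset.sum_comm]
    have hone : ∑ i, V i j ^ 2 = 1 := by
      have := congrFun (congrFun hV j) j
      rw [Matrix.one_apply_eq, Matrix.mul_apply] at this
      rw [← this]
      exact Finset.sum_congr rfl fun i _ => pow_two _
    calc _ ≤ ∑ i, V i j ^ 2 * frobSq R := Finset.sum_le_sum fun i _ => ?_
      _ = frobSq R := by rw [← Finset.sum_mul, hone, one_mul]
    by_cases h : colSq R i = 0
    · rw [h]
      simp only [zero_div, zero_mul, Finset.sum_const_zero]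
      positivity
    · have : ∀ a, colSq R i / frobSq R * (R a i * V i j * (frobSq R / colSq R i)) ^ 2 =
          R a i ^ 2 * (V i j ^ 2 * frobSq R / colSq R i) := fun a => by field_simp
      simp only [this]
      rw [← Finset.sum_mul]
      apply le_of_eq
      change colSq R i * _ = _
      field_simp
  have hexp : ∀ ω : ℕ → unitInterval,
      frobSq (R * V - sampleMat R V fun l : Fin s => f (ω l)) =
      ∑ a, ∑ j, ((∫ u, g a j (f u)) - (1 / (s : ℝ)) * ∑ l : Fin s, g a j (f (ω l))) ^ 2 :=
    fun ω => by
      simp only [hmean]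
      simp only [hg]
      rfl
  simp only [hexp]
  have hI : ∀ a j, Integrable (fun ω : ℕ → unitInterval =>
      ((∫ u, g a j (f u)) - (1 / (s : ℝ)) * ∑ l : Fin s, g a j (f (ω l))) ^ 2) coins :=
    fun a j => integrable_comp_of_finite hmeas fun ι : Fin s → Fin d =>
      ((∫ u, g a j (f u)) - (1 / (s : ℝ)) * ∑ l : Fin s, g a j (ι l)) ^ 2
  rw [integral_finsetSum _ fun a _ => integrable_finsetSum _ fun j _ => hI a j]
  have h2 : ∀ a, ∫ ω, ∑ j, ((∫ u, g a j (f u)) -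
      (1 / (s : ℝ)) * ∑ l : Fin s, g a j (f (ω l))) ^ 2 ∂coins ≤
      ∑ j, (1 / (s : ℝ)) * ∫ u, g a j (f u) ^ 2 := fun a => by
    rw [integral_finsetSum _ fun j _ => hI a j]
    exact Finset.sum_le_sum fun j _ => integral_average_sq_le hf (g a j) hs
  calc _ ≤ ∑ a, ∑ j, (1 / (s : ℝ)) * ∫ u, g a j (f u) ^ 2 := Finset.sum_le_sum fun a _ => h2 a
    _ = (1 / (s : ℝ)) * ∑ j, ∑ a, ∫ u, g a j (f u) ^ 2 := by
        rw [Finset.sum_comm, Finset.mul_sum]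
        simp only [Finset.mul_sum]
    _ ≤ (1 / (s : ℝ)) * ∑ _j : Fin k, frobSq R := by
        gcongr with j
        exact hsecond j
    _ = _ := by simp; ring

/-! ### Sampling an index from partial sums -/

/-- The index selected by the number `u`: the number of proper partial sums of the weights `w`
that are at most `u` times the total weight. -/
noncomputable def pick (w : ℕ → ℝ) (d : ℕ) (u : ℝ) : ℕ :=
  ((Finset.range (d - 1)).filter fun j =>
    ∑ i ∈ Finset.range (j + 1), w i ≤ u * ∑ i ∈ Finset.range d, w i).card

/-- Leaving out the last partial sum keeps the index in range even for $u=1$ or for vanishing total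
weight. -/
theorem pick_lt {w : ℕ → ℝ} {d : ℕ} (hd : 0 < d) (u : ℝ) : pick w d u < d := by
  have := Finset.card_filter_le (Finset.range (d - 1)) fun j =>
    ∑ i ∈ Finset.range (j + 1), w i ≤ u * ∑ i ∈ Finset.range d, w i
  rw [Finset.card_range] at this
  unfold pick
  omega

theorem measurable_pick (w : ℕ → ℝ) (d : ℕ) :
    Measurable fun u : unitInterval => pick w d u := by
  simp only [pick, Finset.card_filter]
  refine Finset.measurable_sum _ fun j _ => ?_
  refine Measurable.ite ?_ measurable_const measurable_const
  exact measurableSet_le measurable_const (measurable_subtype_coe.mul_const _)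

theorem pick_eq {w : ℕ → ℝ} (hw : ∀ i, 0 ≤ w i) {d i : ℕ} (hi : i < d) {u : ℝ}
    (h1 : ∑ j ∈ Finset.range i, w j ≤ u * ∑ j ∈ Finset.range d, w j)
    (h2 : u * ∑ j ∈ Finset.range d, w j < ∑ j ∈ Finset.range (i + 1), w j) :
    pick w d u = i := by
  have hmono : Monotone fun m => ∑ j ∈ Finset.range m, w j := fun a b hab =>
    Finset.sum_le_sum_of_subset_of_nonneg (Finset.range_mono hab) fun _ _ _ => hw _
  have : ((Finset.range (d - 1)).filter fun j =>
      ∑ i ∈ Finset.range (j + 1), w i ≤ u * ∑ i ∈ Finset.range d, w i) = Finset.range i := by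
    ext j
    simp only [Finset.mem_filter, Finset.mem_range]
    constructor
    · rintro ⟨-, hj⟩
      by_contra hij
      have : ∑ i ∈ Finset.range (i + 1), w i ≤ ∑ i ∈ Finset.range (j + 1), w i :=
        hmono (by omega)
      linarith
    · intro hj
      refine ⟨by omega, ?_⟩
      have : ∑ i ∈ Finset.range (j + 1), w i ≤ ∑ i ∈ Finset.range i, w i := hmono (by omega)
      linarith
  rw [pick, this, Finset.card_range]

/-- Up to the endpoint $u=1$, index $i$ is selected exactly on the interval between consecutive
normalised partial sums, whose length is the normalised weight. -/
theorem volume_pick {w : ℕ → ℝ} (hw : ∀ i, 0 ≤ w i) {d i : ℕ} (hi : i < d)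
    (hpos : 0 < ∑ j ∈ Finset.range d, w j) :
    volume.real {u : unitInterval | pick w d u = i} = w i / ∑ j ∈ Finset.range d, w j := by
  obtain ⟨W, hW⟩ : ∃ W : ℕ → ℝ, ∀ m, W m = ∑ j ∈ Finset.range m, w j := ⟨_, fun _ => rfl⟩
  rw [← hW] at hpos ⊢
  have hmono : Monotone W := fun a b hab => by
    rw [hW, hW]
    exact Finset.sum_le_sum_of_subset_of_nonneg (Finset.range_mono hab) fun _ _ _ => hw _
  have hW0 : W 0 = 0 := by rw [hW]; simp
  have hmem : ∀ m ≤ d, W m / W d ∈ unitInterval := fun m hm =>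
    ⟨div_nonneg (hW0 ▸ hmono (Nat.zero_le m)) hpos.le, div_le_one_of_le₀ (hmono hm) hpos.le⟩
  have hpick : ∀ {u : unitInterval} {m : ℕ}, m < d → W m / W d ≤ u → (u : ℝ) < W (m + 1) / W d →
      pick w d u = m := fun {u m} hm h1 h2 => by
    rw [div_le_iff₀ hpos] at h1
    rw [lt_div_iff₀ hpos] at h2
    refine pick_eq hw hm ?_ ?_
    · rw [← hW, ← hW]; exact h1
    · rw [← hW, ← hW]; exact h2
  have hae : {u : unitInterval | pick w d u = i} =ᵐ[volume]
      Set.Ico (⟨W i / W d, hmem i hi.le⟩ : unitInterval) ⟨W (i + 1) / W d, hmem (i + 1) hi⟩ := by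
    -- At $u=1$ all proper partial sums are counted, so the last index is selected even if its
    -- weight is zero.
    have hne : ∀ᵐ u : unitInterval ∂volume, u ≠ 1 := by
      rw [ae_iff]
      simp
    filter_upwards [hne] with u hu
    have hu1 : (u : ℝ) < 1 := lt_of_le_of_ne u.2.2 fun h => hu (Subtype.ext h)
    refine propext ⟨fun h => ?_, fun h => hpick hi h.1 h.2⟩
    have hex : ∃ m, (u : ℝ) < W (m + 1) / W d := ⟨d - 1, by
      rw [Nat.sub_add_cancel (by omega), div_self hpos.ne']; exact hu1⟩
    classical
    have hm := Nat.find_spec hex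
    have hmd : Nat.find hex ≤ d - 1 := Nat.find_min' hex (by
      rw [Nat.sub_add_cancel (by omega), div_self hpos.ne']; exact hu1)
    have hlow : W (Nat.find hex) / W d ≤ u := by
      rcases Nat.eq_zero_or_pos (Nat.find hex) with h0 | h0
      · rw [h0, hW0, zero_div]; exact u.2.1
      · have := Nat.find_min hex (Nat.sub_lt h0 one_pos)
        rw [show Nat.find hex - 1 + 1 = Nat.find hex by omega] at this
        exact not_lt.1 this
    have := hpick (by omega) hlow hm
    have h' : pick w d u = i := h
    rw [h'] at this
    rw [← this] at hm hlow
    exact ⟨hlow, hm⟩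
  rw [measureReal_congr hae, measureReal_def, unitInterval.volume_Ico, ENNReal.toReal_ofReal]
  · rw [← sub_div, hW, hW, Finset.sum_range_succ, add_sub_cancel_left]
  · exact sub_nonneg.2 (div_le_div_of_nonneg_right (hmono (Nat.le_succ i)) hpos.le)

end SparseEncoder

namespace SparseEncoder

open Matrix

/-! ### Reasoning about programs -/

namespace Prog

variable (dec : SVDRoutine) (ω : ℕ → unitInterval)

/-- The real arrays a program may write to. -/
def writesR : Prog → List ℕ
  | skip => []
  | seq c c' => c.writesR ++ c'.writesR
  | setN _ _ _ => []
  | setR a _ _ _ => [a]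
  | rand a _ _ => [a]
  | ite _ c c' => c.writesR ++ c'.writesR
  | loop _ _ c => c.writesR
  | svd _ _ _ u z v => [u, z, v]

/-- The integer arrays a program may write to. -/
def writesN : Prog → List ℕ
  | skip => []
  | seq c c' => c.writesN ++ c'.writesN
  | setN a _ _ => [a]
  | setR _ _ _ _ => []
  | rand _ _ _ => []
  | ite _ c c' => c.writesN ++ c'.writesN
  | loop x _ c => x :: c.writesN
  | svd _ _ _ _ _ _ => []

/-- The program draws no random numbers. -/
def isDet : Prog → Bool
  | seq c c' => c.isDet && c'.isDet
  | rand _ _ _ => false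
  | ite _ c c' => c.isDet && c'.isDet
  | loop _ _ c => c.isDet
  | _ => true

variable {dec ω}

/-- The loop rule. The invariant is assumed before the counter is overwritten, so it must tolerate
any old counter value. -/
theorem exec_loop_induct {x : ℕ} {e : NExp} {c : Prog} {s : State} {P : ℕ → State → Prop}
    (h0 : P 0 (s.tick (e.cost + 1)))
    (hs : ∀ t < e.eval s, ∀ s', P t s' → P (t + 1) (c.exec dec ω ((s'.writeN x 0 t).tick 1))) :
    P (e.eval s) ((loop x e c).exec dec ω s) := by
  rw [exec]
  generalize e.eval s = N at hs
  induction N with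
  | zero => exact h0
  | succ N ih => exact hs N (Nat.lt_succ_self N) _ (ih fun t ht => hs t (by omega))

/-- Frame rule: membership in the syntactic list of written arrays is decidable, so `decide` carries
unrelated arrays through whole program parts. -/
theorem exec_real {c : Prog} {a : ℕ} (ha : a ∉ c.writesR) (s : State) :
    (c.exec dec ω s).real a = s.real a := by
  induction c generalizing s with
  | skip => rfl
  | seq c c' ih ih' =>
    simp only [writesR, List.mem_append, not_or] at ha
    rw [exec, ih' ha.2, ih ha.1]
  | setN => rfl
  | setR b i j e =>
    simp only [writesR, List.mem_singleton] at ha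
    funext i' j'
    simp [exec, State.writeR, State.tick, ha]
  | rand b i j =>
    simp only [writesR, List.mem_singleton] at ha
    funext i' j'
    simp [exec, State.writeR, State.tick, ha]
  | ite b c c' ih ih' =>
    simp only [writesR, List.mem_append, not_or] at ha
    rw [exec]
    split_ifs
    · exact ih ha.1 _
    · exact ih' ha.2 _
  | loop x e c ih =>
    exact exec_loop_induct (P := fun _ s' => s'.real a = s.real a) rfl
      fun t _ s' hs' => (ih ha _).trans hs'
  | svd b p q u z v =>
    simp only [writesR, List.mem_cons, List.not_mem_nil, or_false, not_or] at ha
    funext i' j'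
    simp [exec, State.writeBlock, State.tick, ha]

theorem exec_nat {c : Prog} {a : ℕ} (ha : a ∉ c.writesN) (s : State) :
    (c.exec dec ω s).nat a = s.nat a := by
  induction c generalizing s with
  | skip => rfl
  | seq c c' ih ih' =>
    simp only [writesN, List.mem_append, not_or] at ha
    rw [exec, ih' ha.2, ih ha.1]
  | setN b i e =>
    simp only [writesN, List.mem_singleton] at ha
    funext i'
    simp [exec, State.writeN, State.tick, ha]
  | setR => rfl
  | rand => rfl
  | ite b c c' ih ih' =>
    simp only [writesN, List.mem_append, not_or] at ha
    rw [exec]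
    split_ifs
    · exact ih ha.1 _
    · exact ih' ha.2 _
  | loop x e c ih =>
    simp only [writesN, List.mem_cons, not_or] at ha
    refine exec_loop_induct (P := fun _ s' => s'.nat a = s.nat a) rfl
      fun t _ s' hs' => (ih ha.2 _).trans ?_
    rw [← hs']
    funext i'
    simp [State.writeN, State.tick, ha.1]
  | svd => rfl

theorem exec_drawn {c : Prog} (hc : c.isDet = true) (s : State) :
    (c.exec dec ω s).drawn = s.drawn := by
  induction c generalizing s with
  | skip => rfl
  | seq c c' ih ih' =>
    simp only [isDet, Bool.and_eq_true] at hc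
    rw [exec, ih' hc.2, ih hc.1]
  | setN => rfl
  | setR => rfl
  | rand => simp [isDet] at hc
  | ite b c c' ih ih' =>
    simp only [isDet, Bool.and_eq_true] at hc
    rw [exec]
    split_ifs
    · exact ih hc.1 _
    · exact ih' hc.2 _
  | loop x e c ih =>
    exact exec_loop_induct (P := fun _ s' => s'.drawn = s.drawn) rfl
      fun t _ s' hs' => (ih hc _).trans hs'
  | svd => rfl

/-- Makes the state before sampling independent of the outcome, so that the selected columns and the
residual are constants in the expectation. -/
theorem exec_congr_coins {c : Prog} (hc : c.isDet = true) (ω' : ℕ → unitInterval) (s : State) :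
    c.exec dec ω s = c.exec dec ω' s := by
  induction c generalizing s with
  | skip => rfl
  | seq c c' ih ih' =>
    simp only [isDet, Bool.and_eq_true] at hc
    rw [exec, exec, ih hc.1, ih' hc.2]
  | setN => rfl
  | setR => rfl
  | rand => simp [isDet] at hc
  | ite b c c' ih ih' =>
    simp only [isDet, Bool.and_eq_true] at hc
    rw [exec, exec, ih hc.1, ih' hc.2]
  | loop x e c ih =>
    rw [exec, exec]
    simp only [ih hc]
  | svd => rfl

end Prog

/-! ### Matrix-valued sums -/

/-- The integer variable `a[0]`. -/
def nv (a : ℕ) : NExp :=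
  .get a (.lit 0)

/-- `dst[i, j] := ∑ l < K, e` for all `i < N` and `j < M`; the expression `e` may refer to
`i`, `j`, `l` as the integer variables `1`, `2`, `3`. -/
def mat (dst : ℕ) (N M K : NExp) (e : RExp) : Prog :=
  .loop 1 N (.loop 2 M (.seq (.setR dst (nv 1) (nv 2) (.lit 0))
    (.loop 3 K (.setR dst (nv 1) (nv 2) (.add (.get dst (nv 1) (nv 2)) e)))))

/-- Two states agree up to the real array `dst` and the index variables of `mat`. -/
def Agree (dst : ℕ) (s s' : State) : Prop :=
  (∀ a, a ≠ dst → s'.real a = s.real a) ∧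
    ∀ a, a ≠ 1 → a ≠ 2 → a ≠ 3 → s'.nat a = s.nat a

theorem Agree.refl (dst : ℕ) (s : State) : Agree dst s s :=
  ⟨fun _ _ => rfl, fun _ _ _ _ => rfl⟩

/-- Bounds and summand are re-evaluated while `dst` is being filled, so the hypotheses range over
all states that agree with `s` elsewhere; in particular the summand cannot rely on `dst`. The
constant `c` absorbs all evaluation costs. The equation for `P` keeps named programs folded. -/
theorem mat_run {dec : SVDRoutine} {ω : ℕ → unitInterval} {P : Prog} {dst : ℕ} {N M K : NExp}
    {e : RExp} (hP : P = mat dst N M K e) {s : State} {n m k : ℕ} (f : ℕ → ℕ → ℕ → ℝ) (c : ℕ)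
    (hN : ∀ s', Agree dst s s' → N.eval s' = n) (hM : ∀ s', Agree dst s s' → M.eval s' = m)
    (hK : ∀ s', Agree dst s s' → K.eval s' = k)
    (hf : ∀ s', Agree dst s s' → s'.nat 1 0 < n → s'.nat 2 0 < m → s'.nat 3 0 < k →
      e.eval s' = f (s'.nat 1 0) (s'.nat 2 0) (s'.nat 3 0))
    (hc : N.cost + M.cost + K.cost + e.cost + 12 ≤ c) :
    ∃ s', P.exec dec ω s = s' ∧ Agree dst s s' ∧
      (∀ i j, s'.real dst i j =
        if i < n ∧ j < m then ∑ l ∈ Finset.range k, f i j l else s.real dst i j) ∧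
      s'.time ≤ s.time + c * ((n + 1) * (m + 1) * (k + 1)) := by
  subst hP
  have inner : ∀ (s' : State) (i j : ℕ), i < n → j < m → Agree dst s s' → s'.nat 1 0 = i →
      s'.nat 2 0 = j →
      ∀ s'', s'' = (Prog.seq (.setR dst (nv 1) (nv 2) (.lit 0))
        (.loop 3 K (.setR dst (nv 1) (nv 2) (.add (.get dst (nv 1) (nv 2)) e)))).exec dec ω s' →
      Agree dst s s'' ∧ s''.nat 1 0 = i ∧ (∀ a b, s''.real dst a b =
        if a = i ∧ b = j then ∑ l ∈ Finset.range k, f i j l else s'.real dst a b) ∧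
      s''.time + 1 ≤ s'.time + c * (k + 1) := by
    rintro s' i j hi hj hA h1 h2 s'' rfl
    rw [Prog.exec]
    obtain ⟨s₁, hs₁⟩ : ∃ s₁, s₁ = (Prog.setR dst (nv 1) (nv 2) (.lit 0)).exec dec ω s' := ⟨_, rfl⟩
    rw [← hs₁]
    have hA₁ : Agree dst s s₁ := by
      refine ⟨fun a ha => ?_, fun a h1 h2 h3 => ?_⟩
      · rw [hs₁, Prog.exec_real (by simpa [Prog.writesR] using ha), hA.1 a ha]
      · rw [hs₁, Prog.exec_nat (by simp [Prog.writesN]), hA.2 a h1 h2 h3]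
    have h1₁ : s₁.nat 1 0 = i := by rw [hs₁]; exact h1
    have h2₁ : s₁.nat 2 0 = j := by rw [hs₁]; exact h2
    have hr₁ : ∀ a b, s₁.real dst a b = if a = i ∧ b = j then 0 else s'.real dst a b := by
      intro a b
      simp [hs₁, Prog.exec, State.tick, State.writeR, nv, NExp.eval, RExp.eval, h1, h2]
    have ht₁ : s₁.time = s'.time + 6 := by
      rw [hs₁]; rfl
    have key := Prog.exec_loop_induct (dec := dec) (ω := ω) (x := 3) (e := K)
      (c := .setR dst (nv 1) (nv 2) (.add (.get dst (nv 1) (nv 2)) e)) (s := s₁)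
      (P := fun t s'' => Agree dst s s'' ∧ s''.nat 1 0 = i ∧ s''.nat 2 0 = j ∧
        (∀ a b, s''.real dst a b =
          if a = i ∧ b = j then ∑ l ∈ Finset.range t, f i j l else s'.real dst a b) ∧
        s''.time = s'.time + 6 + (K.cost + 1) + t * (12 + e.cost)) ?_ ?_
    · rw [hK s₁ hA₁] at key
      refine ⟨key.1, key.2.1, key.2.2.2.1, ?_⟩
      rw [key.2.2.2.2]
      nlinarith
    · refine ⟨hA₁, h1₁, h2₁, ?_, ?_⟩
      · simpa [State.tick] using hr₁
      · rw [← ht₁]; simp [State.tick]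
    · rintro t ht s₂ ⟨hA₂, h1₂, h2₂, hr₂, ht₂⟩
      rw [hK s₁ hA₁] at ht
      obtain ⟨s₃, hs₃⟩ : ∃ s₃, s₃ = (s₂.writeN 3 0 t).tick 1 := ⟨_, rfl⟩
      rw [← hs₃]
      have hA₃ : Agree dst s s₃ := by
        refine ⟨fun a ha => ?_, fun a h1 h2 h3 => ?_⟩
        · rw [hs₃]; exact hA₂.1 a ha
        · rw [← hA₂.2 a h1 h2 h3, hs₃]
          funext b
          simp [State.tick, State.writeN, h3]
      have h1₃ : s₃.nat 1 0 = i := by rw [hs₃]; simpa [State.tick, State.writeN] using h1₂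
      have h2₃ : s₃.nat 2 0 = j := by rw [hs₃]; simpa [State.tick, State.writeN] using h2₂
      have h3₃ : s₃.nat 3 0 = t := by rw [hs₃]; simp [State.tick, State.writeN]
      have hr₃ : s₃.real dst = s₂.real dst := by rw [hs₃]; rfl
      have he : e.eval s₃ = f i j t := by
        rw [hf s₃ hA₃ (by omega) (by omega) (by omega), h1₃, h2₃, h3₃]
      refine ⟨⟨fun a ha => ?_, fun a h1 h2 h3 => ?_⟩, h1₃, h2₃, fun a b => ?_, ?_⟩
      · rw [Prog.exec_real (by simpa [Prog.writesR] using ha), hA₃.1 a ha]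
      · rw [Prog.exec_nat (by simp [Prog.writesN]), hA₃.2 a h1 h2 h3]
      · simp only [Prog.exec, State.tick, State.writeR, nv, NExp.eval, RExp.eval, h1₃, h2₃, he,
          hr₃, hr₂, true_and, and_self, if_true]
        by_cases hab : a = i ∧ b = j
        · simp [hab, Finset.sum_range_succ]
        · simp [hab]
      · simp only [Prog.exec, State.tick, State.writeR, nv, NExp.cost, RExp.cost]
        rw [hs₃]
        simp only [State.tick, State.writeN, ht₂]
        ring
  have middle : ∀ (s' : State) (i : ℕ), i < n → Agree dst s s' → s'.nat 1 0 = i →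
      ∀ s'', s'' = (Prog.loop 2 M (Prog.seq (.setR dst (nv 1) (nv 2) (.lit 0))
        (.loop 3 K (.setR dst (nv 1) (nv 2) (.add (.get dst (nv 1) (nv 2)) e))))).exec dec ω s' →
      Agree dst s s'' ∧ (∀ a b, s''.real dst a b =
        if a = i ∧ b < m then ∑ l ∈ Finset.range k, f i b l else s'.real dst a b) ∧
      s''.time + 1 ≤ s'.time + c * ((m + 1) * (k + 1)) := by
    rintro s' i hi hA h1 s'' rfl
    have key := Prog.exec_loop_induct (dec := dec) (ω := ω) (x := 2) (e := M)
      (c := Prog.seq (.setR dst (nv 1) (nv 2) (.lit 0))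
        (.loop 3 K (.setR dst (nv 1) (nv 2) (.add (.get dst (nv 1) (nv 2)) e)))) (s := s')
      (P := fun t s'' => Agree dst s s'' ∧ s''.nat 1 0 = i ∧
        (∀ a b, s''.real dst a b =
          if a = i ∧ b < t then ∑ l ∈ Finset.range k, f i b l else s'.real dst a b) ∧
        s''.time ≤ s'.time + (M.cost + 1) + t * (c * (k + 1))) ?_ ?_
    · rw [hM s' hA] at key
      refine ⟨key.1, key.2.2.1, ?_⟩
      have := key.2.2.2
      nlinarith
    · exact ⟨hA, h1, by simp [State.tick], by simp [State.tick]⟩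
    · rintro t ht s₂ ⟨hA₂, h1₂, hr₂, ht₂⟩
      rw [hM s' hA] at ht
      obtain ⟨s₃, hs₃⟩ : ∃ s₃, s₃ = (s₂.writeN 2 0 t).tick 1 := ⟨_, rfl⟩
      rw [← hs₃]
      have hA₃ : Agree dst s s₃ := by
        refine ⟨fun a ha => ?_, fun a h1 h2 h3 => ?_⟩
        · rw [hs₃]; exact hA₂.1 a ha
        · rw [← hA₂.2 a h1 h2 h3, hs₃]
          funext b
          simp [State.tick, State.writeN, h2]
      have h1₃ : s₃.nat 1 0 = i := by rw [hs₃]; simpa [State.tick, State.writeN] using h1₂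
      have h2₃ : s₃.nat 2 0 = t := by rw [hs₃]; simp [State.tick, State.writeN]
      obtain ⟨hA₄, h1₄, hr₄, ht₄⟩ := inner s₃ i t hi ht hA₃ h1₃ h2₃ _ rfl
      refine ⟨hA₄, h1₄, fun a b => ?_, ?_⟩
      · rw [hr₄]
        have : s₃.real dst a b = s₂.real dst a b := by rw [hs₃]; rfl
        rw [this, hr₂]
        by_cases ha : a = i
        · by_cases hb : b = t
          · simp [ha, hb]
          · have : b < t + 1 ↔ b < t := by omega
            simp [ha, hb, this]
        · simp [ha]
      · have : s₃.time = s₂.time + 1 := by rw [hs₃]; rfl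
        rw [Nat.add_mul, Nat.one_mul]
        omega
  have key := Prog.exec_loop_induct (dec := dec) (ω := ω) (x := 1) (e := N)
    (c := .loop 2 M (Prog.seq (.setR dst (nv 1) (nv 2) (.lit 0))
      (.loop 3 K (.setR dst (nv 1) (nv 2) (.add (.get dst (nv 1) (nv 2)) e))))) (s := s)
    (P := fun t s'' => Agree dst s s'' ∧
      (∀ a b, s''.real dst a b =
        if a < t ∧ b < m then ∑ l ∈ Finset.range k, f a b l else s.real dst a b) ∧
      s''.time ≤ s.time + (N.cost + 1) + t * (c * ((m + 1) * (k + 1)))) ?_ ?_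
  · rw [hN s (Agree.refl _ _)] at key
    refine ⟨_, rfl, key.1, key.2.1, key.2.2.trans ?_⟩
    have : N.cost + 1 ≤ c * ((m + 1) * (k + 1)) := by
      calc N.cost + 1 ≤ c * 1 := by omega
        _ ≤ _ := Nat.mul_le_mul_left _ (Nat.mul_pos (Nat.succ_pos _) (Nat.succ_pos _))
    calc _ ≤ s.time + c * ((m + 1) * (k + 1)) + n * (c * ((m + 1) * (k + 1))) := by omega
      _ = _ := by ring
  · exact ⟨⟨fun _ _ => rfl, fun _ _ _ _ => rfl⟩, by simp [State.tick], by simp [State.tick]⟩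
  · rintro t ht s₂ ⟨hA₂, hr₂, ht₂⟩
    rw [hN s (Agree.refl _ _)] at ht
    obtain ⟨s₃, hs₃⟩ : ∃ s₃, s₃ = (s₂.writeN 1 0 t).tick 1 := ⟨_, rfl⟩
    rw [← hs₃]
    have hA₃ : Agree dst s s₃ := by
      refine ⟨fun a ha => ?_, fun a h1 h2 h3 => ?_⟩
      · rw [hs₃]; exact hA₂.1 a ha
      · rw [← hA₂.2 a h1 h2 h3, hs₃]
        funext b
        simp [State.tick, State.writeN, h1]
    have h1₃ : s₃.nat 1 0 = t := by rw [hs₃]; simp [State.tick, State.writeN]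
    obtain ⟨hA₄, hr₄, ht₄⟩ := middle s₃ t ht hA₃ h1₃ _ rfl
    refine ⟨hA₄, fun a b => ?_, ?_⟩
    · rw [hr₄]
      have : s₃.real dst a b = s₂.real dst a b := by rw [hs₃]; rfl
      rw [this, hr₂]
      by_cases ha : a = t
      · simp [ha]
      · have : a < t + 1 ↔ a < t := by omega
        simp [ha, this]
    · have : s₃.time = s₂.time + 1 := by rw [hs₃]; rfl
      rw [Nat.add_mul, Nat.one_mul]
      omega

/-! ### Calls of the decomposition routine -/

namespace SVD

variable {m n : ℕ} {A : Matrix (Fin m) (Fin n) ℝ} (D : SVD A)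

/-- The left singular vectors, padded by zeros. -/
noncomputable def padU (i j : ℕ) : ℝ :=
  if h : i < m ∧ j < A.rank then D.U ⟨i, h.1⟩ ⟨j, h.2⟩ else 0

/-- The right singular vectors, padded by zeros. -/
noncomputable def padV (i j : ℕ) : ℝ :=
  if h : i < n ∧ j < A.rank then D.V ⟨i, h.1⟩ ⟨j, h.2⟩ else 0

theorem padU_coe (i : Fin m) (j : Fin A.rank) : D.padU i j = D.U i j := by
  rw [padU, dif_pos ⟨i.2, j.2⟩]

theorem padV_coe (i : Fin n) (j : Fin A.rank) : D.padV i j = D.V i j := by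
  rw [padV, dif_pos ⟨i.2, j.2⟩]

theorem padU_of_le {i j : ℕ} (hj : A.rank ≤ j) : D.padU i j = 0 := by
  rw [padU, dif_neg (by omega)]

theorem padV_of_le {i j : ℕ} (hj : A.rank ≤ j) : D.padV i j = 0 := by
  rw [padV, dif_neg (by omega)]

theorem sv_of_le {j : ℕ} (hj : A.rank ≤ j) : D.sv j = 0 := by
  rw [sv, dif_neg (by omega)]

end SVD

theorem rank_le_min {m n : ℕ} (A : Matrix (Fin m) (Fin n) ℝ) : A.rank ≤ min m n :=
  le_min (by simpa using A.rank_le_height) (by simpa using A.rank_le_width)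

/-- The padded functions describe the output without mentioning the rank. Cells of the row of
singular values beyond the written block keep their old content, which matters when that row is read
further out. -/
theorem svd_run {dec : SVDRoutine} {ω : ℕ → unitInterval} {a u z v : ℕ} {p q : NExp} {s : State}
    {m n : ℕ} {A : Matrix (Fin m) (Fin n) ℝ} (hp : p.eval s = m) (hq : q.eval s = n)
    (hA : ∀ (i : Fin m) (j : Fin n), s.real a i j = A i j) (huz : u ≠ z) (huv : u ≠ v)
    (hzv : z ≠ v) :
    ∃ s', (Prog.svd a p q u z v).exec dec ω s = s' ∧
      (∀ b, b ≠ u → b ≠ z → b ≠ v → s'.real b = s.real b) ∧ s'.nat = s.nat ∧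
      (∀ i < m, ∀ j < min m n, s'.real u i j = (dec m n A).padU i j) ∧
      (∀ j < min m n, s'.real z 0 j = (dec m n A).sv j) ∧
      (∀ j, min m n ≤ j → s'.real z 0 j = s.real z 0 j) ∧
      (∀ i < n, ∀ j < min m n, s'.real v i j = (dec m n A).padV i j) ∧
      s'.time = s.time + (p.cost + q.cost + m * n * min m n + 1) := by
  subst hp hq
  have hA' : s.readBlock a (p.eval s) (q.eval s) = A := by
    ext i j; exact hA i j
  subst hA'
  refine ⟨_, rfl, fun b h1 h2 h3 => Prog.exec_real (by simp [Prog.writesR, h1, h2, h3]) s, rfl,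
    fun i hi j hj => ?_, fun j hj => ?_, fun j hj => ?_, fun i hi j hj => ?_, ?_⟩
  · simp only [Prog.exec, State.tick, State.writeBlock, huz, huv, false_and, if_false, true_and,
      hi, hj, if_true, and_self, SVD.padU]
  · simp only [Prog.exec, State.tick, State.writeBlock, hzv, false_and, if_false, true_and,
      Nat.lt_one_iff, hj, if_true, and_self, SVD.sv, Matrix.of_apply]
  · simp only [Prog.exec, State.tick, State.writeBlock, hzv, huz.symm, false_and, if_false,
      true_and, Nat.lt_one_iff, not_lt.2 hj]
  · simp only [Prog.exec, State.tick, State.writeBlock, true_and,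
      hi, hj, if_true, and_self, SVD.padV]
  · rfl

end SparseEncoder

namespace SparseEncoder

open Matrix

/-! ### First part of the program: an approximate right singular basis -/

/-- The number of rows of the input. -/
def vn : NExp := .get 0 (.lit 0)

/-- The number of columns of the input. -/
def vd : NExp := .get 0 (.lit 1)

/-- The dimension of the encoding. -/
def vk : NExp := .get 0 (.lit 2)

/-- The sparsity. -/
def vr : NExp := .get 0 (.lit 3)

/-- A matrix, padded by zeros. -/
def padX {n d : ℕ} (X : Matrix (Fin n) (Fin d) ℝ) (i j : ℕ) : ℝ :=
  if h : i < n ∧ j < d then X ⟨i, h.1⟩ ⟨j, h.2⟩ else 0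

theorem padX_coe {n d : ℕ} (X : Matrix (Fin n) (Fin d) ℝ) (i : Fin n) (j : Fin d) :
    padX X i j = X i j := by
  rw [padX, dif_pos ⟨i.2, j.2⟩]

/-- The state holds the input. -/
structure Inp {n d : ℕ} (X : Matrix (Fin n) (Fin d) ℝ) (k r : ℕ) (s : State) : Prop where
  n : s.nat 0 0 = n
  d : s.nat 0 1 = d
  k : s.nat 0 2 = k
  r : s.nat 0 3 = r
  X : s.real 0 = padX X

theorem Inp.congr {n d k r : ℕ} {X : Matrix (Fin n) (Fin d) ℝ} {s s' : State} (h : Inp X k r s)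
    (hn : s'.nat 0 = s.nat 0) (hr : s'.real 0 = s.real 0) : Inp X k r s' :=
  ⟨by rw [hn, h.n], by rw [hn, h.d], by rw [hn, h.k], by rw [hn, h.r], by rw [hr, h.X]⟩

theorem Inp.agree {n d k r : ℕ} {X : Matrix (Fin n) (Fin d) ℝ} {dst : ℕ} {s s' : State}
    (h : Inp X k r s) (hA : Agree dst s s') (hd : 0 ≠ dst) : Inp X k r s' :=
  h.congr (hA.2 0 (by decide) (by decide) (by decide)) (hA.1 0 hd)

theorem inp_init {n d : ℕ} (X : Matrix (Fin n) (Fin d) ℝ) (k r : ℕ) :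
    Inp X k r (initState X k r) := by
  refine ⟨rfl, rfl, rfl, rfl, ?_⟩
  funext i j
  simp [initState, padX]

/-- Count the batches of `r` rows. -/
def batchCount : Prog :=
  .loop 4 vn (.ite (.ltN (nv 6) vn)
    (.seq (.setN 6 (.lit 0) (.add (nv 6) vr)) (.setN 5 (.lit 0) (.add (nv 5) (.lit 1)))) .skip)

/-- The machine has no integer division, so the number of batches is found by repeated addition; $n$
rounds suffice because $r\ge1$. -/
theorem batchCount_run {dec : SVDRoutine} {ω : ℕ → unitInterval} {n d k r : ℕ}
    {X : Matrix (Fin n) (Fin d) ℝ} {s : State} (hI : Inp X k r s) (hr : 0 < r)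
    (h5 : s.nat 5 0 = 0) (h6 : s.nat 6 0 = 0) :
    ∃ s', batchCount.exec dec ω s = s' ∧ n ≤ s'.nat 5 0 * r ∧ s'.nat 5 0 * r ≤ n + r ∧
      s'.time ≤ s.time + 30 * (n + 1) := by
  have key := Prog.exec_loop_induct (dec := dec) (ω := ω) (x := 4) (e := vn)
    (c := .ite (.ltN (nv 6) vn)
      (.seq (.setN 6 (.lit 0) (.add (nv 6) vr)) (.setN 5 (.lit 0) (.add (nv 5) (.lit 1)))) .skip)
    (s := s)
    (P := fun t s' => s'.nat 0 = s.nat 0 ∧ s'.nat 6 0 = s'.nat 5 0 * r ∧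
      (s'.nat 5 0 = t ∨ n ≤ s'.nat 6 0) ∧ s'.nat 6 0 ≤ n + r ∧
      s'.time ≤ s.time + 3 + t * 30) ?_ ?_
  · have hv : vn.eval s = n := hI.n
    rw [hv] at key
    obtain ⟨-, h1, h2, h3, h4⟩ := key
    refine ⟨_, rfl, ?_, ?_, ?_⟩
    · rcases h2 with h2 | h2
      · rw [batchCount, h2]; exact Nat.le_mul_of_pos_right n hr
      · rw [batchCount, ← h1]; exact h2
    · rw [batchCount, ← h1]; exact h3
    · rw [batchCount]
      omega
  · refine ⟨rfl, ?_, Or.inl ?_, ?_, ?_⟩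
    · simp [State.tick, h5, h6]
    · simp [State.tick, h5]
    · simp [State.tick, h6]
    · simp [State.tick, vn, NExp.cost]
  · rintro t ht s' ⟨h0, h1, h2, h3, h4⟩
    have hn : s'.nat 0 0 = n := by rw [h0]; exact hI.n
    have hr' : s'.nat 0 3 = r := by rw [h0]; exact hI.r
    rw [Prog.exec]
    have hb : (BExp.ltN (nv 6) vn).eval ((s'.writeN 4 0 t).tick 1) ↔ s'.nat 6 0 < n := by
      simp [BExp.eval, nv, vn, NExp.eval, State.writeN, State.tick, hn]
    by_cases h : s'.nat 6 0 < n
    · rw [if_pos (hb.2 h)]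
      simp only [Prog.exec, nv, vr, NExp.eval, State.writeN, State.tick, NExp.cost,
        BExp.cost, vn]
      refine ⟨?_, ?_, Or.inl ?_, ?_, ?_⟩
      · funext i; simp [h0]
      · simp [h1, hr']; ring
      · have : s'.nat 5 0 = t := by omega
        simp [this]
      · simp [hr']; omega
      · omega
    · rw [if_neg (hb.not.2 h)]
      simp only [Prog.exec, nv, State.writeN, State.tick, NExp.cost, BExp.cost, vn]
      refine ⟨?_, ?_, Or.inr ?_, ?_, ?_⟩
      · funext i; simp [h0]
      · simp [h1]
      · simp; omega
      · simp; omega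
      · omega

/-- The sketch, followed by the next `r` rows of the input. -/
def fillBuffer : Prog :=
  mat 3 (.add vr vr) vd (.lit 1)
    (.add (.get 2 (nv 1) (nv 2))
      (.mul (.cast (.sub (.lit 1) (.sub vr (nv 1))))
        (.get 0 (.add (nv 7) (.sub (nv 1) vr)) (nv 2))))

/-- The new sketch. -/
def shrink : Prog :=
  mat 2 vr vd (.lit 1)
    (.mul (.sqrt (.sub (.mul (.get 5 (.lit 0) (nv 1)) (.get 5 (.lit 0) (nv 1)))
      (.mul (.get 5 (.lit 0) vr) (.get 5 (.lit 0) vr)))) (.get 6 (nv 2) (nv 1)))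

/-- Treat one batch of rows. -/
def batch : Prog :=
  .seq fillBuffer (.seq (.svd 3 (.add vr vr) vd 4 5 6)
    (.seq shrink (.setN 7 (.lit 0) (.add (nv 7) vr))))

/-- Filling the buffer reads array 2 beyond its $r$ rows, and shrinking reads the singular value of
index $r$, which lies outside the written block if $d\le r$. Both places must hold zeros, so this is
part of the invariant. -/
theorem batch_run {dec : SVDRoutine} {ω : ℕ → unitInterval} {n d k r : ℕ}
    {X : Matrix (Fin n) (Fin d) ℝ} {s : State} {Δ : ℝ} (hI : Inp X k r s) (hr : 0 < r)
    (hd : 0 < d) (h2 : ∀ i j, r ≤ i → s.real 2 i j = 0)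
    (h5 : ∀ j, min (r + r) d ≤ j → s.real 5 0 j = 0)
    (hS : IsSketch d r (padX X) (s.nat 7 0) (s.real 2) Δ) :
    ∃ s', batch.exec dec ω s = s' ∧ Inp X k r s' ∧ (∀ i j, r ≤ i → s'.real 2 i j = 0) ∧
      (∀ j, min (r + r) d ≤ j → s'.real 5 0 j = 0) ∧ s'.nat 7 0 = s.nat 7 0 + r ∧
      (∃ Δ', IsSketch d r (padX X) (s'.nat 7 0) (s'.real 2) Δ') ∧
      s'.time ≤ s.time + 3000 * (r * r * d) := by
  obtain ⟨s₁, e₁, A₁, v₁, t₁⟩ := mat_run (dec := dec) (ω := ω) (P := fillBuffer) rfl (s := s)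
    (n := r + r) (m := d) (k := 1)
    (fun i j _ => s.real 2 i j + ((1 - (r - i) : ℕ) : ℝ) * padX X (s.nat 7 0 + (i - r)) j) 100
    (fun s' h => by simp [vr, NExp.eval, h.2, hI.r])
    (fun s' h => by simp [vd, NExp.eval, h.2, hI.d]) (fun s' h => rfl)
    (fun s' h _ _ _ => by
      simp [RExp.eval, NExp.eval, nv, vr, h.1, h.2, hI.r, hI.X])
    (by decide)
  obtain ⟨A, hA⟩ : ∃ A, A = Matrix.of fun (i : Fin (r + r)) (j : Fin d) => s₁.real 3 i j :=
    ⟨_, rfl⟩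
  have hI₁ := hI.agree A₁ (by decide)
  obtain ⟨s₂, e₂, f₂, n₂, -, z₂, z₂', V₂, t₂⟩ := svd_run (dec := dec) (ω := ω) (a := 3)
    (p := .add vr vr) (q := vd) (u := 4) (z := 5) (v := 6) (s := s₁) (m := r + r) (n := d)
    (A := Matrix.of fun (i : Fin (r + r)) (j : Fin d) => s₁.real 3 i j)
    (by simp [vr, NExp.eval, hI₁.r]) (by simp [vd, NExp.eval, hI₁.d])
    (fun i j => rfl) (by decide) (by decide) (by decide)
  have hI₂ : Inp X k r s₂ :=
    hI₁.congr (by rw [n₂]) (f₂ 0 (by decide) (by decide) (by decide))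
  obtain ⟨D, hD⟩ : ∃ D, D = dec _ _ (Matrix.of fun (i : Fin (r + r)) (j : Fin d) =>
    s₁.real 3 i j) := ⟨_, rfl⟩
  rw [← hD] at z₂ V₂
  have hz : ∀ j, s₂.real 5 0 j = D.sv j := fun j => by
    by_cases hj : j < min (r + r) d
    · exact z₂ j hj
    · rw [z₂' j (not_lt.1 hj), A₁.1 5 (by decide), h5 j (not_lt.1 hj), D.sv_of_le]
      exact (rank_le_min _).trans (not_lt.1 hj)
  obtain ⟨s₃, e₃, A₃, v₃, t₃⟩ := mat_run (dec := dec) (ω := ω) (P := shrink) rfl (s := s₂)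
    (n := r) (m := d) (k := 1)
    (fun i j _ => √(D.sv i * D.sv i - D.sv r * D.sv r) * s₂.real 6 j i) 100
    (fun s' h => by simp [vr, NExp.eval, h.2, hI₂.r])
    (fun s' h => by simp [vd, NExp.eval, h.2, hI₂.d]) (fun s' h => rfl)
    (fun s' h _ _ _ => by
      simp [RExp.eval, NExp.eval, nv, vr, h.1, h.2, hI₂.r, hz])
    (by decide)
  have hI₃ := hI₂.agree A₃ (by decide)
  have e : batch.exec dec ω s = (Prog.setN 7 (.lit 0) (.add (nv 7) vr)).exec dec ω s₃ := by
    simp only [batch, Prog.exec] at e₂ ⊢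
    rw [e₁, e₂, e₃]
  have h7 : s₃.nat 7 0 = s.nat 7 0 := by
    rw [A₃.2 7 (by decide) (by decide) (by decide), n₂,
      A₁.2 7 (by decide) (by decide) (by decide)]
  have hsk : IsSketch d r (padX X) (s.nat 7 0 + r) (s₃.real 2) (Δ + D.sv r ^ 2) := by
    refine hS.step (buf := s₁.real 3) ?_ ?_ D (s₂.real 6) ?_ ?_
    · intro i hi j hj
      rw [v₁, if_pos ⟨by omega, hj⟩]
      -- With truncated subtraction $1-(r-i)$ is the indicator of $i\ge r$: it switches the rows of
      -- the input on only in the lower half of the buffer.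
      have : 1 - (r - i) = 0 := by omega
      simp [this]
    · intro i hi j hj
      rw [v₁, if_pos ⟨by omega, hj⟩]
      have : r - (r + i) = 0 := by omega
      simp [this, h2 (r + i) j (by omega)]
    · intro j t
      have ht : (t : ℕ) < min (r + r) d := t.2.trans_le (rank_le_min _)
      rw [V₂ j j.2 t ht, D.padV_coe]
    · intro i hi j hj
      rw [v₃, if_pos ⟨hi, hj⟩]
      simp
  refine ⟨_, e, ?_, ?_, ?_, ?_, ⟨Δ + D.sv r ^ 2, ?_⟩, ?_⟩
  · exact hI₃.congr (by funext i; simp [Prog.exec, State.writeN, State.tick]) rfl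
  · intro i j hi
    simp only [Prog.exec, State.writeN, State.tick]
    rw [v₃, if_neg (by omega), f₂ 2 (by decide) (by decide) (by decide), A₁.1 2 (by decide),
      h2 i j hi]
  · intro j hj
    simp only [Prog.exec, State.writeN, State.tick]
    rw [A₃.1 5 (by decide), hz, D.sv_of_le ((rank_le_min _).trans hj)]
  · simp [Prog.exec, State.writeN, State.tick, NExp.eval, nv, vr, hI₃.r, h7]
  · have : ((Prog.setN 7 (.lit 0) (.add (nv 7) vr)).exec dec ω s₃).nat 7 0 = s.nat 7 0 + r := by
      simp [Prog.exec, State.writeN, State.tick, NExp.eval, nv, vr, hI₃.r, h7]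
    rw [this]
    exact hsk
  · simp only [Prog.exec, State.writeN, State.tick, NExp.cost, nv, vr]
    simp only [vr, vd, NExp.cost] at t₂
    have b1 : (r + r + 1) * (d + 1) * (1 + 1) ≤ 12 * (r * r * d) := by
      calc (r + r + 1) * (d + 1) * (1 + 1) ≤ (3 * r) * (2 * d) * (2 * r) := by
            gcongr <;> omega
        _ = 12 * (r * r * d) := by ring
    have b3 : (r + 1) * (d + 1) * (1 + 1) ≤ 8 * (r * r * d) := by
      calc (r + 1) * (d + 1) * (1 + 1) ≤ (2 * r) * (2 * d) * (2 * r) := by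
            gcongr <;> omega
        _ = 8 * (r * r * d) := by ring
    have b2 : (r + r) * d * min (r + r) d ≤ 4 * (r * r * d) := by
      calc (r + r) * d * min (r + r) d ≤ (2 * r) * d * (2 * r) := by
            gcongr
            · omega
            · exact (min_le_left _ _).trans (by omega)
        _ = 4 * (r * r * d) := by ring
    have b0 : 1 ≤ r * r * d := Nat.mul_pos (Nat.mul_pos hr hr) hd
    omega

/-- Count the leading singular vectors of the sketch, at most `k` of them. -/
def countBasis : Prog :=
  .loop 4 vk (.ite (.ltR (.lit 0) (.get 8 (.lit 0) (nv 4)))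
    (.setN 8 (.lit 0) (.add (nv 8) (.lit 1))) .skip)

/-- The padded singular values are positive exactly below the rank, so counting positive ones among
the first $k$ yields $\min(k,\mathrm{rank})$. -/
theorem countBasis_run {dec : SVDRoutine} {ω : ℕ → unitInterval} {n d k r l : ℕ}
    {X : Matrix (Fin n) (Fin d) ℝ} {s : State} (hI : Inp X k r s) (h8 : s.nat 8 0 = 0)
    (hz : ∀ j < k, 0 < s.real 8 0 j ↔ j < l) :
    ∃ s', countBasis.exec dec ω s = s' ∧ s'.nat 8 0 = min k l ∧
      s'.time ≤ s.time + 30 * (k + 1) := by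
  have key := Prog.exec_loop_induct (dec := dec) (ω := ω) (x := 4) (e := vk)
    (c := .ite (.ltR (.lit 0) (.get 8 (.lit 0) (nv 4)))
      (.setN 8 (.lit 0) (.add (nv 8) (.lit 1))) .skip) (s := s)
    (P := fun t s' => s'.real = s.real ∧ s'.nat 8 0 = min t l ∧ s'.time ≤ s.time + 3 + t * 30)
    ?_ ?_
  · have hv : vk.eval s = k := hI.k
    rw [hv] at key
    refine ⟨_, rfl, key.2.1, ?_⟩
    have := key.2.2
    rw [countBasis]
    omega
  · exact ⟨rfl, by simp [State.tick, h8], by simp [State.tick, vk, NExp.cost]⟩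
  · rintro t ht s' ⟨h1, h2, h3⟩
    have ht' : t < k := by
      have hv : vk.eval s = k := hI.k
      omega
    rw [Prog.exec]
    have hb : (BExp.ltR (.lit 0) (.get 8 (.lit 0) (nv 4))).eval ((s'.writeN 4 0 t).tick 1) ↔
        t < l := by
      rw [← hz t ht']
      simp [BExp.eval, RExp.eval, nv, NExp.eval, State.writeN, State.tick, h1]
    by_cases h : t < l
    · rw [if_pos (hb.2 h)]
      simp only [Prog.exec, nv, NExp.eval, State.writeN, State.tick, NExp.cost, BExp.cost,
        RExp.cost]
      refine ⟨h1, ?_, by omega⟩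
      simp [h2]; omega
    · rw [if_neg (hb.not.2 h)]
      simp only [Prog.exec, nv, State.writeN, State.tick, NExp.cost, BExp.cost, RExp.cost]
      refine ⟨h1, ?_, by omega⟩
      simp [h2]; omega

/-- An approximate right singular basis, from a sketch of the input. -/
def findBasis : Prog :=
  .seq batchCount (.seq (.loop 4 (nv 5) batch) (.seq (.svd 2 vr vd 7 8 9) countBasis))

theorem findBasis_run {dec : SVDRoutine} {ω : ℕ → unitInterval} {n d k r : ℕ}
    {X : Matrix (Fin n) (Fin d) ℝ} {s : State} (hI : Inp X k r s) (hn : 0 < n) (hd : 0 < d)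
    (hk : k ≤ X.rank) (hkr : k < r) (hn5 : s.nat 5 0 = 0) (hn6 : s.nat 6 0 = 0)
    (hn7 : s.nat 7 0 = 0) (hn8 : s.nat 8 0 = 0) (h2 : ∀ i j, s.real 2 i j = 0)
    (h5 : ∀ i j, s.real 5 i j = 0) :
    ∃ (s' : State) (l : ℕ) (Z : Matrix (Fin d) (Fin l) ℝ), findBasis.exec dec ω s = s' ∧
      Inp X k r s' ∧ l ≤ k ∧ Zᵀ * Z = 1 ∧
      ((r : ℝ) - k) * frobSq (X - X * Z * Zᵀ) ≤ r * frobSq (X - bestRank X k) ∧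
      s'.nat 8 0 = l ∧ (∀ i j, s'.real 9 (i : Fin d) (j : Fin l) = Z i j) ∧
      s'.time ≤ s.time + 10000 * (n * d * r + r * r * d) := by
  have hr : 0 < r := by omega
  have hkd : k ≤ d := hk.trans ((rank_le_min X).trans (min_le_right _ _))
  obtain ⟨s₁, e₁, hq, hq', t₁⟩ := batchCount_run (dec := dec) (ω := ω) hI hr hn5 hn6
  have hI₁ : Inp X k r s₁ := by
    rw [← e₁]; exact hI.congr (Prog.exec_nat (by decide) s) (Prog.exec_real (by decide) s)
  have hr₁ : ∀ a, s₁.real a = s.real a := fun a => by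
    rw [← e₁]; exact Prog.exec_real (by simp [batchCount, Prog.writesR]) s
  have hn₁ : ∀ a, a ≠ 4 → a ≠ 5 → a ≠ 6 → s₁.nat a = s.nat a := fun a h1 h2 h3 => by
    rw [← e₁]; exact Prog.exec_nat (by simp [batchCount, Prog.writesN, h1, h2, h3]) s
  have key := Prog.exec_loop_induct (dec := dec) (ω := ω) (x := 4) (e := nv 5) (c := batch)
    (s := s₁)
    (P := fun t s' => Inp X k r s' ∧ (∀ i j, r ≤ i → s'.real 2 i j = 0) ∧
      (∀ j, min (r + r) d ≤ j → s'.real 5 0 j = 0) ∧ s'.nat 7 0 = t * r ∧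
      (∃ Δ', IsSketch d r (padX X) (s'.nat 7 0) (s'.real 2) Δ') ∧
      s'.time ≤ s₁.time + 3 + t * (3001 * (r * r * d))) ?_ ?_
  · obtain ⟨s₂, e₂⟩ : ∃ s₂, s₂ = (Prog.loop 4 (nv 5) batch).exec dec ω s₁ := ⟨_, rfl⟩
    have hv : (nv 5).eval s₁ = s₁.nat 5 0 := rfl
    rw [← e₂, hv] at key
    obtain ⟨hI₂, -, -, h7₂, ⟨Δ, hΔ⟩, t₂⟩ := key
    rw [h7₂] at hΔ
    obtain ⟨s₃, e₃, f₃, n₃, -, z₃, -, V₃, t₃⟩ := svd_run (dec := dec) (ω := ω) (a := 2)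
      (p := vr) (q := vd) (u := 7) (z := 8) (v := 9) (s := s₂) (m := r) (n := d)
      (A := Matrix.of fun (i : Fin r) (j : Fin d) => s₂.real 2 i j)
      (by simp [vr, NExp.eval, hI₂.r]) (by simp [vd, NExp.eval, hI₂.d])
      (fun i j => rfl) (by decide) (by decide) (by decide)
    have hI₃ : Inp X k r s₃ :=
      hI₂.congr (by rw [n₃]) (f₃ 0 (by decide) (by decide) (by decide))
    obtain ⟨D, hD⟩ : ∃ D, D = dec _ _ (Matrix.of fun (i : Fin r) (j : Fin d) =>
      s₂.real 2 i j) := ⟨_, rfl⟩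
    rw [← hD] at z₃ V₃
    have hz : ∀ j < k, 0 < s₃.real 8 0 j ↔
        j < (Matrix.of fun (i : Fin r) (j : Fin d) => s₂.real 2 i j).rank := by
      intro j hj
      rw [z₃ j (lt_min (by omega) (by omega)), SVD.sv]
      split_ifs with h
      · exact ⟨fun _ => h, fun _ => D.pos _⟩
      · simp [h]
    have h8₃ : s₃.nat 8 0 = 0 := by
      rw [n₃, e₂, Prog.exec_nat (by decide), hn₁ 8 (by decide) (by decide) (by decide), hn8]
    obtain ⟨s₄, e₄, h8₄, t₄⟩ := countBasis_run (dec := dec) (ω := ω) hI₃ h8₃ hz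
    have hI₄ : Inp X k r s₄ := by
      rw [← e₄]; exact hI₃.congr (Prog.exec_nat (by decide) _) (Prog.exec_real (by decide) _)
    have h9₄ : s₄.real 9 = s₃.real 9 := by
      rw [← e₄]; exact Prog.exec_real (by decide) _
    have e : findBasis.exec dec ω s = s₄ := by
      rw [findBasis, Prog.exec, Prog.exec, Prog.exec, e₁, ← e₂, e₃, e₄]
    have hl : min k (Matrix.of fun (i : Fin r) (j : Fin d) => s₂.real 2 i j).rank ≤
        (Matrix.of fun (i : Fin r) (j : Fin d) => s₂.real 2 i j).rank := min_le_right _ _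
    refine ⟨s₄, _, D.leadV hl, e, hI₄, min_le_left _ _, D.leadV_orth hl, ?_, h8₄, ?_, ?_⟩
    · refine hΔ.frobSq_le hk hkr.le hq (padX_coe X) (fun i hi j hj => ?_) D hl rfl
      rw [padX, dif_neg (by omega)]
    · intro i j
      have hj : (j : ℕ) < k := j.2.trans_le (min_le_left _ _)
      rw [h9₄, V₃ i i.2 j (lt_min (by omega) (by omega))]
      exact D.padV_coe i (Fin.castLE hl j)
    -- The number of batches times $r$ is at most $n+r$, so the decompositions cost $(n+r)rd$ up to
    -- a constant.
    · have b1 : s₁.nat 5 0 * (3001 * (r * r * d)) ≤ 3001 * (n * d * r + r * r * d) := by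
        calc s₁.nat 5 0 * (3001 * (r * r * d)) = 3001 * ((s₁.nat 5 0 * r) * (r * d)) := by ring
          _ ≤ 3001 * ((n + r) * (r * d)) := by gcongr
          _ = _ := by ring
      have b2 : r * d * min r d ≤ r * r * d := by
        calc r * d * min r d ≤ r * d * r := by gcongr; exact min_le_left _ _
          _ = _ := by ring
      have b0 : 1 ≤ r * r * d := Nat.mul_pos (Nat.mul_pos hr hr) hd
      have b3 : n ≤ n * d * r := by
        rw [Nat.mul_assoc]; exact Nat.le_mul_of_pos_right n (Nat.mul_pos hd hr)
      have b4 : d ≤ r * r * d := Nat.le_mul_of_pos_left d (Nat.mul_pos hr hr)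
      simp only [vr, vd, NExp.cost] at t₃
      omega
  · refine ⟨hI₁.congr rfl rfl, fun i j _ => ?_, fun j _ => ?_, ?_, ⟨0, ?_⟩, ?_⟩
    · simp [State.tick, hr₁, h2]
    · simp [State.tick, hr₁, h5]
    · simp [State.tick, hn₁, hn7]
    · have : (s₁.tick ((nv 5).cost + 1)).nat 7 0 = 0 := by simp [State.tick, hn₁, hn7]
      rw [this]
      exact IsSketch.zero fun i _ j _ => by simp [State.tick, hr₁, h2]
    · simp [State.tick, nv, NExp.cost]
  · rintro t ht s' ⟨hI', h2', h5', h7', ⟨Δ, hΔ⟩, ht'⟩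
    obtain ⟨s₃, e₃, a1, a2, a3, a4, a5, a6⟩ := batch_run (dec := dec) (ω := ω)
      (s := (s'.writeN 4 0 t).tick 1)
      (hI'.congr (by funext i; simp [State.writeN, State.tick]) rfl) hr hd h2' h5'
      (Δ := Δ) (by simpa [State.writeN, State.tick] using hΔ)
    rw [e₃]
    refine ⟨a1, a2, a3, ?_, a5, ?_⟩
    · rw [a4]
      simp [State.writeN, State.tick, h7']
      ring
    · simp only [State.writeN, State.tick] at a6
      have b0 : 1 ≤ r * r * d := Nat.mul_pos (Nat.mul_pos hr hr) hd
      rw [Nat.add_mul]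
      omega

end SparseEncoder

namespace SparseEncoder

open Matrix

/-! ### Second part of the program: selection of columns by the barrier method -/

/-- The coordinates of the rows of the input with respect to the basis. -/
def coordsProg : Prog :=
  mat 10 vn (nv 8) vd (.mul (.get 0 (nv 1) (nv 3)) (.get 9 (nv 3) (nv 2)))

/-- The projection of the rows of the input to the span of the basis. -/
def projProg : Prog :=
  mat 11 vn vd (nv 8) (.mul (.get 10 (nv 1) (nv 3)) (.get 9 (nv 2) (nv 3)))

/-- The squared norms of the columns of the residual. -/
def weightsProg : Prog :=
  mat 13 (.lit 1) vd vn (.mul (.sub (.get 0 (nv 3) (nv 2)) (.get 11 (nv 3) (nv 2)))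
    (.sub (.get 0 (nv 3) (nv 2)) (.get 11 (nv 3) (nv 2))))

/-- The sum of the weights. -/
def weightSumProg : Prog :=
  mat 14 (.lit 1) (.lit 1) vd (.get 13 (.lit 0) (nv 3))

/-- The weights of the columns. -/
def findWeights : Prog :=
  .seq coordsProg (.seq projProg (.seq weightsProg weightSumProg))

theorem findWeights_run {dec : SVDRoutine} {ω : ℕ → unitInterval} {n d k r l : ℕ}
    {X : Matrix (Fin n) (Fin d) ℝ} {Z : Matrix (Fin d) (Fin l) ℝ} {s : State}
    (hI : Inp X k r s) (hn : 0 < n) (hd : 0 < d) (hl : l < r) (h8 : s.nat 8 0 = l)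
    (h9 : ∀ i j, s.real 9 (i : Fin d) (j : Fin l) = Z i j) :
    ∃ s', findWeights.exec dec ω s = s' ∧
      (∀ i : Fin d, s'.real 13 0 i = colSq (X - X * Z * Zᵀ) i) ∧
      s'.real 14 0 0 = ∑ i, colSq (X - X * Z * Zᵀ) i ∧
      s'.time ≤ s.time + 2500 * (n * d * r) := by
  obtain ⟨s₁, e₁, A₁, v₁, t₁⟩ := mat_run (dec := dec) (ω := ω) (P := coordsProg) rfl (s := s)
    (n := n) (m := l) (k := d) (fun i j l => padX X i l * s.real 9 l j) 100
    (fun s' h => by simp [vn, NExp.eval, h.2, hI.n])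
    (fun s' h => by simp [nv, NExp.eval, h.2, h8])
    (fun s' h => by simp [vd, NExp.eval, h.2, hI.d])
    (fun s' h _ _ _ => by simp [RExp.eval, NExp.eval, nv, h.1, hI.X])
    (by decide)
  have hI₁ := hI.agree A₁ (by decide)
  obtain ⟨s₂, e₂, A₂, v₂, t₂⟩ := mat_run (dec := dec) (ω := ω) (P := projProg) rfl (s := s₁)
    (n := n) (m := d) (k := l) (fun i j c => s₁.real 10 i c * s.real 9 j c) 100
    (fun s' h => by simp [vn, NExp.eval, h.2, hI₁.n])
    (fun s' h => by simp [vd, NExp.eval, h.2, hI₁.d])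
    (fun s' h => by simp [nv, NExp.eval, h.2, A₁.2, h8])
    (fun s' h _ _ _ => by simp [RExp.eval, NExp.eval, nv, h.1, A₁.1])
    (by decide)
  have hI₂ := hI₁.agree A₂ (by decide)
  obtain ⟨s₃, e₃, A₃, v₃, t₃⟩ := mat_run (dec := dec) (ω := ω) (P := weightsProg) rfl (s := s₂)
    (n := 1) (m := d) (k := n)
    (fun _ j a => (padX X a j - s₂.real 11 a j) * (padX X a j - s₂.real 11 a j)) 100
    (fun s' h => rfl)
    (fun s' h => by simp [vd, NExp.eval, h.2, hI₂.d])
    (fun s' h => by simp [vn, NExp.eval, h.2, hI₂.n])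
    (fun s' h _ _ _ => by simp [RExp.eval, NExp.eval, nv, h.1, hI₂.X])
    (by decide)
  have hI₃ := hI₂.agree A₃ (by decide)
  obtain ⟨s₄, e₄, A₄, v₄, t₄⟩ := mat_run (dec := dec) (ω := ω) (P := weightSumProg) rfl (s := s₃)
    (n := 1) (m := 1) (k := d) (fun _ _ i => s₃.real 13 0 i) 100
    (fun s' h => rfl) (fun s' h => rfl)
    (fun s' h => by simp [vd, NExp.eval, h.2, hI₃.d])
    (fun s' h _ _ _ => by simp [RExp.eval, NExp.eval, nv, h.1])
    (by decide)
  have hY : ∀ (i : Fin n) (j : Fin l), s₁.real 10 i j = (X * Z) i j := fun i j => by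
    rw [v₁, if_pos ⟨i.2, j.2⟩, Finset.sum_range, Matrix.mul_apply]
    exact Finset.sum_congr rfl fun c _ => by rw [padX_coe, h9]
  have hP : ∀ (i : Fin n) (j : Fin d), s₂.real 11 i j = (X * Z * Zᵀ) i j := fun i j => by
    rw [v₂, if_pos ⟨i.2, j.2⟩, Finset.sum_range, Matrix.mul_apply]
    exact Finset.sum_congr rfl fun c _ => by rw [hY, h9, Matrix.transpose_apply]
  have hW : ∀ i : Fin d, s₃.real 13 0 i = colSq (X - X * Z * Zᵀ) i := fun i => by
    rw [v₃, if_pos ⟨Nat.one_pos, i.2⟩, Finset.sum_range, colSq]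
    exact Finset.sum_congr rfl fun a _ => by
      rw [padX_coe, hP, Matrix.sub_apply, sq]
  refine ⟨s₄, ?_, fun i => ?_, ?_, ?_⟩
  · rw [findWeights, Prog.exec, Prog.exec, Prog.exec, e₁, e₂, e₃, e₄]
  · rw [A₄.1 13 (by decide), hW]
  · rw [v₄, if_pos ⟨Nat.one_pos, Nat.one_pos⟩, Finset.sum_range]
    exact Finset.sum_congr rfl fun i _ => hW i
  · have b1 : (n + 1) * (l + 1) * (d + 1) ≤ 4 * (n * d * r) := by
      calc (n + 1) * (l + 1) * (d + 1) ≤ (2 * n) * r * (2 * d) := by gcongr <;> omega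
        _ = _ := by ring
    have b2 : (n + 1) * (d + 1) * (l + 1) ≤ 4 * (n * d * r) := by
      calc (n + 1) * (d + 1) * (l + 1) ≤ (2 * n) * (2 * d) * r := by gcongr <;> omega
        _ = _ := by ring
    have b3 : (1 + 1) * (d + 1) * (n + 1) ≤ 8 * (n * d * r) := by
      calc (1 + 1) * (d + 1) * (n + 1) ≤ (2 * r) * (2 * d) * (2 * n) := by gcongr <;> omega
        _ = _ := by ring
    have b4 : (1 + 1) * (1 + 1) * (d + 1) ≤ 8 * (n * d * r) := by
      calc (1 + 1) * (1 + 1) * (d + 1) ≤ (2 * n) * (2 * r) * (2 * d) := by gcongr <;> omega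
        _ = _ := by ring
    omega

/-- `1` if the two integers are equal, and `0` otherwise. -/
def eqExp (e f : NExp) : RExp :=
  .cast (.sub (.lit 1) (.add (.sub e f) (.sub f e)))

theorem eqExp_eval (e f : NExp) (s : State) :
    (eqExp e f).eval s = if e.eval s = f.eval s then 1 else 0 := by
  simp only [eqExp, RExp.eval, NExp.eval]
  split_ifs with h
  · simp [h]
  · have : 1 - (e.eval s - f.eval s + (f.eval s - e.eval s)) = 0 := by omega
    rw [this, Nat.cast_zero]

/-- The initial barrier matrix. -/
def initBarrier : Prog :=
  mat 15 (nv 8) (nv 8) (.lit 1)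
    (.mul (eqExp (nv 1) (nv 2)) (.sub (.cast (.add (nv 8) (nv 8))) (.lit 1)))

/-- The inverse of the barrier matrix. -/
def inverseProg : Prog :=
  mat 19 (nv 8) (nv 8) (nv 8)
    (.div (.mul (.get 18 (nv 1) (nv 3)) (.get 16 (nv 2) (nv 3))) (.get 17 (.lit 0) (nv 3)))

/-- The trace of the inverse. -/
def traceProg : Prog :=
  mat 20 (.lit 1) (.lit 1) (nv 8) (.get 19 (nv 3) (nv 3))

/-- The basis times the inverse. -/
def basisInverseProg : Prog :=
  mat 21 vd (nv 8) (nv 8) (.mul (.get 9 (nv 1) (nv 3)) (.get 19 (nv 3) (nv 2)))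

/-- The scores of the columns. -/
def scoreProg : Prog :=
  mat 24 (.lit 1) vd (nv 8)
    (.sub (.div (.mul (.get 21 (nv 2) (nv 3)) (.get 21 (nv 2) (nv 3)))
      (.sub (.get 20 (.lit 0) (.lit 0)) (.lit (1 / 2))))
      (.mul (.get 21 (nv 2) (nv 3)) (.get 9 (nv 2) (nv 3))))

/-- Select a column whose score is positive and exceeds its share of the weights. -/
def choose : Prog :=
  .loop 2 vd (.ite (.ltR (.lit 0) (.get 24 (.lit 0) (nv 2)))
    (.ite (.ltR (.get 24 (.lit 0) (nv 2))
        (.div (.get 13 (.lit 0) (nv 2)) (.mul (.lit 2) (.get 14 (.lit 0) (.lit 0)))))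
      .skip (.setN 9 (nv 4) (nv 2))) .skip)

/-- The updated barrier matrix. -/
def updateBarrier : Prog :=
  mat 25 (nv 8) (nv 8) (.lit 1)
    (.add (.sub (.get 15 (nv 1) (nv 2)) (eqExp (nv 1) (nv 2)))
      (.div (.mul (.get 9 (.get 9 (nv 4)) (nv 1)) (.get 9 (.get 9 (nv 4)) (nv 2)))
        (.get 24 (.lit 0) (.get 9 (nv 4)))))

/-- Copy the updated barrier matrix back. -/
def copyBarrier : Prog :=
  mat 15 (nv 8) (nv 8) (.lit 1) (.get 25 (nv 1) (nv 2))

/-- One step of the barrier method. -/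
def barrierStep : Prog :=
  .seq (.svd 15 (nv 8) (nv 8) 16 17 18) (.seq inverseProg (.seq traceProg
    (.seq basisInverseProg (.seq scoreProg (.seq choose (.seq updateBarrier copyBarrier))))))

theorem choose_run {dec : SVDRoutine} {ω : ℕ → unitInterval} {n d k r t : ℕ}
    {X : Matrix (Fin n) (Fin d) ℝ} {s : State} (hI : Inp X k r s) (h4 : s.nat 4 0 = t)
    (hex : ∃ j < d, 0 < s.real 24 0 j ∧ s.real 13 0 j / (2 * s.real 14 0 0) ≤ s.real 24 0 j) :
    ∃ s', choose.exec dec ω s = s' ∧ (∀ u, u ≠ t → s'.nat 9 u = s.nat 9 u) ∧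
      (∃ j < d, s'.nat 9 t = j ∧ 0 < s.real 24 0 j ∧
        s.real 13 0 j / (2 * s.real 14 0 0) ≤ s.real 24 0 j) ∧
      s'.time ≤ s.time + 60 * (d + 1) := by
  have hv : vd.eval s = d := hI.d
  have key := Prog.exec_loop_induct (dec := dec) (ω := ω) (x := 2) (e := vd)
    (c := .ite (.ltR (.lit 0) (.get 24 (.lit 0) (nv 2)))
      (.ite (.ltR (.get 24 (.lit 0) (nv 2))
          (.div (.get 13 (.lit 0) (nv 2)) (.mul (.lit 2) (.get 14 (.lit 0) (.lit 0)))))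
        .skip (.setN 9 (nv 4) (nv 2))) .skip) (s := s)
    -- The last qualifying column overwrites earlier ones. Existence of a qualifying column is known
    -- only for the whole range, so the invariant is an implication.
    (P := fun m s' => s'.real = s.real ∧ s'.nat 4 0 = t ∧
      (∀ u, u ≠ t → s'.nat 9 u = s.nat 9 u) ∧
      ((∃ j < m, 0 < s.real 24 0 j ∧ s.real 13 0 j / (2 * s.real 14 0 0) ≤ s.real 24 0 j) →
        ∃ j < m, s'.nat 9 t = j ∧ 0 < s.real 24 0 j ∧
        s.real 13 0 j / (2 * s.real 14 0 0) ≤ s.real 24 0 j) ∧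
      s'.time ≤ s.time + 3 + m * 60) ?_ ?_
  · rw [hv] at key
    refine ⟨_, rfl, key.2.2.1, key.2.2.2.1 hex, ?_⟩
    have := key.2.2.2.2
    rw [choose]
    omega
  · refine ⟨rfl, h4, fun _ _ => rfl, ?_, ?_⟩
    · rintro ⟨j, hj, -⟩; omega
    · simp [State.tick, vd, NExp.cost]
  · rintro m hm s' ⟨h1, h2, h3, h5, h6⟩
    rw [hv] at hm
    rw [Prog.exec]
    have hb : (BExp.ltR (.lit 0) (.get 24 (.lit 0) (nv 2))).eval ((s'.writeN 2 0 m).tick 1) ↔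
        0 < s.real 24 0 m := by
      simp [BExp.eval, RExp.eval, nv, NExp.eval, State.writeN, State.tick, h1]
    by_cases h : 0 < s.real 24 0 m
    · rw [if_pos (hb.2 h), Prog.exec]
      have hb' : (BExp.ltR (.get 24 (.lit 0) (nv 2))
          (.div (.get 13 (.lit 0) (nv 2)) (.mul (.lit 2) (.get 14 (.lit 0) (.lit 0))))).eval
          (((s'.writeN 2 0 m).tick 1).tick
            ((BExp.ltR (.lit 0) (.get 24 (.lit 0) (nv 2))).cost + 1)) ↔
          s.real 24 0 m < s.real 13 0 m / (2 * s.real 14 0 0) := by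
        simp [BExp.eval, RExp.eval, nv, NExp.eval, State.writeN, State.tick, h1]
      by_cases h' : s.real 24 0 m < s.real 13 0 m / (2 * s.real 14 0 0)
      · rw [if_pos (hb'.2 h')]
        simp only [Prog.exec, nv, State.writeN, State.tick, NExp.cost, BExp.cost, RExp.cost]
        refine ⟨h1, by simpa using h2, fun u hu => by simpa using h3 u hu, ?_, by omega⟩
        rintro ⟨j, hj, hj1, hj2⟩
        have hjm : j ≠ m := by
          rintro rfl; exact absurd h' (not_lt.2 hj2)
        obtain ⟨j', q1, q2, q3⟩ := h5 ⟨j, by omega, hj1, hj2⟩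
        exact ⟨j', by omega, by simpa using q2, q3⟩
      · rw [if_neg (hb'.not.2 h')]
        simp only [Prog.exec, nv, NExp.eval, State.writeN, State.tick, NExp.cost, BExp.cost,
          RExp.cost]
        refine ⟨h1, by simpa using h2, fun u hu => ?_, fun _ => ?_, by omega⟩
        · simp [h2, hu, h3 u hu]
        · exact ⟨m, by omega, by simp [h2], h, not_lt.1 h'⟩
    · rw [if_neg (hb.not.2 h)]
      simp only [Prog.exec, nv, State.writeN, State.tick, NExp.cost, BExp.cost, RExp.cost]
      refine ⟨h1, by simpa using h2, fun u hu => by simpa using h3 u hu, ?_, by omega⟩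
      rintro ⟨j, hj, hj1, hj2⟩
      have hjm : j ≠ m := by
        rintro rfl; exact absurd hj1 h
      obtain ⟨j', q1, q2, q3⟩ := h5 ⟨j, by omega, hj1, hj2⟩
      exact ⟨j', by omega, by simpa using q2, q3⟩

theorem SVD.inv_eq {l : ℕ} {T : Matrix (Fin l) (Fin l) ℝ} (D : SVD T) (hT : IsUnit T.det) :
    T⁻¹ = D.V * Matrix.diagonal (fun t => (D.σ t)⁻¹) * D.Uᵀ := by
  refine Matrix.inv_eq_right_inv ?_
  rw [← Matrix.mul_assoc, D.mul_inv]
  have h : D.U * (D.Uᵀ * T) * T⁻¹ = T * T⁻¹ := congrArg (· * T⁻¹) D.U_mul_transpose_mul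
  rwa [← Matrix.mul_assoc, Matrix.mul_assoc _ T, Matrix.mul_nonsing_inv _ hT, Matrix.mul_one] at h

/-- Padded terms vanish because the singular vector is zero there; the quotient by the padded
singular value does no harm. -/
theorem SVD.sum_pad_inv {m n N : ℕ} {A : Matrix (Fin m) (Fin n) ℝ} (D : SVD A) (hN : A.rank ≤ N)
    (i : Fin n) (j : Fin m) :
    ∑ c ∈ Finset.range N, D.padV i c * D.padU j c / D.sv c =
      (D.V * Matrix.diagonal (fun t => (D.σ t)⁻¹) * D.Uᵀ) i j := by
  rw [Matrix.mul_apply, sum_fin_eq_sum_range_dite hN]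
  refine Finset.sum_congr rfl fun c _ => ?_
  split_ifs with h
  · rw [Matrix.mul_diagonal, Matrix.transpose_apply, D.padV_coe i ⟨c, h⟩, D.padU_coe j ⟨c, h⟩,
      D.sv_coe ⟨c, h⟩]
    ring
  · rw [D.padV_of_le (not_lt.1 h)]
    ring

/-- Scoring all columns needs only the $d\times l$ product $ZT^{-1}$, and the decomposition of `T`
costs $l^3\le dl^2$. Thus a step costs order $dl^2$, and $4l$ steps give the term $dk^3$. -/
theorem barrierStep_run {dec : SVDRoutine} {ω : ℕ → unitInterval} {n d k r l t : ℕ}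
    {X : Matrix (Fin n) (Fin d) ℝ} {Z : Matrix (Fin d) (Fin l) ℝ} {a : Fin d → ℝ}
    {ι : ℕ → Fin d} {T : Matrix (Fin l) (Fin l) ℝ} {s : State}
    (hI : Inp X k r s) (hl : 0 < l) (hld : l ≤ d) (hZ : Zᵀ * Z = 1) (ha : ∀ i, 0 ≤ a i)
    (h4 : s.nat 4 0 = t) (h8 : s.nat 8 0 = l)
    (h9 : ∀ i j, s.real 9 (i : Fin d) (j : Fin l) = Z i j)
    (h13 : ∀ i : Fin d, s.real 13 0 i = a i) (h14 : s.real 14 0 0 = ∑ i, a i)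
    (h15 : ∀ i j : Fin l, s.real 15 i j = T i j) (hB : BarrierRun Z a t ι T)
    (hι : ∀ u < t, s.nat 9 u = ι u) :
    ∃ (s' : State) (ι' : ℕ → Fin d) (T' : Matrix (Fin l) (Fin l) ℝ),
      barrierStep.exec dec ω s = s' ∧ BarrierRun Z a (t + 1) ι' T' ∧
      (∀ i j : Fin l, s'.real 15 i j = T' i j) ∧ (∀ u < t + 1, s'.nat 9 u = ι' u) ∧
      s'.time ≤ s.time + 5000 * (d * l * l) := by
  obtain ⟨s₁, e₁, f₁, n₁, U₁, z₁, -, V₁, t₁⟩ := svd_run (dec := dec) (ω := ω) (a := 15)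
    (p := nv 8) (q := nv 8) (u := 16) (z := 17) (v := 18) (s := s) (m := l) (n := l) (A := T)
    h8 h8 h15 (by decide) (by decide) (by decide)
  obtain ⟨D, hD⟩ : ∃ D, D = dec l l T := ⟨_, rfl⟩
  rw [← hD] at U₁ z₁ V₁
  rw [min_self] at U₁ z₁ V₁ t₁
  have hI₁ : Inp X k r s₁ := hI.congr (by rw [n₁]) (f₁ 0 (by decide) (by decide) (by decide))
  have h8₁ : s₁.nat 8 0 = l := by rw [n₁, h8]
  obtain ⟨s₂, e₂, A₂, v₂, t₂⟩ := mat_run (dec := dec) (ω := ω) (P := inverseProg) rfl (s := s₁)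
    (n := l) (m := l) (k := l) (fun i j c => D.padV i c * D.padU j c / D.sv c) 100
    (fun s' h => by simp [nv, NExp.eval, h.2, h8₁])
    (fun s' h => by simp [nv, NExp.eval, h.2, h8₁])
    (fun s' h => by simp [nv, NExp.eval, h.2, h8₁])
    (fun s' h h1 h2 h3 => by
      simp [RExp.eval, NExp.eval, nv, h.1, V₁ _ h1 _ h3, U₁ _ h2 _ h3, z₁ _ h3])
    (by decide)
  have hTP := hB.1.posDef
  have hdet : IsUnit T.det := (Matrix.isUnit_iff_isUnit_det T).1 hTP.isUnit
  have hM : ∀ i j : Fin l, s₂.real 19 i j = T⁻¹ i j := fun i j => by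
    rw [v₂, if_pos ⟨i.2, j.2⟩, D.sum_pad_inv ((rank_le_min _).trans (min_le_left _ _)),
      D.inv_eq hdet]
  have h8₂ : s₂.nat 8 0 = l := by rw [A₂.2 8 (by decide) (by decide) (by decide), h8₁]
  obtain ⟨s₃, e₃, A₃, v₃, t₃⟩ := mat_run (dec := dec) (ω := ω) (P := traceProg) rfl (s := s₂)
    (n := 1) (m := 1) (k := l) (fun _ _ c => s₂.real 19 c c) 100
    (fun s' h => rfl) (fun s' h => rfl)
    (fun s' h => by simp [nv, NExp.eval, h.2, h8₂])
    (fun s' h _ _ _ => by simp [RExp.eval, NExp.eval, nv, h.1])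
    (by decide)
  have htr : s₃.real 20 0 0 = (T⁻¹).trace := by
    rw [v₃, if_pos ⟨Nat.one_pos, Nat.one_pos⟩, Finset.sum_range]
    exact Finset.sum_congr rfl fun c _ => hM c c
  have hI₃ : Inp X k r s₃ := (hI₁.agree A₂ (by decide)).agree A₃ (by decide)
  have h8₃ : s₃.nat 8 0 = l := by rw [A₃.2 8 (by decide) (by decide) (by decide), h8₂]
  have h9₃ : s₃.real 9 = s.real 9 := by
    rw [A₃.1 9 (by decide), A₂.1 9 (by decide), f₁ 9 (by decide) (by decide) (by decide)]
  obtain ⟨s₄, e₄, A₄, v₄, t₄⟩ := mat_run (dec := dec) (ω := ω) (P := basisInverseProg) rfl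
    (s := s₃) (n := d) (m := l) (k := l) (fun i j c => s.real 9 i c * s₂.real 19 c j) 100
    (fun s' h => by simp [vd, NExp.eval, h.2, hI₃.d])
    (fun s' h => by simp [nv, NExp.eval, h.2, h8₃])
    (fun s' h => by simp [nv, NExp.eval, h.2, h8₃])
    (fun s' h _ _ _ => by simp [RExp.eval, NExp.eval, nv, h.1, h9₃, A₃.1])
    (by decide)
  have hZM : ∀ (i : Fin d) (j : Fin l), s₄.real 21 i j = (Z * T⁻¹) i j := fun i j => by
    rw [v₄, if_pos ⟨i.2, j.2⟩, Finset.sum_range, Matrix.mul_apply]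
    exact Finset.sum_congr rfl fun c _ => by rw [h9, hM]
  have hI₄ := hI₃.agree A₄ (by decide)
  have h8₄ : s₄.nat 8 0 = l := by rw [A₄.2 8 (by decide) (by decide) (by decide), h8₃]
  have h20₄ : s₄.real 20 0 0 = (T⁻¹).trace := by rw [A₄.1 20 (by decide), htr]
  obtain ⟨s₅, e₅, A₅, v₅, t₅⟩ := mat_run (dec := dec) (ω := ω) (P := scoreProg) rfl
    (s := s₄) (n := 1) (m := d) (k := l)
    (fun _ i b => s₄.real 21 i b * s₄.real 21 i b / ((T⁻¹).trace - 1 / 2) -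
      s₄.real 21 i b * s.real 9 i b) 100
    (fun s' h => rfl)
    (fun s' h => by simp [vd, NExp.eval, h.2, hI₄.d])
    (fun s' h => by simp [nv, NExp.eval, h.2, h8₄])
    (fun s' h _ _ _ => by
      simp [RExp.eval, NExp.eval, nv, h.1, h20₄, A₄.1, h9₃])
    (by decide)
  have hsc : ∀ i : Fin d, s₅.real 24 0 i = score Z T⁻¹ i := fun i => by
    rw [v₅, if_pos ⟨Nat.one_pos, i.2⟩, Finset.sum_range, score, Finset.sum_div,
      ← Finset.sum_sub_distrib]
    exact Finset.sum_congr rfl fun b _ => by rw [hZM, h9, sq]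
  have hI₅ := hI₄.agree A₅ (by decide)
  have hr₅ : ∀ b, b ≠ 16 → b ≠ 17 → b ≠ 18 → b ≠ 19 → b ≠ 20 → b ≠ 21 → b ≠ 24 →
      s₅.real b = s.real b := fun b q1 q2 q3 q4 q5 q6 q7 => by
    rw [A₅.1 b q7, A₄.1 b q6, A₃.1 b q5, A₂.1 b q4, f₁ b q1 q2 q3]
  have hn₅ : ∀ b, b ≠ 1 → b ≠ 2 → b ≠ 3 → s₅.nat b = s.nat b := fun b q1 q2 q3 => by
    rw [A₅.2 b q1 q2 q3, A₄.2 b q1 q2 q3, A₃.2 b q1 q2 q3, A₂.2 b q1 q2 q3, n₁]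
  have h13₅ : ∀ i : Fin d, s₅.real 13 0 i = a i := fun i => by
    rw [hr₅ 13 (by decide) (by decide) (by decide) (by decide) (by decide) (by decide)
      (by decide), h13]
  have h14₅ : s₅.real 14 0 0 = ∑ i, a i := by
    rw [hr₅ 14 (by decide) (by decide) (by decide) (by decide) (by decide) (by decide)
      (by decide), h14]
  obtain ⟨htr0, i₀, hi₀, hi₀'⟩ := hB.1.exists_score hZ ha
  obtain ⟨s₆, e₆, o₆, ⟨j, hj, hj1, hj2, hj3⟩, t₆⟩ := choose_run (dec := dec) (ω := ω) hI₅
    (t := t) (by rw [hn₅ 4 (by decide) (by decide) (by decide), h4])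
    ⟨i₀, i₀.2, by rw [hsc]; exact hi₀, by rw [hsc, h13₅, h14₅]; exact hi₀'⟩
  obtain ⟨i, rfl⟩ : ∃ i : Fin d, (i : ℕ) = j := ⟨⟨j, hj⟩, rfl⟩
  rw [hsc] at hj2
  rw [hsc, h13₅, h14₅] at hj3
  have hr₆ : s₆.real = s₅.real := by
    funext b; rw [← e₆]; exact Prog.exec_real (by simp [choose, Prog.writesR]) _
  have hn₆ : ∀ b, b ≠ 2 → b ≠ 9 → s₆.nat b = s₅.nat b := fun b q1 q2 => by
    rw [← e₆]; exact Prog.exec_nat (by simp [choose, Prog.writesN, q1, q2]) _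
  have h8₆ : s₆.nat 8 0 = l := by
    rw [hn₆ 8 (by decide) (by decide), hn₅ 8 (by decide) (by decide) (by decide), h8]
  have h4₆ : s₆.nat 4 0 = t := by
    rw [hn₆ 4 (by decide) (by decide), hn₅ 4 (by decide) (by decide) (by decide), h4]
  have h9₆ : s₆.real 9 = s.real 9 := by
    rw [hr₆, hr₅ 9 (by decide) (by decide) (by decide) (by decide) (by decide) (by decide)
      (by decide)]
  have h15₆ : s₆.real 15 = s.real 15 := by
    rw [hr₆, hr₅ 15 (by decide) (by decide) (by decide) (by decide) (by decide) (by decide)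
      (by decide)]
  have h24₆ : s₆.real 24 0 i = score Z T⁻¹ i := by rw [hr₆, hsc]
  obtain ⟨s₇, e₇, A₇, v₇, t₇⟩ := mat_run (dec := dec) (ω := ω) (P := updateBarrier) rfl
    (s := s₆) (n := l) (m := l) (k := 1)
    (fun p q _ => s.real 15 p q - (if p = q then 1 else 0) +
      s.real 9 i p * s.real 9 i q / score Z T⁻¹ i) 100
    (fun s' h => by simp [nv, NExp.eval, h.2, h8₆])
    (fun s' h => by simp [nv, NExp.eval, h.2, h8₆])
    (fun s' h => rfl)
    (fun s' h _ _ _ => by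
      simp [RExp.eval, NExp.eval, eqExp_eval, nv, h.1, h.2, h4₆, hj1, h9₆, h15₆, h24₆]
      rfl)
    (by decide)
  have h8₇ : s₇.nat 8 0 = l := by rw [A₇.2 8 (by decide) (by decide) (by decide), h8₆]
  -- The new barrier matrix depends on array 15, which `mat` may not read while filling it; hence
  -- the detour over array 25.
  obtain ⟨s₈, e₈, A₈, v₈, t₈⟩ := mat_run (dec := dec) (ω := ω) (P := copyBarrier) rfl
    (s := s₇) (n := l) (m := l) (k := 1) (fun p q _ => s₇.real 25 p q) 100
    (fun s' h => by simp [nv, NExp.eval, h.2, h8₇])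
    (fun s' h => by simp [nv, NExp.eval, h.2, h8₇])
    (fun s' h => rfl)
    (fun s' h _ _ _ => by simp [RExp.eval, NExp.eval, nv, h.1])
    (by decide)
  refine ⟨s₈, Function.update ι t i,
    T - 1 + (score Z T⁻¹ i)⁻¹ • Matrix.vecMulVec (Z i) (Z i), ?_, hB.succ hZ ha hj2 hj3, ?_, ?_, ?_⟩
  · simp only [barrierStep, Prog.exec] at e₁ ⊢
    rw [e₁, e₂, e₃, e₄, e₅, e₆, e₇, e₈]
  · intro p q
    rw [v₈, if_pos ⟨p.2, q.2⟩, Finset.sum_range_one, v₇, if_pos ⟨p.2, q.2⟩,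
      Finset.sum_range_one, h15, h9, h9, Matrix.add_apply, Matrix.sub_apply, Matrix.one_apply,
      Matrix.smul_apply, Matrix.vecMulVec_apply, smul_eq_mul]
    simp only [Fin.val_inj]
    rw [div_eq_inv_mul]
  · intro u hu
    have hnn : s₈.nat 9 u = s₆.nat 9 u := by
      rw [A₈.2 9 (by decide) (by decide) (by decide), A₇.2 9 (by decide) (by decide) (by decide)]
    rw [hnn]
    by_cases hut : u = t
    · subst hut
      rw [hj1, Function.update_self]
    · rw [o₆ u hut, hn₅ 9 (by decide) (by decide) (by decide), hι u (by omega),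
        Function.update_of_ne hut]
  · simp only [nv, NExp.cost] at t₁
    have hd : 0 < d := by omega
    have b1 : l * l * l ≤ d * l * l := by gcongr
    have b2 : (l + 1) * (l + 1) * (l + 1) ≤ 8 * (d * l * l) := by
      calc (l + 1) * (l + 1) * (l + 1) ≤ (2 * d) * (2 * l) * (2 * l) := by gcongr <;> omega
        _ = _ := by ring
    have b3 : (1 + 1) * (1 + 1) * (l + 1) ≤ 8 * (d * l * l) := by
      calc (1 + 1) * (1 + 1) * (l + 1) ≤ (2 * d) * (2 * l) * (2 * l) := by gcongr <;> omega
        _ = _ := by ring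
    have b4 : (d + 1) * (l + 1) * (l + 1) ≤ 8 * (d * l * l) := by
      calc (d + 1) * (l + 1) * (l + 1) ≤ (2 * d) * (2 * l) * (2 * l) := by gcongr <;> omega
        _ = _ := by ring
    have b5 : (1 + 1) * (d + 1) * (l + 1) ≤ 8 * (d * l * l) := by
      calc (1 + 1) * (d + 1) * (l + 1) ≤ (2 * l) * (2 * d) * (2 * l) := by gcongr <;> omega
        _ = _ := by ring
    have b6 : d + 1 ≤ 2 * (d * l * l) := by
      calc d + 1 ≤ 2 * (d * 1 * 1) := by omega
        _ ≤ _ := by gcongr <;> omega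
    have b7 : (l + 1) * (l + 1) * (1 + 1) ≤ 8 * (d * l * l) := by
      calc (l + 1) * (l + 1) * (1 + 1) ≤ (2 * l) * (2 * l) * (2 * d) := by gcongr <;> omega
        _ = _ := by ring
    omega

end SparseEncoder

namespace SparseEncoder

open Matrix

/-! ### The complete column selection -/

/-- Four times the dimension of the basis. -/
def v4 : NExp := .add (.add (nv 8) (nv 8)) (.add (nv 8) (nv 8))

theorem v4_eval {s : State} {l : ℕ} (h : s.nat 8 0 = l) : v4.eval s = 4 * l := by
  simp only [v4, nv, NExp.eval, h]
  ring

/-- Select columns by the barrier method. -/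
def selectColumns : Prog :=
  .seq findWeights (.seq initBarrier (.loop 4 v4 barrierStep))

theorem selectColumns_run {dec : SVDRoutine} {ω : ℕ → unitInterval} {n d k r l : ℕ}
    {X : Matrix (Fin n) (Fin d) ℝ} {Z : Matrix (Fin d) (Fin l) ℝ} {s : State}
    (hI : Inp X k r s) (hn : 0 < n) (hd : 0 < d) (hl : l < r) (hld : l ≤ d) (hZ : Zᵀ * Z = 1)
    (h8 : s.nat 8 0 = l) (h9 : ∀ i j, s.real 9 (i : Fin d) (j : Fin l) = Z i j) :
    ∃ (s' : State) (ι : ℕ → Fin d) (W : Matrix (Fin (4 * l)) (Fin d) ℝ),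
      selectColumns.exec dec ω s = s' ∧ (∀ u < 4 * l, s'.nat 9 u = ι u) ∧
      frobSq (X - X.submatrix id (fun u : Fin (4 * l) => ι u) * W) ≤
        5 * frobSq (X - X * Z * Zᵀ) ∧
      s'.time ≤ s.time + 30000 * (n * d * r + d * l ^ 3) := by
  obtain ⟨s₁, e₁, h13, h14, t₁⟩ := findWeights_run (dec := dec) (ω := ω) hI hn hd hl h8 h9
  have hI₁ : Inp X k r s₁ := by
    rw [← e₁]; exact hI.congr (Prog.exec_nat (by decide) _) (Prog.exec_real (by decide) _)
  have h8₁ : s₁.nat 8 0 = l := by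
    rw [← e₁, Prog.exec_nat (by decide), h8]
  have h9₁ : s₁.real 9 = s.real 9 := by
    rw [← e₁, Prog.exec_real (by decide)]
  obtain ⟨s₂, e₂, A₂, v₂, t₂⟩ := mat_run (dec := dec) (ω := ω) (P := initBarrier) rfl (s := s₁)
    (n := l) (m := l) (k := 1)
    (fun i j _ => (if i = j then 1 else 0) * (2 * (l : ℝ) - 1)) 100
    (fun s' h => by simp [nv, NExp.eval, h.2, h8₁])
    (fun s' h => by simp [nv, NExp.eval, h.2, h8₁])
    (fun s' h => rfl)
    (fun s' h _ _ _ => by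
      simp only [RExp.eval, NExp.eval, eqExp_eval, nv,
        h.2 8 (by decide) (by decide) (by decide), h8₁]
      push_cast
      rw [two_mul]
      rfl)
    (by decide)
  have hI₂ := hI₁.agree A₂ (by decide)
  have h8₂ : s₂.nat 8 0 = l := by rw [A₂.2 8 (by decide) (by decide) (by decide), h8₁]
  have hT : ∀ i j : Fin l, s₂.real 15 i j =
      ((2 * (l : ℝ) - 1) • (1 : Matrix (Fin l) (Fin l) ℝ)) i j := fun i j => by
    rw [v₂, if_pos ⟨i.2, j.2⟩, Finset.sum_range_one, Matrix.smul_apply, Matrix.one_apply,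
      smul_eq_mul, mul_comm]
    simp only [Fin.val_inj]
  have e : selectColumns.exec dec ω s = (Prog.loop 4 v4 barrierStep).exec dec ω s₂ := by
    rw [selectColumns, Prog.exec, Prog.exec, e₁, e₂]
  have b1 : (l + 1) * (l + 1) * (1 + 1) ≤ 4 * (n * d * r) := by
    calc (l + 1) * (l + 1) * (1 + 1) ≤ r * (2 * d) * (2 * n) := by gcongr <;> omega
      _ = _ := by ring
  have b2 : 1 ≤ n * d * r := Nat.mul_pos (Nat.mul_pos hn hd) (by omega)
  -- For $l=0$ the potential is an empty sum and never $1/2$, so the barrier argument does not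
  -- apply. The loop then makes no rounds, no column is selected, and the residual is $X$ itself.
  rcases Nat.eq_zero_or_pos l with hl0 | hl0
  · subst hl0
    have key := Prog.exec_loop_induct (dec := dec) (ω := ω) (x := 4) (e := v4)
      (c := barrierStep) (s := s₂)
      (P := fun t s' => t = 0 → s'.time ≤ s₂.time + 12) ?_ ?_
    · rw [v4_eval h8₂] at key
      refine ⟨_, fun _ => ⟨0, hd⟩, 0, e, fun u hu => absurd hu (by omega), ?_, ?_⟩
      · rw [Matrix.mul_zero, sub_zero]
        have : X * Z * Zᵀ = 0 := by
          ext i j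
          simp [Matrix.mul_apply]
        rw [this, sub_zero]
        linarith [frobSq_nonneg X]
      · have := key rfl
        omega
    · intro _
      simp [State.tick, v4, nv, NExp.cost]
    · intro t _ s' _ h
      omega
  · have key := Prog.exec_loop_induct (dec := dec) (ω := ω) (x := 4) (e := v4)
      (c := barrierStep) (s := s₂)
      (P := fun t s' => (∀ a ∈ [0, 9, 13, 14], s'.real a = s₂.real a) ∧
        (∀ a ∈ [0, 8], s'.nat a = s₂.nat a) ∧
        (∃ (ι : ℕ → Fin d) (T : Matrix (Fin l) (Fin l) ℝ),
          BarrierRun Z (colSq (X - X * Z * Zᵀ)) t ι T ∧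
          (∀ i j : Fin l, s'.real 15 i j = T i j) ∧ (∀ u < t, s'.nat 9 u = ι u)) ∧
        s'.time ≤ s₂.time + 12 + t * (5001 * (d * l * l))) ?_ ?_
    · rw [v4_eval h8₂] at key
      obtain ⟨-, -, ⟨ι, T, hB, -, hι⟩, ht⟩ := key
      obtain ⟨W, hW⟩ := hB.exists_approx hZ hl0
      refine ⟨_, ι, W, e, hι, hW, ?_⟩
      have b3 : 4 * l * (5001 * (d * l * l)) = 20004 * (d * l ^ 3) := by ring
      omega
    · refine ⟨fun _ _ => rfl, fun _ _ => rfl, ⟨fun _ => ⟨0, hd⟩, _,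
        BarrierRun.zero hl0 Z _ _, hT, fun u hu => absurd hu (by omega)⟩, ?_⟩
      simp [State.tick, v4, nv, NExp.cost]
    · rintro t ht s' ⟨hr', hn', ⟨ι, T, hB, hT', hι⟩, ht'⟩
      obtain ⟨s₃, hs₃⟩ : ∃ s₃, s₃ = (s'.writeN 4 0 t).tick 1 := ⟨_, rfl⟩
      rw [← hs₃]
      have hr₃ : s₃.real = s'.real := by rw [hs₃]; rfl
      have hn₃ : ∀ a, a ≠ 4 → s₃.nat a = s'.nat a := fun a ha => by
        rw [hs₃]; funext i; simp [State.writeN, State.tick, ha]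
      obtain ⟨s₄, ι', T', e₄, hB', hT₄, hι₄, t₄⟩ := barrierStep_run (dec := dec) (ω := ω)
        (s := s₃) (a := colSq (X - X * Z * Zᵀ)) (t := t) (ι := ι) (T := T) (l := l) (Z := Z)
        (hI₂.congr (by rw [hn₃ 0 (by decide), hn' 0 (by decide)])
          (by rw [hr₃, hr' 0 (by decide)])) hl0 hld hZ (colSq_nonneg _)
        (by rw [hs₃]; simp [State.writeN, State.tick])
        (by rw [hn₃ 8 (by decide), hn' 8 (by decide), h8₂])
        (fun i j => by rw [hr₃, hr' 9 (by decide), A₂.1 9 (by decide), h9₁, h9])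
        (fun i => by rw [hr₃, hr' 13 (by decide), A₂.1 13 (by decide), h13])
        (by rw [hr₃, hr' 14 (by decide), A₂.1 14 (by decide), h14])
        (fun i j => by rw [hr₃, hT']) hB (fun u hu => by rw [hn₃ 9 (by decide), hι u hu])
      refine ⟨fun a ha => ?_, fun a ha => ?_, ⟨ι', T', hB', ?_, ?_⟩, ?_⟩
      · rw [← hr' a ha, ← hr₃]
        refine Prog.exec_real ?_ _
        revert a
        decide
      · have : a ≠ 4 := by rintro rfl; revert ha; decide
        rw [← hn' a ha, ← hn₃ a this]
        refine Prog.exec_nat ?_ _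
        clear this
        revert a
        decide
      · rw [e₄]; exact hT₄
      · rw [e₄]; exact hι₄
      · rw [e₄]
        have : s₃.time = s'.time + 1 := by rw [hs₃]; rfl
        have b0 : 1 ≤ d * l * l := Nat.mul_pos (Nat.mul_pos hd hl0) hl0
        rw [Nat.add_mul]
        omega

/-! ### Third part of the program: adaptive sampling -/

/-- The columns selected by the barrier method. -/
def gatherSelected : Prog :=
  mat 26 vn v4 (.lit 1) (.get 0 (nv 1) (.get 9 (nv 2)))

/-- The minimum of two integers. -/
def minExp (e f : NExp) : NExp := .sub e (.sub e f)

theorem minExp_eval (e f : NExp) (s : State) :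
    (minExp e f).eval s = min (e.eval s) (f.eval s) := by
  simp only [minExp, NExp.eval]
  omega

/-- The coordinates of the input with respect to the span of the selected columns. -/
def selectedCoords : Prog :=
  mat 30 (minExp vn v4) vd vn (.mul (.get 27 (nv 3) (nv 1)) (.get 0 (nv 3) (nv 2)))

/-- The projection of the input to the span of the selected columns. -/
def selectedProj : Prog :=
  mat 31 vn vd (minExp vn v4) (.mul (.get 27 (nv 1) (nv 3)) (.get 30 (nv 3) (nv 2)))

/-- The squared norms of the columns of the residual. -/
def residualWeights : Prog :=
  mat 33 (.lit 1) vd vn (.mul (.sub (.get 0 (nv 3) (nv 2)) (.get 31 (nv 3) (nv 2)))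
    (.sub (.get 0 (nv 3) (nv 2)) (.get 31 (nv 3) (nv 2))))

/-- Partial sums of the weights. -/
def prefixSums : Prog :=
  .loop 2 vd (.setR 35 (.lit 0) (.add (nv 2) (.lit 1))
    (.add (.get 35 (.lit 0) (nv 2)) (.get 33 (.lit 0) (nv 2))))

/-- Prepare the sampling. -/
def prepare : Prog :=
  .seq gatherSelected (.seq (.svd 26 vn v4 27 28 29) (.seq selectedCoords
    (.seq selectedProj (.seq residualWeights prefixSums))))

theorem SVD.sum_padU_mul {m n N q : ℕ} {A : Matrix (Fin m) (Fin n) ℝ} (D : SVD A)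
    (hN : A.rank ≤ N) (X : Matrix (Fin m) (Fin q) ℝ) (i : Fin m) (j : Fin q) :
    ∑ c ∈ Finset.range N, D.padU i c * ∑ b : Fin m, D.padU b c * X b j =
      (D.U * (D.Uᵀ * X)) i j := by
  rw [Matrix.mul_apply, sum_fin_eq_sum_range_dite hN]
  refine Finset.sum_congr rfl fun c _ => ?_
  split_ifs with h
  · rw [D.padU_coe i ⟨c, h⟩, Matrix.mul_apply]
    congr 1
    exact Finset.sum_congr rfl fun b _ => by
      rw [D.padU_coe b ⟨c, h⟩, Matrix.transpose_apply]
  · rw [D.padU_of_le (not_lt.1 h), zero_mul]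

theorem prefixSums_run {dec : SVDRoutine} {ω : ℕ → unitInterval} {n d k r : ℕ}
    {X : Matrix (Fin n) (Fin d) ℝ} {s : State} {w : ℕ → ℝ} (hI : Inp X k r s)
    (h35 : s.real 35 0 0 = 0) (hw : ∀ i < d, s.real 33 0 i = w i) :
    ∃ s', prefixSums.exec dec ω s = s' ∧
      (∀ j ≤ d, s'.real 35 0 j = ∑ i ∈ Finset.range j, w i) ∧
      s'.time ≤ s.time + 30 * (d + 1) := by
  have hv : vd.eval s = d := hI.d
  have key := Prog.exec_loop_induct (dec := dec) (ω := ω) (x := 2) (e := vd)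
    (c := .setR 35 (.lit 0) (.add (nv 2) (.lit 1))
      (.add (.get 35 (.lit 0) (nv 2)) (.get 33 (.lit 0) (nv 2)))) (s := s)
    (P := fun t s' => s'.real 33 = s.real 33 ∧
      (∀ j ≤ t, s'.real 35 0 j = ∑ i ∈ Finset.range j, w i) ∧ s'.time ≤ s.time + 3 + t * 30)
    ?_ ?_
  · rw [hv] at key
    refine ⟨_, rfl, key.2.1, ?_⟩
    have := key.2.2
    rw [prefixSums]
    omega
  · refine ⟨rfl, fun j hj => ?_, by simp [State.tick, vd, NExp.cost]⟩
    obtain rfl : j = 0 := by omega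
    simpa [State.tick] using h35
  · rintro t ht s' ⟨h1, h2, h3⟩
    rw [hv] at ht
    simp only [Prog.exec, nv, NExp.eval, RExp.eval, State.writeN, State.writeR, State.tick,
      NExp.cost, RExp.cost]
    refine ⟨?_, fun j hj => ?_, by omega⟩
    · funext a b
      simp [h1]
    · by_cases hjt : j = t + 1
      · simp [hjt, h1, h2 t le_rfl, hw t ht, Finset.sum_range_succ]
      · simp [hjt, h2 j (by omega)]

/-- Two facts about the residual are needed: its optimality bounds its norm by the barrier estimate,
and its form $X-X_\iota W$ places sampled residual columns in the span of the chosen columns of $X$.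
-/
theorem prepare_run {dec : SVDRoutine} {ω : ℕ → unitInterval} {n d k r l : ℕ}
    {X : Matrix (Fin n) (Fin d) ℝ} {ι : ℕ → Fin d} {s : State}
    (hI : Inp X k r s) (hn : 0 < n) (hd : 0 < d) (hl : 4 * l < r) (h8 : s.nat 8 0 = l)
    (h9 : ∀ u < 4 * l, s.nat 9 u = ι u) (h35 : s.real 35 0 0 = 0) :
    ∃ (s' : State) (R : Matrix (Fin n) (Fin d) ℝ) (W : Matrix (Fin (4 * l)) (Fin d) ℝ)
      (w : ℕ → ℝ), prepare.exec dec ω s = s' ∧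
      R = X - X.submatrix id (fun u : Fin (4 * l) => ι u) * W ∧
      (∀ W' : Matrix (Fin (4 * l)) (Fin d) ℝ,
        frobSq R ≤ frobSq (X - X.submatrix id (fun u : Fin (4 * l) => ι u) * W')) ∧
      (∀ i, 0 ≤ w i) ∧ (∀ i : Fin d, w i = colSq R i) ∧
      (∀ j ≤ d, s'.real 35 0 j = ∑ i ∈ Finset.range j, w i) ∧
      s'.time ≤ s.time + 4000 * (n * d * r + n * r * r) := by
  obtain ⟨C, hC⟩ : ∃ C, C = X.submatrix id (fun u : Fin (4 * l) => ι u) := ⟨_, rfl⟩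
  rw [← hC]
  obtain ⟨s₁, e₁, A₁, v₁, t₁⟩ := mat_run (dec := dec) (ω := ω) (P := gatherSelected) rfl (s := s)
    (n := n) (m := 4 * l) (k := 1) (fun i j _ => padX X i (s.nat 9 j)) 100
    (fun s' h => by simp [vn, NExp.eval, h.2, hI.n])
    (fun s' h => v4_eval (by rw [h.2 8 (by decide) (by decide) (by decide), h8]))
    (fun s' h => rfl)
    (fun s' h _ _ _ => by simp [RExp.eval, NExp.eval, nv, h.1, h.2, hI.X])
    (by decide)
  have hI₁ := hI.agree A₁ (by decide)
  have h8₁ : s₁.nat 8 0 = l := by rw [A₁.2 8 (by decide) (by decide) (by decide), h8]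
  obtain ⟨s₂, e₂, f₂, n₂, U₂, -, -, -, t₂⟩ := svd_run (dec := dec) (ω := ω) (a := 26)
    (p := vn) (q := v4) (u := 27) (z := 28) (v := 29) (s := s₁) (m := n) (n := 4 * l) (A := C)
    (by simp [vn, NExp.eval, hI₁.n]) (v4_eval h8₁)
    (fun i j => by
      rw [v₁, if_pos ⟨i.2, j.2⟩, Finset.sum_range_one, h9 j j.2, padX_coe, hC]; rfl)
    (by decide) (by decide) (by decide)
  obtain ⟨D, hD⟩ : ∃ D, D = dec _ _ C := ⟨_, rfl⟩
  rw [← hD] at U₂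
  have hI₂ : Inp X k r s₂ := hI₁.congr (by rw [n₂]) (f₂ 0 (by decide) (by decide) (by decide))
  have h8₂ : s₂.nat 8 0 = l := by rw [n₂, h8₁]
  obtain ⟨N, hN⟩ : ∃ N, N = min n (4 * l) := ⟨_, rfl⟩
  rw [← hN] at U₂
  have hmin : ∀ {dst s s'}, Agree dst s s' → Inp X k r s → s.nat 8 0 = l →
      (minExp vn v4).eval s' = N := fun {dst s s'} h hI h8 => by
    rw [minExp_eval, v4_eval (l := l) (by rw [h.2 8 (by decide) (by decide) (by decide), h8]), hN]
    congr 1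
    rw [vn, NExp.eval, h.2 0 (by decide) (by decide) (by decide)]
    exact hI.n
  obtain ⟨s₃, e₃, A₃, v₃, t₃⟩ := mat_run (dec := dec) (ω := ω) (P := selectedCoords) rfl (s := s₂)
    (n := N) (m := d) (k := n) (fun i j a => D.padU a i * padX X a j) 100
    (fun s' h => hmin h hI₂ h8₂)
    (fun s' h => by simp [vd, NExp.eval, h.2, hI₂.d])
    (fun s' h => by simp [vn, NExp.eval, h.2, hI₂.n])
    (fun s' h h1 h2 h3 => by
      simp [RExp.eval, NExp.eval, nv, h.1, hI₂.X, U₂ _ h3 _ h1])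
    (by decide)
  have hI₃ := hI₂.agree A₃ (by decide)
  have h8₃ : s₃.nat 8 0 = l := by rw [A₃.2 8 (by decide) (by decide) (by decide), h8₂]
  have U₃ : ∀ i < n, ∀ j < N, s₃.real 27 i j = D.padU i j := fun i hi j hj => by
    rw [A₃.1 27 (by decide), U₂ i hi j hj]
  obtain ⟨s₄, e₄, A₄, v₄, t₄⟩ := mat_run (dec := dec) (ω := ω) (P := selectedProj) rfl (s := s₃)
    (n := n) (m := d) (k := N) (fun i j c => D.padU i c * s₃.real 30 c j) 100
    (fun s' h => by simp [vn, NExp.eval, h.2, hI₃.n])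
    (fun s' h => by simp [vd, NExp.eval, h.2, hI₃.d])
    (fun s' h => hmin h hI₃ h8₃)
    (fun s' h h1 h2 h3 => by
      simp [RExp.eval, NExp.eval, nv, h.1, U₃ _ h1 _ h3])
    (by decide)
  have hI₄ := hI₃.agree A₄ (by decide)
  obtain ⟨s₅, e₅, A₅, v₅, t₅⟩ := mat_run (dec := dec) (ω := ω) (P := residualWeights) rfl
    (s := s₄) (n := 1) (m := d) (k := n)
    (fun _ j a => (padX X a j - s₄.real 31 a j) * (padX X a j - s₄.real 31 a j)) 100
    (fun s' h => rfl)
    (fun s' h => by simp [vd, NExp.eval, h.2, hI₄.d])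
    (fun s' h => by simp [vn, NExp.eval, h.2, hI₄.n])
    (fun s' h _ _ _ => by simp [RExp.eval, NExp.eval, nv, h.1, hI₄.X])
    (by decide)
  have hI₅ := hI₄.agree A₅ (by decide)
  have hrank : C.rank ≤ N := by rw [hN]; exact rank_le_min C
  have hP : ∀ (i : Fin n) (j : Fin d), s₄.real 31 i j = (D.U * (D.Uᵀ * X)) i j := fun i j => by
    rw [v₄, if_pos ⟨i.2, j.2⟩, ← D.sum_padU_mul hrank]
    refine Finset.sum_congr rfl fun c hc => ?_
    rw [v₃, if_pos ⟨Finset.mem_range.1 hc, j.2⟩, Finset.sum_range]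
    simp only [padX_coe]
  obtain ⟨R, hR⟩ : ∃ R, R = X - D.U * (D.Uᵀ * X) := ⟨_, rfl⟩
  obtain ⟨w, hw⟩ : ∃ w : ℕ → ℝ, ∀ i, w i = if h : i < d then colSq R ⟨i, h⟩ else 0 :=
    ⟨_, fun _ => rfl⟩
  have hwR : ∀ i : Fin d, w i = colSq R i := fun i => by rw [hw, dif_pos i.2]
  have h33 : ∀ i < d, s₅.real 33 0 i = w i := fun i hi => by
    rw [v₅, if_pos ⟨Nat.one_pos, hi⟩, hwR ⟨i, hi⟩, Finset.sum_range, colSq]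
    refine Finset.sum_congr rfl fun a _ => ?_
    have h1 := padX_coe X a ⟨i, hi⟩
    have h2 := hP a ⟨i, hi⟩
    simp only at h1 h2
    rw [h1, h2, hR, Matrix.sub_apply, sq]
  have h35₅ : s₅.real 35 0 0 = 0 := by
    rw [A₅.1 35 (by decide), A₄.1 35 (by decide), A₃.1 35 (by decide),
      f₂ 35 (by decide) (by decide) (by decide), A₁.1 35 (by decide), h35]
  obtain ⟨s₆, e₆, v₆, t₆⟩ := prefixSums_run (dec := dec) (ω := ω) hI₅ h35₅ h33
  refine ⟨s₆, R, D.V * Matrix.diagonal (fun t => (D.σ t)⁻¹) * (D.Uᵀ * X), w, ?_, ?_, ?_, ?_, hwR,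
    v₆, ?_⟩
  · simp only [prepare, Prog.exec] at e₂ ⊢
    rw [e₁, e₂, e₃, e₄, e₅, e₆]
  · rw [hR, ← Matrix.mul_assoc C, D.mul_inv]
  · intro W'
    rw [hR]
    exact D.frobSq_sub_U_le X W'
  · intro i
    rw [hw]
    split_ifs
    · exact colSq_nonneg _ _
    · exact le_rfl
  · simp only [vn, v4, nv, NExp.cost] at t₂
    have hNr : N + 1 ≤ r := by rw [hN]; have := min_le_right n (4 * l); omega
    have b1 : (n + 1) * (4 * l + 1) * (1 + 1) ≤ 8 * (n * d * r) := by
      calc (n + 1) * (4 * l + 1) * (1 + 1) ≤ (2 * n) * r * (4 * d) := by gcongr <;> omega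
        _ = _ := by ring
    have b2 : n * (4 * l) * min n (4 * l) ≤ n * r * r := by
      gcongr
      exact (min_le_right _ _).trans hl.le
    have b3 : (N + 1) * (d + 1) * (n + 1) ≤ 4 * (n * d * r) := by
      calc (N + 1) * (d + 1) * (n + 1) ≤ r * (2 * d) * (2 * n) := by gcongr <;> omega
        _ = _ := by ring
    have b4 : (n + 1) * (d + 1) * (N + 1) ≤ 4 * (n * d * r) := by
      calc (n + 1) * (d + 1) * (N + 1) ≤ (2 * n) * (2 * d) * r := by gcongr <;> omega
        _ = _ := by ring
    have b5 : (1 + 1) * (d + 1) * (n + 1) ≤ 8 * (n * d * r) := by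
      calc (1 + 1) * (d + 1) * (n + 1) ≤ (2 * r) * (2 * d) * (2 * n) := by gcongr <;> omega
        _ = _ := by ring
    have b6 : d + 1 ≤ 2 * (n * d * r) := by
      calc d + 1 ≤ 2 * (1 * d * 1) := by omega
        _ ≤ _ := by gcongr <;> omega
    omega

end SparseEncoder

namespace SparseEncoder

open Matrix

/-! ### Third part of the program: sampling further columns -/

/-- Count the partial sums that do not exceed the random threshold. -/
def locate : Prog :=
  .loop 2 (.sub vd (.lit 1))
    (.ite (.ltR (.mul (.get 36 (.lit 0) (.lit 0)) (.get 35 (.lit 0) vd))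
        (.get 35 (.lit 0) (.add (nv 2) (.lit 1))))
      .skip
      (.setN 9 (.add v4 (nv 4)) (.add (.get 9 (.add v4 (nv 4))) (.lit 1))))

theorem locate_run {dec : SVDRoutine} {ω : ℕ → unitInterval} {n d k r l t : ℕ}
    {X : Matrix (Fin n) (Fin d) ℝ} {w : ℕ → ℝ} {s : State} (hI : Inp X k r s)
    (h8 : s.nat 8 0 = l) (h4 : s.nat 4 0 = t) (h9 : s.nat 9 (4 * l + t) = 0)
    (h35 : ∀ j ≤ d, s.real 35 0 j = ∑ i ∈ Finset.range j, w i) :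
    ∃ s', locate.exec dec ω s = s' ∧ s'.nat 9 (4 * l + t) = pick w d (s.real 36 0 0) ∧
      (∀ u, u ≠ 4 * l + t → s'.nat 9 u = s.nat 9 u) ∧ s'.drawn = s.drawn ∧
      s'.time ≤ s.time + 6 + d * 100 := by
  have hv : (NExp.sub vd (.lit 1)).eval s = d - 1 := by
    simp [NExp.eval, vd, hI.d]
  have key := Prog.exec_loop_induct (dec := dec) (ω := ω) (x := 2) (e := .sub vd (.lit 1))
    (c := .ite (.ltR (.mul (.get 36 (.lit 0) (.lit 0)) (.get 35 (.lit 0) vd))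
        (.get 35 (.lit 0) (.add (nv 2) (.lit 1))))
      .skip
      (.setN 9 (.add v4 (nv 4)) (.add (.get 9 (.add v4 (nv 4))) (.lit 1)))) (s := s)
    (P := fun q s' => s'.real = s.real ∧ s'.nat 0 = s.nat 0 ∧ s'.nat 8 0 = l ∧ s'.nat 4 0 = t ∧
      s'.nat 9 (4 * l + t) = ((Finset.range q).filter fun j =>
        ∑ i ∈ Finset.range (j + 1), w i ≤
          s.real 36 0 0 * ∑ i ∈ Finset.range d, w i).card ∧
      (∀ u, u ≠ 4 * l + t → s'.nat 9 u = s.nat 9 u) ∧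
      s'.time ≤ s.time + 6 + q * 100) ?_ ?_
  · rw [hv] at key
    obtain ⟨-, -, -, -, h1, h2, h3⟩ := key
    refine ⟨_, rfl, h1, h2, Prog.exec_drawn (by decide) s, ?_⟩
    rw [locate]
    omega
  · exact ⟨rfl, rfl, h8, h4, by simpa [State.tick] using h9, fun u _ => rfl, by
      simp [State.tick, vd, NExp.cost]⟩
  · rintro q hq s' ⟨h1, h2, h3, h4', h5, h6, h7⟩
    rw [hv] at hq
    have hd : s'.nat 0 1 = d := by rw [h2]; exact hI.d
    obtain ⟨s₁, hs₁⟩ : ∃ s₁, s₁ = (s'.writeN 2 0 q).tick 1 := ⟨_, rfl⟩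
    have hr₁ : s₁.real = s.real := by rw [hs₁]; exact h1
    have hn₁ : ∀ a, a ≠ 2 → s₁.nat a = s'.nat a := fun a ha => by
      rw [hs₁]; funext i; simp [State.writeN, State.tick, ha]
    have ht₁ : s₁.time = s'.time + 1 := by rw [hs₁]; rfl
    have h2₁ : s₁.nat 2 0 = q := by rw [hs₁]; simp [State.writeN, State.tick]
    rw [← hs₁, Prog.exec]
    have hb : (BExp.ltR (.mul (.get 36 (.lit 0) (.lit 0)) (.get 35 (.lit 0) vd))
        (.get 35 (.lit 0) (.add (nv 2) (.lit 1)))).eval s₁ ↔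
        ¬ ∑ i ∈ Finset.range (q + 1), w i ≤
          s.real 36 0 0 * ∑ i ∈ Finset.range d, w i := by
      rw [not_le, ← h35 d le_rfl, ← h35 (q + 1) (by omega)]
      simp [BExp.eval, RExp.eval, nv, vd, NExp.eval, hr₁, h2₁, hn₁ 0 (by decide), hd]
    by_cases h : ∑ i ∈ Finset.range (q + 1), w i ≤
        s.real 36 0 0 * ∑ i ∈ Finset.range d, w i
    · rw [if_neg (fun h' => hb.1 h' h)]
      obtain ⟨s₂, hs₂⟩ : ∃ s₂, s₂ = s₁.tick
        ((BExp.ltR (.mul (.get 36 (.lit 0) (.lit 0)) (.get 35 (.lit 0) vd))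
        (.get 35 (.lit 0) (.add (nv 2) (.lit 1)))).cost + 1) := ⟨_, rfl⟩
      rw [← hs₂]
      have hn₂ : ∀ a, a ≠ 2 → s₂.nat a = s'.nat a := fun a ha => by rw [hs₂, ← hn₁ a ha]; rfl
      have hv₂ : (NExp.add v4 (nv 4)).eval s₂ = 4 * l + t := by
        rw [NExp.eval, v4_eval (l := l) (by rw [hn₂ 8 (by decide), h3])]
        simp [nv, NExp.eval, hn₂ 4 (by decide), h4']
      have hr₂ : s₂.real = s.real := by rw [hs₂]; exact hr₁
      have hv₂' : (NExp.add (.get 9 (.add v4 (nv 4))) (.lit 1)).eval s₂ =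
          s'.nat 9 (4 * l + t) + 1 := by
        rw [← hn₂ 9 (by decide), ← hv₂]; rfl
      rw [Prog.exec, hv₂, hv₂', h5]
      simp only [State.writeN, State.tick]
      refine ⟨hr₂, ?_, ?_, ?_, ?_, fun u hu => ?_, ?_⟩
      · funext i; simp [hn₂ 0 (by decide), h2]
      · simp [hn₂ 8 (by decide), h3]
      · simp [hn₂ 4 (by decide), h4']
      · rw [Finset.range_add_one, Finset.filter_insert, if_pos h,
          Finset.card_insert_of_notMem (by simp)]
        simp
      · simp [hu, hn₂ 9 (by decide), h6 u hu]
      · rw [hs₂]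
        simp only [State.tick, NExp.cost, BExp.cost, RExp.cost, nv, v4, vd]
        omega
    · rw [if_pos (hb.2 h)]
      simp only [Prog.exec, State.tick]
      refine ⟨hr₁, ?_, ?_, ?_, ?_, fun u hu => ?_, ?_⟩
      · rw [hn₁ 0 (by decide), h2]
      · rw [hn₁ 8 (by decide), h3]
      · rw [hn₁ 4 (by decide), h4']
      · rw [Finset.range_add_one, Finset.filter_insert, if_neg h, hn₁ 9 (by decide), h5]
      · rw [hn₁ 9 (by decide), h6 u hu]
      · simp only [NExp.cost, BExp.cost, RExp.cost, nv, vd]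
        omega

/-- Sample columns with probabilities proportional to the weights. -/
def sampling : Prog :=
  .loop 4 (.sub vr v4) (.seq (.rand 36 (.lit 0) (.lit 0))
    (.seq (.setN 9 (.add v4 (nv 4)) (.lit 0)) locate))

theorem sampling_run {dec : SVDRoutine} {ω : ℕ → unitInterval} {n d k r l : ℕ}
    {X : Matrix (Fin n) (Fin d) ℝ} {w : ℕ → ℝ} {s : State} (hI : Inp X k r s) (hd : 0 < d)
    (hl : 4 * l < r) (h8 : s.nat 8 0 = l) (hdr : s.drawn = 0)
    (h35 : ∀ j ≤ d, s.real 35 0 j = ∑ i ∈ Finset.range j, w i) :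
    ∃ s', sampling.exec dec ω s = s' ∧ (∀ u < 4 * l, s'.nat 9 u = s.nat 9 u) ∧
      (∀ t < r - 4 * l, s'.nat 9 (4 * l + t) = pick w d (ω t)) ∧
      s'.time ≤ s.time + 300 * (d * r) := by
  have hv : (NExp.sub vr v4).eval s = r - 4 * l := by
    rw [NExp.eval, v4_eval h8]
    simp [NExp.eval, vr, hI.r]
  have key := Prog.exec_loop_induct (dec := dec) (ω := ω) (x := 4) (e := .sub vr v4)
    (c := .seq (.rand 36 (.lit 0) (.lit 0))
      (.seq (.setN 9 (.add v4 (nv 4)) (.lit 0)) locate)) (s := s)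
    -- The count of drawn numbers equals the round, which identifies the number used in round `q` as
    -- `ω q`.
    (P := fun q s' => s'.drawn = q ∧ s'.real 0 = s.real 0 ∧ s'.real 35 = s.real 35 ∧
      s'.nat 0 = s.nat 0 ∧ s'.nat 8 = s.nat 8 ∧ (∀ u < 4 * l, s'.nat 9 u = s.nat 9 u) ∧
      (∀ t < q, s'.nat 9 (4 * l + t) = pick w d (ω t)) ∧
      s'.time ≤ s.time + 20 + q * (200 * d)) ?_ ?_
  · rw [hv] at key
    obtain ⟨-, -, -, -, -, h1, h2, h3⟩ := key
    refine ⟨_, rfl, h1, h2, h3.trans ?_⟩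
    have b1 : (r - 4 * l) * (200 * d) ≤ 200 * (d * r) := by
      calc (r - 4 * l) * (200 * d) ≤ r * (200 * d) := by gcongr; omega
        _ = _ := by ring
    have b2 : 1 ≤ d * r := Nat.mul_pos hd (by omega)
    omega
  · exact ⟨hdr, rfl, rfl, rfl, rfl, fun _ _ => rfl, fun t ht => absurd ht (by omega), by
      simp [State.tick, vr, v4, nv, NExp.cost]⟩
  · rintro q hq s' ⟨h1, h2, h3, h4, h5, h6, h7, h10⟩
    rw [hv] at hq
    obtain ⟨s₂, hs₂⟩ : ∃ s₂, s₂ = (Prog.rand 36 (.lit 0) (.lit 0)).exec dec ω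
      ((s'.writeN 4 0 q).tick 1) := ⟨_, rfl⟩
    obtain ⟨s₃, hs₃⟩ : ∃ s₃, s₃ = (Prog.setN 9 (.add v4 (nv 4)) (.lit 0)).exec dec ω s₂ :=
      ⟨_, rfl⟩
    rw [Prog.exec, Prog.exec, ← hs₂, ← hs₃]
    have hn₂ : ∀ a, a ≠ 4 → s₂.nat a = s'.nat a := fun a ha => by
      rw [hs₂]; funext i; simp [Prog.exec, State.writeN, State.writeR, State.tick, ha]
    have h4₂ : s₂.nat 4 0 = q := by
      rw [hs₂]; simp [Prog.exec, State.writeN, State.writeR, State.tick]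
    have hr₂ : ∀ a, a ≠ 36 → s₂.real a = s'.real a := fun a ha => by
      rw [hs₂, Prog.exec_real (by simpa [Prog.writesR] using ha)]; rfl
    have h36₂ : s₂.real 36 0 0 = ω q := by
      rw [hs₂]; simp [Prog.exec, State.writeN, State.writeR, State.tick, NExp.eval, h1]
    have hd₂ : s₂.drawn = q + 1 := by
      rw [hs₂]; simp [Prog.exec, State.writeN, State.writeR, State.tick, h1]
    have ht₂ : s₂.time = s'.time + 4 := by
      rw [hs₂]; simp [Prog.exec, State.writeN, State.writeR, State.tick, NExp.cost]
    have hv₂ : (NExp.add v4 (nv 4)).eval s₂ = 4 * l + q := by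
      rw [NExp.eval, v4_eval (l := l) (by rw [hn₂ 8 (by decide), h5, h8])]
      simp [nv, NExp.eval, h4₂]
    have hn₃ : ∀ a, a ≠ 9 → s₃.nat a = s₂.nat a := fun a ha => by
      rw [hs₃, Prog.exec_nat (by simpa [Prog.writesN] using ha)]
    have h9₃ : ∀ u, s₃.nat 9 u = if u = 4 * l + q then 0 else s₂.nat 9 u := fun u => by
      rw [hs₃, Prog.exec, hv₂]; simp [State.writeN, State.tick, NExp.eval]
    have hr₃ : s₃.real = s₂.real := by rw [hs₃]; rfl
    have hd₃ : s₃.drawn = s₂.drawn := by rw [hs₃]; rfl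
    have ht₃ : s₃.time ≤ s₂.time + 30 := by
      rw [hs₃]; simp [Prog.exec, State.writeN, State.tick, NExp.cost, v4, nv]
    obtain ⟨s₄, e₄, p₄, u₄, d₄, t₄⟩ := locate_run (dec := dec) (ω := ω) (s := s₃) (l := l)
      (t := q) (w := w) (hI.congr (by rw [hn₃ 0 (by decide), hn₂ 0 (by decide), h4])
        (by rw [hr₃, hr₂ 0 (by decide), h2]))
      (by rw [hn₃ 8 (by decide), hn₂ 8 (by decide), h5, h8]) (by rw [hn₃ 4 (by decide), h4₂])
      (by rw [h9₃, if_pos rfl])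
      (fun j hj => by rw [hr₃, hr₂ 35 (by decide), h3, h35 j hj])
    have hn₄ : ∀ a, a ≠ 2 → a ≠ 9 → s₄.nat a = s₃.nat a := fun a ha ha' => by
      rw [← e₄]; exact Prog.exec_nat (by simp [locate, Prog.writesN, ha, ha']) s₃
    have hr₄ : ∀ a, s₄.real a = s₃.real a := fun a => by
      rw [← e₄]; exact Prog.exec_real (by simp [locate, Prog.writesR]) s₃
    have h9₄ : ∀ u, u ≠ 4 * l + q → s₄.nat 9 u = s'.nat 9 u := fun u hu => by
      rw [u₄ u hu, h9₃, if_neg hu, hn₂ 9 (by decide)]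
    rw [e₄]
    refine ⟨by rw [d₄, hd₃, hd₂], ?_, ?_, ?_, ?_, fun u hu => ?_, fun t ht => ?_, ?_⟩
    · rw [hr₄, hr₃, hr₂ 0 (by decide), h2]
    · rw [hr₄, hr₃, hr₂ 35 (by decide), h3]
    · rw [hn₄ 0 (by decide) (by decide), hn₃ 0 (by decide), hn₂ 0 (by decide), h4]
    · rw [hn₄ 8 (by decide) (by decide), hn₃ 8 (by decide), hn₂ 8 (by decide), h5]
    · rw [h9₄ u (by omega), h6 u hu]
    · by_cases htq : t = q
      · rw [htq, p₄, hr₃, h36₂]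
      · rw [h9₄ _ (by omega), h7 t (by omega)]
    · rw [Nat.add_mul]
      omega

end SparseEncoder

namespace SparseEncoder

open Matrix

/-! ### Last part of the program: an encoder supported on the chosen columns -/

/-- The encoder `H` with `XH = U Jᵀ E` loses at most as much as any rank `k` approximation
in the column space of `C`. -/
theorem SVD.infoLoss_le_of_coords {n d r k N : ℕ} {C : Matrix (Fin n) (Fin r) ℝ} (D : SVD C)
    (X : Matrix (Fin n) (Fin d) ℝ) {J : Matrix (Fin N) (Fin C.rank) ℝ} (hJ : Jᵀ * J = 1)
    (E : SVD (J * (D.Uᵀ * X))) {H : Matrix (Fin d) (Fin k) ℝ}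
    (hH : X * H = D.U * (Jᵀ * E.leadU k)) (F : Matrix (Fin r) (Fin k) ℝ)
    (G : Matrix (Fin k) (Fin d) ℝ) :
    infoLoss H X ≤ frobSq (X - C * F * G) := by
  obtain ⟨P, hP⟩ : ∃ P, P = J * (D.Uᵀ * X) := ⟨_, rfl⟩
  obtain ⟨L, hL⟩ : ∃ L, L = E.leadU k := ⟨_, rfl⟩
  have hJP : Jᵀ * P = D.Uᵀ * X := by rw [hP, ← Matrix.mul_assoc, hJ, Matrix.one_mul]
  have h1 : frobSq (X - X * H * (Lᵀ * P)) =
      frobSq (X - D.U * (D.Uᵀ * X)) + frobSq (D.Uᵀ * X - Jᵀ * (L * (Lᵀ * P))) := by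
    rw [← frobSq_eq_proj_add D.orthU, hH, ← hL]
    simp only [Matrix.mul_assoc]
  have h2 : frobSq (X - C * F * G) =
      frobSq (X - D.U * (D.Uᵀ * X)) + frobSq (D.Uᵀ * X - D.Uᵀ * C * F * G) := by
    rw [← frobSq_eq_proj_add D.orthU]
    simp only [← Matrix.mul_assoc]
    rw [Matrix.mul_assoc D.U, D.U_mul_transpose_mul]
  -- `J` embeds the true coordinates into a block with extra zero rows. Its transpose contracts, so
  -- an approximation computed in the padded block is no worse in the true coordinates.
  have h3 : frobSq (Jᵀ * (P - L * (Lᵀ * P))) ≤ frobSq (P - L * (Lᵀ * P)) := by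
    have := frobSq_eq_proj_add hJ (P - L * (Lᵀ * P)) (0 : Matrix (Fin C.rank) (Fin d) ℝ)
    rw [Matrix.mul_zero, sub_zero, sub_zero] at this
    rw [this]
    linarith [frobSq_nonneg (P - L * (Lᵀ * P) - J * (Jᵀ * (P - L * (Lᵀ * P))))]
  have h4 : frobSq (P - L * (Lᵀ * P)) ≤ frobSq (P - J * (D.Uᵀ * C * F) * G) := by
    rw [hP, hL]
    -- Eckart–Young in coordinates: the competitor $CFG$ becomes a product with inner dimension $k$.
    exact E.frobSq_sub_leadU_le k (J * (D.Uᵀ * C * F)) G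
  have h5 : P - J * (D.Uᵀ * C * F) * G = J * (D.Uᵀ * X - D.Uᵀ * C * F * G) := by
    rw [hP, Matrix.mul_sub, Matrix.mul_assoc J (_ * F) G]
  rw [h5, frobSq_mul_left hJ] at h4
  rw [Matrix.mul_sub, hJP] at h3
  calc infoLoss H X ≤ frobSq (X - X * H * (Lᵀ * P)) := infoLoss_le H X _
    _ ≤ _ := by rw [h1, h2]; linarith

/-- The inclusion of the first `l` coordinates. -/
def inclMat (N l : ℕ) : Matrix (Fin N) (Fin l) ℝ :=
  Matrix.of fun i t => if (i : ℕ) = t then 1 else 0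

theorem transpose_inclMat_mul {N l q : ℕ} (h : l ≤ N) (M : Matrix (Fin N) (Fin q) ℝ) :
    (inclMat N l)ᵀ * M = M.submatrix (Fin.castLE h) id := by
  ext t j
  rw [Matrix.mul_apply, Finset.sum_eq_single (Fin.castLE h t)]
  · simp [inclMat]
  · intro b _ hb
    have : ¬ (b : ℕ) = t := fun h' => hb (Fin.ext h')
    simp [inclMat, this]
  · simp

theorem transpose_inclMat_mul_self {N l : ℕ} (h : l ≤ N) : (inclMat N l)ᵀ * inclMat N l = 1 := by
  rw [transpose_inclMat_mul h]
  ext i j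
  simp [inclMat, Matrix.one_apply, Fin.ext_iff]

/-- The coordinates of the input in the column space of the chosen columns. -/
noncomputable def coords (dec : SVDRoutine) {n d r : ℕ} (X : Matrix (Fin n) (Fin d) ℝ)
    (ι : Fin r → Fin d) : Matrix (Fin (min n r)) (Fin d) ℝ :=
  inclMat (min n r) (X.submatrix id ι).rank * ((dec n r (X.submatrix id ι)).Uᵀ * X)

/-- The encoder that the last part of the program computes from the chosen columns. -/
noncomputable def encOf (dec : SVDRoutine) {n d r : ℕ} (X : Matrix (Fin n) (Fin d) ℝ) (k : ℕ)
    (ι : Fin r → Fin d) : Matrix (Fin d) (Fin k) ℝ :=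
  (1 : Matrix (Fin d) (Fin d) ℝ).submatrix id ι *
    ((dec n r (X.submatrix id ι)).V *
      Matrix.diagonal (fun t => ((dec n r (X.submatrix id ι)).σ t)⁻¹) *
      ((inclMat (min n r) (X.submatrix id ι).rank)ᵀ * (dec _ _ (coords dec X ι)).leadU k))

/-- By construction $XH=C\cdot C^\dagger UJ^TL=UJ^TL$ for the chosen columns $C=U\Sigma V^T$ and the
leading left singular vectors $L$ of the coordinates. -/
theorem infoLoss_encOf_le (dec : SVDRoutine) {n d r k : ℕ} (X : Matrix (Fin n) (Fin d) ℝ)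
    (ι : Fin r → Fin d) (F : Matrix (Fin r) (Fin k) ℝ) (G : Matrix (Fin k) (Fin d) ℝ) :
    infoLoss (encOf dec X k ι) X ≤ frobSq (X - X.submatrix id ι * F * G) := by
  refine (dec n r (X.submatrix id ι)).infoLoss_le_of_coords X
    (transpose_inclMat_mul_self (rank_le_min _)) (dec _ _ (coords dec X ι)) ?_ F G
  have h : X * (1 : Matrix (Fin d) (Fin d) ℝ).submatrix id ι = X.submatrix id ι := by
    ext i j
    simp [Matrix.mul_apply, Matrix.one_apply]
  rw [encOf, ← Matrix.mul_assoc, h, ← Matrix.mul_assoc, SVD.mul_inv]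
  rfl

/-- The support of each column lies in the range of `ι`; repeated choices only make it smaller. -/
theorem isSparse_encOf (dec : SVDRoutine) {n d r k : ℕ} (X : Matrix (Fin n) (Fin d) ℝ)
    (ι : Fin r → Fin d) : IsSparse r (encOf dec X k ι) := by
  intro j
  have : {i | encOf dec X k ι i j ≠ 0} ⊆ Set.range ι := by
    intro i hi
    by_contra h
    refine hi ?_
    rw [encOf, Matrix.mul_apply]
    refine Finset.sum_eq_zero fun u _ => ?_
    have : i ≠ ι u := fun h' => h ⟨u, h'.symm⟩
    simp [this]
  refine (Set.ncard_le_ncard this (Set.finite_range ι)).trans ?_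
  rw [← Set.image_univ]
  refine (Set.ncard_image_le Set.finite_univ).trans ?_
  simp [Set.ncard_univ]

theorem SVD.sum_padU_transpose_mul {m n q : ℕ} {A : Matrix (Fin m) (Fin n) ℝ} (D : SVD A)
    (X : Matrix (Fin m) (Fin q) ℝ) {N : ℕ} (i : Fin N) (j : Fin q) :
    ∑ a : Fin m, D.padU a i * X a j = (inclMat N A.rank * (D.Uᵀ * X)) i j := by
  symm
  by_cases h : (i : ℕ) < A.rank
  · rw [Matrix.mul_apply, Finset.sum_eq_single ⟨i, h⟩]
    · rw [Matrix.mul_apply]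
      simp only [inclMat, Matrix.of_apply, if_true, one_mul, Matrix.transpose_apply]
      exact Finset.sum_congr rfl fun a _ => by rw [← D.padU_coe a ⟨i, h⟩]
    · intro b _ hb
      have : ¬ (i : ℕ) = b := fun h' => hb (Fin.ext h'.symm)
      simp [inclMat, this]
    · simp
  · rw [Matrix.mul_apply, Finset.sum_eq_zero, Finset.sum_eq_zero]
    · intro a _
      rw [D.padU_of_le (not_lt.1 h), zero_mul]
    · intro b _
      have : ¬ (i : ℕ) = b := fun h' => h (h' ▸ b.2)
      simp [inclMat, this]

theorem SVD.sum_padV_div_mul {m n N p q k : ℕ} {A : Matrix (Fin m) (Fin n) ℝ} (D : SVD A)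
    {B : Matrix (Fin p) (Fin q) ℝ} (E : SVD B) (hp : p = N) (hN : A.rank ≤ N) (i : Fin n)
    (j : Fin k) :
    ∑ c ∈ Finset.range N, D.padV i c / D.sv c * E.padU c j =
      (D.V * Matrix.diagonal (fun t => (D.σ t)⁻¹) *
        ((inclMat p A.rank)ᵀ * E.leadU k)) i j := by
  subst hp
  rw [transpose_inclMat_mul hN, Matrix.mul_apply, sum_fin_eq_sum_range_dite hN]
  refine Finset.sum_congr rfl fun c hc => ?_
  split_ifs with h
  · have h1 := D.padV_coe i ⟨c, h⟩
    have h2 := D.sv_coe ⟨c, h⟩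
    simp only at h1 h2
    rw [h1, h2, Matrix.mul_diagonal, div_eq_mul_inv]
    congr 1
    simp only [SVD.padU, SVD.leadU, Matrix.submatrix_apply, Matrix.of_apply, id]
    have hc' := Finset.mem_range.1 hc
    simp only [hc', true_and]
    rfl
  · rw [D.padV_of_le (not_lt.1 h), zero_div, zero_mul]

/-- The chosen columns. -/
def gatherChosen : Prog :=
  mat 37 vn vr (.lit 1) (.get 0 (nv 1) (.get 9 (nv 2)))

/-- The coordinates of the input in the column space of the chosen columns. -/
def chosenCoords : Prog :=
  mat 41 (minExp vn vr) vd vn (.mul (.get 38 (nv 3) (nv 1)) (.get 0 (nv 3) (nv 2)))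

/-- The encoder, in terms of the chosen columns. -/
def compactEncoder : Prog :=
  mat 45 vr vk (minExp vn vr)
    (.mul (.div (.get 40 (nv 1) (nv 3)) (.get 39 (.lit 0) (nv 3))) (.get 42 (nv 3) (nv 2)))

/-- Distribute the rows of the compact encoder. -/
def scatter : Prog :=
  mat 1 vd vk vr (.mul (eqExp (nv 1) (.get 9 (nv 3))) (.get 45 (nv 3) (nv 2)))

/-- Compute the encoder from the chosen columns. -/
def finish : Prog :=
  .seq gatherChosen (.seq (.svd 37 vn vr 38 39 40) (.seq chosenCoords
    (.seq (.svd 41 (minExp vn vr) vd 42 43 44) (.seq compactEncoder scatter))))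

theorem finish_run {dec : SVDRoutine} {ω : ℕ → unitInterval} {n d k r : ℕ}
    {X : Matrix (Fin n) (Fin d) ℝ} {ι : Fin r → Fin d} {s : State}
    (hI : Inp X k r s) (hn : 0 < n) (hd : 0 < d) (hkn : k ≤ n) (hkd : k ≤ d) (hkr : k < r)
    (h9 : ∀ u : Fin r, s.nat 9 u = ι u) :
    ∃ s', finish.exec dec ω s = s' ∧ s'.readBlock 1 d k = encOf dec X k ι ∧
      s'.time ≤ s.time + 4000 * (n * d * r + (n + d) * r ^ 2) := by
  obtain ⟨C, hC⟩ : ∃ C, C = X.submatrix id ι := ⟨_, rfl⟩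
  obtain ⟨s₁, e₁, A₁, v₁, t₁⟩ := mat_run (dec := dec) (ω := ω) (P := gatherChosen) rfl (s := s)
    (n := n) (m := r) (k := 1) (fun i j _ => padX X i (s.nat 9 j)) 100
    (fun s' h => by simp [vn, NExp.eval, h.2, hI.n])
    (fun s' h => by simp [vr, NExp.eval, h.2, hI.r])
    (fun s' h => rfl)
    (fun s' h _ _ _ => by simp [RExp.eval, NExp.eval, nv, h.1, h.2, hI.X])
    (by decide)
  have hI₁ := hI.agree A₁ (by decide)
  have h9₁ : s₁.nat 9 = s.nat 9 := A₁.2 9 (by decide) (by decide) (by decide)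
  obtain ⟨s₂, e₂, f₂, n₂, U₂, z₂, -, V₂, t₂⟩ := svd_run (dec := dec) (ω := ω) (a := 37)
    (p := vn) (q := vr) (u := 38) (z := 39) (v := 40) (s := s₁) (m := n) (n := r) (A := C)
    (by simp [vn, NExp.eval, hI₁.n]) (by simp [vr, NExp.eval, hI₁.r])
    (fun i j => by
      rw [v₁, if_pos ⟨i.2, j.2⟩, Finset.sum_range_one, h9 j, padX_coe, hC]; rfl)
    (by decide) (by decide) (by decide)
  obtain ⟨D, hD⟩ : ∃ D, D = dec _ _ C := ⟨_, rfl⟩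
  rw [← hD] at U₂ z₂ V₂
  have hI₂ : Inp X k r s₂ := hI₁.congr (by rw [n₂]) (f₂ 0 (by decide) (by decide) (by decide))
  obtain ⟨N, hN⟩ : ∃ N, N = min n r := ⟨_, rfl⟩
  rw [← hN] at U₂ z₂ V₂
  have hmin₀ : ∀ {s}, Inp X k r s → (minExp vn vr).eval s = N := fun {s} hI => by
    rw [minExp_eval, hN]
    simp [vn, vr, NExp.eval, hI.n, hI.r]
  have hmin : ∀ {dst s s'}, dst ≠ 0 → Agree dst s s' → Inp X k r s →
      (minExp vn vr).eval s' = N := fun {dst s s'} hd h hI => hmin₀ (hI.agree h hd.symm)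
  obtain ⟨s₃, e₃, A₃, v₃, t₃⟩ := mat_run (dec := dec) (ω := ω) (P := chosenCoords) rfl (s := s₂)
    (n := N) (m := d) (k := n) (fun i j a => D.padU a i * padX X a j) 100
    (fun s' h => hmin (by decide) h hI₂)
    (fun s' h => by simp [vd, NExp.eval, h.2, hI₂.d])
    (fun s' h => by simp [vn, NExp.eval, h.2, hI₂.n])
    (fun s' h h1 h2 h3 => by
      simp [RExp.eval, NExp.eval, nv, h.1, hI₂.X, U₂ _ h3 _ h1])
    (by decide)
  have hI₃ := hI₂.agree A₃ (by decide)
  obtain ⟨s₄, e₄, f₄, n₄, U₄, -, -, -, t₄⟩ := svd_run (dec := dec) (ω := ω) (a := 41)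
    (p := minExp vn vr) (q := vd) (u := 42) (z := 43) (v := 44) (s := s₃) (m := min n r) (n := d)
    (A := coords dec X ι)
    ((hmin₀ hI₃).trans hN) (by simp [vd, NExp.eval, hI₃.d])
    (fun i j => by
      rw [v₃, if_pos ⟨hN ▸ i.2, j.2⟩, coords, ← SVD.sum_padU_transpose_mul, Finset.sum_range]
      subst hC hD
      simp only [padX_coe])
    (by decide) (by decide) (by decide)
  obtain ⟨E, hE⟩ : ∃ E, E = dec _ _ (coords dec X ι) := ⟨_, rfl⟩
  rw [← hE] at U₄
  have hI₄ : Inp X k r s₄ := hI₃.congr (by rw [n₄]) (f₄ 0 (by decide) (by decide) (by decide))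
  have hr₄ : ∀ a, a ∉ [41, 42, 43, 44] → s₄.real a = s₂.real a := fun a ha => by
    simp only [List.mem_cons, List.not_mem_nil, or_false, not_or] at ha
    rw [f₄ a ha.2.1 ha.2.2.1 ha.2.2.2, A₃.1 a ha.1]
  have h9₄ : s₄.nat 9 = s.nat 9 := by
    rw [n₄, A₃.2 9 (by decide) (by decide) (by decide), n₂, h9₁]
  have hkN : k ≤ N := by rw [hN]; exact le_min hkn hkr.le
  obtain ⟨s₅, e₅, A₅, v₅, t₅⟩ := mat_run (dec := dec) (ω := ω) (P := compactEncoder) rfl (s := s₄)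
    (n := r) (m := k) (k := N) (fun i j c => D.padV i c / D.sv c * E.padU c j) 100
    (fun s' h => by simp [vr, NExp.eval, h.2, hI₄.r])
    (fun s' h => by simp [vk, NExp.eval, h.2, hI₄.k])
    (fun s' h => hmin (by decide) h hI₄)
    (fun s' h h1 h2 h3 => by
      simp only [RExp.eval, NExp.eval, nv, h.1 39 (by decide), h.1 40 (by decide),
        h.1 42 (by decide), hr₄ 39 (by decide), hr₄ 40 (by decide)]
      rw [V₂ _ h1 _ h3, z₂ _ h3, U₄ _ (hN ▸ h3) _ (by rw [← hN]; exact lt_min (by omega) (by omega))])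
    (by decide)
  have hI₅ := hI₄.agree A₅ (by decide)
  have h9₅ : s₅.nat 9 = s.nat 9 := by
    rw [A₅.2 9 (by decide) (by decide) (by decide), h9₄]
  obtain ⟨s₆, e₆, A₆, v₆, t₆⟩ := mat_run (dec := dec) (ω := ω) (P := scatter) rfl (s := s₅)
    (n := d) (m := k) (k := r)
    -- A column may be chosen more than once; its rows of the compact encoder are then added,
    -- exactly as the product with the selection matrix does.
    (fun i j u => (if i = s.nat 9 u then 1 else 0) * s₅.real 45 u j) 100
    (fun s' h => by simp [vd, NExp.eval, h.2, hI₅.d])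
    (fun s' h => by simp [vk, NExp.eval, h.2, hI₅.k])
    (fun s' h => by simp [vr, NExp.eval, h.2, hI₅.r])
    (fun s' h _ _ _ => by
      simp only [RExp.eval, NExp.eval, eqExp_eval, nv, h.1 45 (by decide),
        h.2 9 (by decide) (by decide) (by decide), h9₅])
    (by decide)
  refine ⟨s₆, ?_, ?_, ?_⟩
  · rw [finish, Prog.exec, e₁, Prog.exec, e₂, Prog.exec, e₃, Prog.exec, e₄, Prog.exec, e₅, e₆]
  · ext i j
    rw [State.readBlock, Matrix.of_apply, v₆, if_pos ⟨i.2, j.2⟩, encOf, Matrix.mul_apply,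
      Finset.sum_range]
    refine Finset.sum_congr rfl fun u _ => ?_
    rw [h9 u, v₅, if_pos (⟨u.2, j.2⟩ : (u : ℕ) < r ∧ (j : ℕ) < k),
      D.sum_padV_div_mul E hN.symm (hN ▸ rank_le_min C)]
    subst hC hD hE
    simp only [Matrix.submatrix_apply, Matrix.one_apply, id, Fin.val_inj]
  · simp only [vn, vr, vd, minExp, NExp.cost] at t₂ t₄
    have hNr : N ≤ r := by rw [hN]; exact min_le_right _ _
    have b1 : (n + 1) * (r + 1) * (1 + 1) ≤ 8 * (n * d * r) := by
      calc (n + 1) * (r + 1) * (1 + 1) ≤ (2 * n) * (2 * r) * (2 * d) := by gcongr <;> omega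
        _ = _ := by ring
    have b2 : n * r * min n r ≤ n * r ^ 2 := by
      rw [← hN]
      calc n * r * N ≤ n * r * r := by gcongr
        _ = _ := by ring
    have b3 : (N + 1) * (d + 1) * (n + 1) ≤ 8 * (n * d * r) := by
      calc (N + 1) * (d + 1) * (n + 1) ≤ (2 * r) * (2 * d) * (2 * n) := by gcongr <;> omega
        _ = _ := by ring
    have b4 : min n r * d * min (min n r) d ≤ d * r ^ 2 := by
      rw [← hN]
      calc N * d * min N d ≤ r * d * r := by
            gcongr
            exact (min_le_left _ _).trans hNr
        _ = _ := by ring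
    have b5 : (r + 1) * (k + 1) * (N + 1) ≤ 8 * (d * r ^ 2) := by
      calc (r + 1) * (k + 1) * (N + 1) ≤ (2 * r) * (2 * d) * (2 * r) := by gcongr <;> omega
        _ = _ := by ring
    have b6 : (d + 1) * (k + 1) * (r + 1) ≤ 8 * (d * r ^ 2) := by
      calc (d + 1) * (k + 1) * (r + 1) ≤ (2 * d) * (2 * r) * (2 * r) := by gcongr <;> omega
        _ = _ := by ring
    have b7 : 1 ≤ n * d * r := Nat.mul_pos (Nat.mul_pos hn hd) (by omega)
    rw [Nat.add_mul n d]
    omega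

end SparseEncoder

namespace SparseEncoder

open Matrix MeasureTheory ProbabilityTheory

/-! ### The expected loss -/

/-- A sampled residual column is a chosen column of $X$ minus a combination of the columns selected
before, so the estimator of $RV$ lies in the span of all chosen columns. -/
theorem exists_mul_eq_sampleMat {n d k p s : ℕ} {X R : Matrix (Fin n) (Fin d) ℝ}
    {ι : Fin p → Fin d} {W : Matrix (Fin p) (Fin d) ℝ} (hR : R = X - X.submatrix id ι * W)
    (V : Matrix (Fin d) (Fin k) ℝ) (τ : Fin s → Fin d) :
    ∃ F : Matrix (Fin (p + s)) (Fin k) ℝ, X.submatrix id (Fin.append ι τ) * F =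
      X.submatrix id ι * W * V + sampleMat R V τ := by
  obtain ⟨K, hK⟩ : ∃ K : Matrix (Fin s) (Fin k) ℝ, ∀ u j, K u j =
      1 / (s : ℝ) * (V (τ u) j * (frobSq R / colSq R (τ u))) := ⟨Matrix.of _, fun _ _ => rfl⟩
  have hS : sampleMat R V τ =
      X.submatrix id τ * K - X.submatrix id ι * (W.submatrix id τ * K) := by
    have : sampleMat R V τ = R.submatrix id τ * K := by
      ext a j
      rw [sampleMat, Matrix.of_apply, Matrix.mul_apply, Finset.mul_sum]
      refine Finset.sum_congr rfl fun u _ => ?_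
      rw [hK, Matrix.submatrix_apply, id]
      ring
    rw [this, ← Matrix.mul_assoc, ← Matrix.sub_mul]
    congr 1
    rw [hR]
    rfl
  refine ⟨Matrix.of (Fin.append (W * V - W.submatrix id τ * K) K), ?_⟩
  rw [hS, Matrix.mul_assoc, add_sub_assoc', add_sub_right_comm, ← Matrix.mul_sub]
  ext a j
  rw [Matrix.mul_apply, Fin.sum_univ_add, Matrix.add_apply, Matrix.mul_apply, Matrix.mul_apply]
  simp only [Matrix.submatrix_apply, Fin.append_left, Fin.append_right]
  exact congrArg₂ (· + ·)
    (Finset.sum_congr rfl fun i _ => congrArg _ (congrFun (Fin.append_left _ _ i) j))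
    (Finset.sum_congr rfl fun i _ => congrArg _ (congrFun (Fin.append_right _ _ i) j))

/-- The comparison matrix is $(X_\iota WV+S)V^T$ with the estimator $S$ of $RV$. As $XV=X_\iota
WV+RV$, it misses $XVV^T$ by $(RV-S)V^T$, whose rows are orthogonal to those of $X-XVV^T$. -/
theorem infoLoss_encOf_append_le (dec : SVDRoutine) {n d k p s : ℕ}
    {X R : Matrix (Fin n) (Fin d) ℝ} {ι : Fin p → Fin d} {W : Matrix (Fin p) (Fin d) ℝ}
    (hR : R = X - X.submatrix id ι * W) {V : Matrix (Fin d) (Fin k) ℝ} (hV : Vᵀ * V = 1)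
    (τ : Fin s → Fin d) :
    infoLoss (encOf dec X k (Fin.append ι τ)) X ≤
      frobSq (X - X * V * Vᵀ) + frobSq (R * V - sampleMat R V τ) := by
  obtain ⟨F, hF⟩ := exists_mul_eq_sampleMat hR V τ
  refine (infoLoss_encOf_le dec X _ F Vᵀ).trans (le_of_eq ?_)
  have h1 : X - X.submatrix id (Fin.append ι τ) * F * Vᵀ =
      (X - X * V * Vᵀ) + (R * V - sampleMat R V τ) * Vᵀ := by
    have : X * V = X.submatrix id ι * W * V + R * V := by
      rw [← Matrix.add_mul, hR, add_sub_cancel]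
    rw [hF, this]
    simp only [Matrix.add_mul, Matrix.sub_mul]
    abel
  rw [h1, frobSq_add_of_mul_transpose_eq_zero, frobSq_mul_right hV]
  rw [Matrix.transpose_mul, Matrix.transpose_transpose, ← Matrix.mul_assoc, Matrix.sub_mul,
    Matrix.mul_assoc (X * V), hV, Matrix.mul_one, sub_self, Matrix.zero_mul]

theorem integral_infoLoss_encOf_le (dec : SVDRoutine) {n d k p s : ℕ}
    {X R : Matrix (Fin n) (Fin d) ℝ} {ι : Fin p → Fin d} {W : Matrix (Fin p) (Fin d) ℝ}
    {w : ℕ → ℝ} (hR : R = X - X.submatrix id ι * W) (hk : k ≤ X.rank) (hs : 0 < s)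
    (hw : ∀ i, 0 ≤ w i) (hwR : ∀ i : Fin d, w i = colSq R i) {f : unitInterval → Fin d}
    (hf : ∀ u : unitInterval, (f u : ℕ) = pick w d u) :
    Integrable (fun ω : ℕ → unitInterval =>
      infoLoss (encOf dec X k (Fin.append ι fun l : Fin s => f (ω l))) X) coins ∧
    ∫ ω : ℕ → unitInterval,
      infoLoss (encOf dec X k (Fin.append ι fun l : Fin s => f (ω l))) X ∂coins ≤
      frobSq (X - bestRank X k) + k / s * frobSq R := by
  obtain ⟨V, hV, hVX⟩ := exists_bestRank_eq X hk
  have hfm : Measurable f := by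
    refine measurable_to_countable' fun i => ?_
    have : f ⁻¹' {i} = (fun u : unitInterval => pick w d u) ⁻¹' {(i : ℕ)} := by
      ext u
      simp [← hf, Fin.ext_iff]
    rw [this]
    exact measurable_pick w d (measurableSet_singleton _)
  have hτ : Measurable fun (ω : ℕ → unitInterval) (l : Fin s) => f (ω l) :=
    measurable_pi_lambda _ fun l => hfm.comp (measurable_pi_apply _)
  have hi := integrable_comp_of_finite (μ := coins) hτ fun τ =>
    infoLoss (encOf dec X k (Fin.append ι τ)) X
  have hi' := integrable_comp_of_finite (μ := coins) hτ fun τ =>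
    frobSq (R * V - sampleMat R V τ)
  refine ⟨hi, ?_⟩
  have h1 : ∫ ω : ℕ → unitInterval,
      frobSq (R * V - sampleMat R V fun l : Fin s => f (ω l)) ∂coins ≤ k / s * frobSq R := by
    have hsum : ∑ j ∈ Finset.range d, w j = frobSq R := by
      rw [Finset.sum_range, ← sum_colSq]
      exact Finset.sum_congr rfl fun i _ => hwR i
    -- If the residual vanishes the sampling distribution is undefined, but the estimator is exactly
    -- zero.
    rcases (frobSq_nonneg R).eq_or_lt with h0 | h0
    · have hz : R = 0 := by
        ext a i
        have := (Finset.sum_eq_zero_iff_of_nonneg fun i _ => colSq_nonneg R i).1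
          ((sum_colSq R).trans h0.symm) i (Finset.mem_univ i)
        exact eq_zero_of_colSq_eq_zero this a
      have hz' : ∀ τ : Fin s → Fin d, R * V - sampleMat R V τ = 0 := fun τ => by
        ext a j
        simp [hz, sampleMat]
      simp only [hz']
      have : frobSq (0 : Matrix (Fin n) (Fin k) ℝ) = 0 := by simp [frobSq]
      rw [← h0, this]
      simp
    · refine integral_sampleMat_le h0 hV hs hfm fun i => ?_
      have : f ⁻¹' {i} = {u : unitInterval | pick w d u = i} := by
        ext u
        simp [← hf, Fin.ext_iff]
      rw [this, volume_pick hw i.2 (hsum ▸ h0), hsum, hwR]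
  calc _ ≤ ∫ ω : ℕ → unitInterval, (frobSq (X - bestRank X k) +
          frobSq (R * V - sampleMat R V fun l : Fin s => f (ω l))) ∂coins := by
        refine integral_mono hi ((integrable_const _).add hi') fun ω => ?_
        rw [← hVX]
        exact infoLoss_encOf_append_le dec hR hV _
    _ = frobSq (X - bestRank X k) + ∫ ω : ℕ → unitInterval,
          frobSq (R * V - sampleMat R V fun l : Fin s => f (ω l)) ∂coins := by
        rw [integral_add (integrable_const _) hi']
        simp
    _ ≤ _ := by linarith

/-! ### The program -/

/-- The deterministic part of the program. -/
def preprocess : Prog :=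
  .seq findBasis (.seq selectColumns prepare)

theorem preprocess_run {dec : SVDRoutine} {ω : ℕ → unitInterval} {n d k r : ℕ}
    {X : Matrix (Fin n) (Fin d) ℝ} (hn : 0 < n) (hd : 0 < d) (hk : k ≤ X.rank)
    (hkr : 5 * k < r) :
    ∃ (s' : State) (l : ℕ) (ι : ℕ → Fin d) (R : Matrix (Fin n) (Fin d) ℝ)
      (W : Matrix (Fin (4 * l)) (Fin d) ℝ) (w : ℕ → ℝ),
      preprocess.exec dec ω (initState X k r) = s' ∧ Inp X k r s' ∧ l ≤ k ∧ s'.nat 8 0 = l ∧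
      s'.drawn = 0 ∧ (∀ u < 4 * l, s'.nat 9 u = ι u) ∧
      R = X - X.submatrix id (fun u : Fin (4 * l) => ι u) * W ∧
      ((r : ℝ) - k) * frobSq R ≤ 5 * r * frobSq (X - bestRank X k) ∧
      (∀ i, 0 ≤ w i) ∧ (∀ i : Fin d, w i = colSq R i) ∧
      (∀ j ≤ d, s'.real 35 0 j = ∑ i ∈ Finset.range j, w i) ∧
      s'.time ≤ 44000 * (n * d * r + (n + d) * r ^ 2 + d * k ^ 3) := by
  have hI := inp_init X k r
  have h0 : ∀ a, a ≠ 0 → ∀ i j, (initState X k r).real a i j = 0 := fun a ha i j => by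
    simp [initState, ha]
  obtain ⟨s₁, l, Z, e₁, hI₁, hl, hZ, hZX, h8, h9, t₁⟩ := findBasis_run (dec := dec) (ω := ω) hI
    hn hd hk (by omega) rfl rfl rfl rfl (h0 2 (by decide)) (h0 5 (by decide))
  have hkd : k ≤ d := hk.trans ((rank_le_min X).trans (min_le_right _ _))
  obtain ⟨s₂, ι, W', e₂, hι, hW', t₂⟩ := selectColumns_run (dec := dec) (ω := ω) hI₁ hn hd
    (by omega) (by omega) hZ h8 h9
  have hI₂ : Inp X k r s₂ := by
    rw [← e₂]; exact hI₁.congr (Prog.exec_nat (by decide) _) (Prog.exec_real (by decide) _)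
  have h8₂ : s₂.nat 8 0 = l := by rw [← e₂, Prog.exec_nat (by decide), h8]
  have h35 : s₂.real 35 0 0 = 0 := by
    rw [← e₂, Prog.exec_real (by decide), ← e₁, Prog.exec_real (by decide), h0 35 (by decide)]
  obtain ⟨s₃, R, W, w, e₃, hR, hRW, hw, hwR, h35₃, t₃⟩ := prepare_run (dec := dec) (ω := ω) hI₂
    hn hd (by omega) h8₂ hι h35
  have e : preprocess.exec dec ω (initState X k r) = s₃ := by
    rw [preprocess, Prog.exec, e₁, Prog.exec, e₂, e₃]
  refine ⟨s₃, l, ι, R, W, w, e, ?_, hl, ?_, ?_, ?_, hR, ?_, hw, hwR, h35₃, ?_⟩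
  · rw [← e₃]; exact hI₂.congr (Prog.exec_nat (by decide) _) (Prog.exec_real (by decide) _)
  · rw [← e₃, Prog.exec_nat (by decide), h8₂]
  · rw [← e]; exact Prog.exec_drawn (by decide) _
  · intro u hu
    rw [← e₃, Prog.exec_nat (by decide), hι u hu]
  · have h1 := (hRW W').trans hW'
    have h2 : (0 : ℝ) ≤ r - k := by
      have : (k : ℝ) ≤ r := by exact_mod_cast (by omega : k ≤ r)
      linarith
    nlinarith [mul_le_mul_of_nonneg_left h1 h2]
  · have ht : (initState X k r).time = 0 := rfl
    have b : d * l ^ 3 ≤ d * k ^ 3 := by gcongr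
    have c : (n + d) * r ^ 2 = n * r * r + r * r * d := by ring
    rw [c]
    omega

/-- The program: choose columns, and compute an encoder that is supported on them. -/
def encoderProg : Prog :=
  .seq preprocess (.seq sampling finish)

theorem bound_of_residual {k r s R O : ℝ} (hk : 0 ≤ k) (hr : 5 * k < r) (hs : r - 4 * k ≤ s)
    (hO : 0 ≤ O) (hR : (r - k) * R ≤ 5 * r * O) :
    O + k / s * R ≤ (1 + 5 * k / (r - 5 * k)) * O := by
  have h1 : 0 < r - 5 * k := by linarith
  have h2 : 0 < r - 4 * k := by linarith
  have h3 : 0 < r - k := by linarith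
  have hs0 : 0 < s := by linarith
  have hR' : R ≤ 5 * r * O / (r - k) := by
    rw [le_div_iff₀ h3]; linarith
  have h4 : k / s * R ≤ k / (r - 4 * k) * (5 * r * O / (r - k)) := by
    have h5 : 0 ≤ 5 * r * O / (r - k) := by
      have : 0 ≤ r := by linarith
      positivity
    calc k / s * R ≤ k / s * (5 * r * O / (r - k)) := by gcongr
      _ ≤ _ := by gcongr
  have h6 : k / (r - 4 * k) * (5 * r * O / (r - k)) ≤ 5 * k / (r - 5 * k) * O := by
    -- Here $(r-4k)(r-k)=r(r-5k)+4k^2$.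
    have h7 : r / ((r - 4 * k) * (r - k)) ≤ 1 / (r - 5 * k) := by
      rw [div_le_div_iff₀ (by positivity) h1]
      nlinarith [sq_nonneg k]
    calc k / (r - 4 * k) * (5 * r * O / (r - k))
        = 5 * k * O * (r / ((r - 4 * k) * (r - k))) := by field_simp
      _ ≤ 5 * k * O * (1 / (r - 5 * k)) := by gcongr
      _ = _ := by ring
  linarith

theorem encoderProg_spec (dec : SVDRoutine) {n d k r : ℕ} (X : Matrix (Fin n) (Fin d) ℝ)
    (hn : 0 < n) (hd : 0 < d) (hk : k ≤ X.rank) (hkr : 5 * k < r) :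
    (∀ ω, encoderProg.runTime dec X k r ω ≤
      50000 * (n * d * r + (n + d) * r ^ 2 + d * k ^ 3)) ∧
    (∀ ω, IsSparse r (encoderProg.encoder dec X k r ω)) ∧
    Integrable (fun ω => infoLoss (encoderProg.encoder dec X k r ω) X) coins ∧
    ∫ ω, infoLoss (encoderProg.encoder dec X k r ω) X ∂coins ≤
      (1 + 5 * (k : ℝ) / ((r : ℝ) - 5 * (k : ℝ))) * frobSq (X - bestRank X k) := by
  obtain ⟨s₁, l, ι, R, W, w, e₁, hI₁, hl, h8, hdr, h9, hR, hRX, hw, hwR, h35, t₁⟩ :=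
    preprocess_run (dec := dec) (ω := fun _ => 0) hn hd hk hkr
  have hkn : k ≤ n := hk.trans ((rank_le_min X).trans (min_le_left _ _))
  have hkd : k ≤ d := hk.trans ((rank_le_min X).trans (min_le_right _ _))
  -- All columns not spent on the barrier method are sampled: $q=r-4l\ge r-4k>0$.
  obtain ⟨q, rfl⟩ : ∃ q, r = 4 * l + q := ⟨r - 4 * l, by omega⟩
  obtain ⟨f, hf⟩ : ∃ f : unitInterval → Fin d, ∀ u : unitInterval, (f u : ℕ) = pick w d u :=
    ⟨fun u => ⟨pick w d u, pick_lt hd u⟩, fun _ => rfl⟩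
  have key : ∀ ω, encoderProg.encoder dec X k (4 * l + q) ω =
        encOf dec X k (Fin.append (fun u : Fin (4 * l) => ι u) fun t : Fin q => f (ω t)) ∧
      encoderProg.runTime dec X k (4 * l + q) ω ≤
        50000 * (n * d * (4 * l + q) + (n + d) * (4 * l + q) ^ 2 + d * k ^ 3) := fun ω => by
    have e₁' : preprocess.exec dec ω (initState X k (4 * l + q)) = s₁ := by
      rw [← e₁]; exact Prog.exec_congr_coins (by decide) _ _
    obtain ⟨s₂, e₂, u₂, p₂, t₂⟩ := sampling_run (dec := dec) (ω := ω) hI₁ hd (by omega) h8 hdr h35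
    have hI₂ : Inp X k (4 * l + q) s₂ := by
      rw [← e₂]; exact hI₁.congr (Prog.exec_nat (by decide) _) (Prog.exec_real (by decide) _)
    obtain ⟨s₃, e₃, r₃, t₃⟩ := finish_run (dec := dec) (ω := ω)
      (ι := Fin.append (fun u : Fin (4 * l) => ι u) fun t : Fin q => f (ω t)) hI₂ hn hd hkn hkd
      (by omega) (fun u => by
        refine Fin.addCases (fun u => ?_) (fun t => ?_) u
        · rw [Fin.append_left, Fin.val_castAdd, u₂ u u.2, h9 u u.2]
        · rw [Fin.append_right, Fin.val_natAdd, p₂ t (by omega), hf])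
    have e : encoderProg.run dec X k (4 * l + q) ω = s₃ := by
      rw [Prog.run, encoderProg, Prog.exec, e₁', Prog.exec, e₂, e₃]
    refine ⟨by rw [Prog.encoder, e, r₃], ?_⟩
    rw [Prog.runTime, e]
    have b : d * (4 * l + q) ≤ n * d * (4 * l + q) := by
      rw [Nat.mul_assoc]; exact Nat.le_mul_of_pos_left _ hn
    omega
  simp only [fun ω => (key ω).1]
  have hq : 0 < q := by omega
  obtain ⟨hi, hE⟩ := integral_infoLoss_encOf_le dec hR hk hq hw hwR hf
  refine ⟨fun ω => (key ω).2, fun ω => isSparse_encOf dec X _, hi, hE.trans ?_⟩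
  refine bound_of_residual (Nat.cast_nonneg k) (by exact_mod_cast hkr) ?_ (frobSq_nonneg _) hRX
  have : (l : ℝ) ≤ k := by exact_mod_cast hl
  push_cast
  linarith

end SparseEncoder

theorem theorem2p4 :
    ∃ (P : SparseEncoder.Prog) (C : ℕ),
      ∀ (dec : SparseEncoder.SVDRoutine) (n d k r : ℕ) (X : Matrix (Fin n) (Fin d) ℝ),
      0 < n → 0 < d → k ≤ X.rank → 5 * k < r →
      (∀ ω, P.runTime dec X k r ω ≤ C * (n * d * r + (n + d) * r ^ 2 + d * k ^ 3)) ∧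
      (∀ ω, SparseEncoder.IsSparse r (P.encoder dec X k r ω)) ∧
      MeasureTheory.Integrable
        (fun ω => SparseEncoder.infoLoss (P.encoder dec X k r ω) X) SparseEncoder.coins ∧
      ∫ ω, SparseEncoder.infoLoss (P.encoder dec X k r ω) X ∂SparseEncoder.coins ≤
        (1 + 5 * (k : ℝ) / ((r : ℝ) - 5 * (k : ℝ))) *
          SparseEncoder.frobSq (X - SparseEncoder.bestRank X k) := by
  exact ⟨SparseEncoder.encoderProg, 50000, fun dec _ _ _ _ X hn hd hk hkr =>
    SparseEncoder.encoderProg_spec dec X hn hd hk hkr⟩
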